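/- Let $d\in\{2,3\}$, let $\Omega\subset\mathbb R^d$ be a bounded open set and $T>0$. Let $a=a(t,x,s)$ be a scalar function, uniformly continuous on $[0,T]\times\bar\Omega\times[0,\infty)$, for which there are constants $\underline a,\bar a>0$ with $$|a(t,x,|y|)y-a(t,x,|z|)z|\le \bar a|y-z|,\qquad (a(t,x,|y|)y-a(t,x,|z|)z)\cdot(y-z)\ge\underline a|y-z|^2$$ for all $y,z\in\mathbb R^d$, $(t,x)\in[0,T]\times\bar\Omega$. Write $\alpha(v)=a(t,\cdot,|\nabla v|)\nabla v$, let $\langle\cdot,\cdot\rangle$ and $\|\cdot\|$ be the inner product and norm of $L^2(\Omega)$, and let $\|\psi\|_{-1}=\sup\{|\langle\psi,v\rangle|: v\in H^1_0(\Omega),\ \|\nabla v\|\le 1\}$. Let $f\in L^\infty(0,T;L^2(\Omega))$, $u_0\in L^2(\Omega)$, and let $u\in C([0,T];L^2(\Omega))\cap L^2(0,T;H^1_0(\Omega))$ be the weak solution of $u_t-\nabla\cdot(a(t,x,|\nabla u|)\nabla u)=f$ in $(0,T]\times\Omega$, $u=0$ on $\partial\Omega$, $u(0)=u_0$. Let $\mathcal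 T$ be a finite subdivision of $\Omega$ into closed (possibly curved, possibly with hanging nodes) quadrilateral/hexahedral elements $\kappa=F_\kappa([-1,1]^d)$ with pairwise disjoint interiors contained in $\Omega$ and union $\bar\Omega$, where each $F_\kappa$ is a $C^\infty$-diffeomorphism of the closed cube onto $\kappa$. For $p\in\mathbb N$ let $S^p$ be the space of all $v\in L^2(\Omega)$ such that, for every $\kappa$, $v|_\kappa\circ F_\kappa$ is a polynomial of degree at most $p$ in each variable. Let $\Gamma$ be the union of the element faces. On a face $e\subset\Omega$ shared by $\kappa^\pm$ with outward unit normals $\mathbf n^\pm$, let $[v]=v^+\mathbf n^++v^-\mathbf n^-$ and $\{\phi\}=\frac12(\phi^++\phi^-)$; on $e\subset\partial\kappa\cap\partial\Omega$ let $[v]=v^+\mathbf n^+$, $\{\phi\}=\phi^+$. Let $h=\operatorname{diam}\kappa$ on $\kappa$, $h=\{h\}$ on $\Gamma$, $\sigma=C_\sigma p^2/h$ on $\Gamma$ with $C_\sigma>0$, and $\theta\in\{-1,0,1\}$. For $W,V\in S^p$ let $$B(W,V)=\sum_{\kappa}\int_\kappa\alpha(W)\cdot\nabla V\,dx+\int_\Gamma\Big(\theta\{a(t,x,h^{-1}|[W]|)\nabla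 V\}\cdot[W]-\{\alpha(W)\}\cdot[V]+\sigma[W]\cdot[V]\Big)ds,$$ and for $v\in H^1_0(\Omega)+S^p$ let $$|||v|||=\Big(\sum_\kappa\|\nabla v\|_{L^2(\kappa)}^2+\int_\Gamma\sigma|[v]|^2ds\Big)^{1/2},\qquad \|v\|_{L^2(0,T;H^1(\Omega))}=\Big(\int_0^T|||v(t)|||^2dt\Big)^{1/2}.$$ Let $U:[0,T]\to S^p$ be absolutely continuous and solve, for a.e. $t\in(0,T]$, the interior penalty method $\langle U_t,V\rangle+B(U,V)=\langle f,V\rangle$ for all $V\in S^p$. For a.e. $t$ let $w(t)\in H^1_0(\Omega)$ be the elliptic reconstruction of $U(t)$, i.e. $\langle\alpha(w),\nabla v\rangle=\langle -AU+f-\Pi f,v\rangle$ for all $v\in H^1_0(\Omega)$, where $\Pi$ is the orthogonal $L^2$-projection onto $S^p$ and $AU\in S^p$ is defined by $\langle -AU,V\rangle=B(U,V)$ for all $V\in S^p$. Put $e=U-u$ and $\epsilon=w-U$. Finally let $U=U^c+U^d$ with $U^c(t)\in S^p\cap H^1_0(\Omega)$ for all $t\in[0,T]$ and with $U^d:[0,T]\to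 S^p$ absolutely continuous. **Theorem.** Under these assumptions (both sides being allowed to be $+\infty$), $$\|e\|_{L^2(0,T;H^1(\Omega))}\le C_1\|\epsilon\|_{L^2(0,T;H^1(\Omega))}+\underline a^{-1/2}\big(\|u_0-U(0)\|+\|U^d(0)\|\big)+C_1\|U^d\|_{L^2(0,T;H^1(\Omega))}+C_2\|U^d_t\|_{L^2(0,T;H^{-1}(\Omega))},$$ where $C_1=1+\sqrt2\,\bar a\,\underline a^{-1}$ and $C_2=\sqrt2\,\underline a^{-1}$. -/

import Mathlib

open MeasureTheory Set Filter Topology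
open scoped ENNReal ContDiff

namespace IPDG

noncomputable section

/-- `ℝ^d` with its Euclidean norm. -/
abbrev E (d : ℕ) : Type := EuclideanSpace ℝ (Fin d)

/-- The space `L²(Ω)`. -/
abbrev L2 {d : ℕ} (Ω : Set (E d)) : Type := Lp ℝ 2 (volume.restrict Ω)

/-- The space `L²(Ω)^d` of vector fields. -/
abbrev L2v {d : ℕ} (Ω : Set (E d)) : Type := Lp (E d) 2 (volume.restrict Ω)

/-! ### The spaces `H¹₀(Ω)` and `H⁻¹(Ω)` -/

/-- The pairs `(v, ∇v)` with `v ∈ H¹₀(Ω)`: the closure in `L²(Ω) × L²(Ω)^d` of the pairs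
`(φ, ∇φ)` with `φ ∈ C_c^∞(Ω)`. -/
def H10Graph {d : ℕ} (Ω : Set (E d)) : Set (L2 Ω × L2v Ω) :=
  closure {P | ∃ φ : E d → ℝ, ContDiff ℝ ∞ φ ∧ HasCompactSupport φ ∧ tsupport φ ⊆ Ω ∧
    P.1 =ᵐ[volume.restrict Ω] φ ∧ P.2 =ᵐ[volume.restrict Ω] gradient φ}

/-- `H¹₀(Ω)`, as a subset of `L²(Ω)`. -/
def H10 {d : ℕ} (Ω : Set (E d)) : Set (L2 Ω) := {v | ∃ G, (v, G) ∈ H10Graph Ω}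

open Classical in
/-- The weak gradient of `v ∈ H¹₀(Ω)` (which is unique); zero by convention if `v ∉ H¹₀(Ω)`. -/
def grad {d : ℕ} (Ω : Set (E d)) (v : L2 Ω) : L2v Ω :=
  if h : ∃ G, (v, G) ∈ H10Graph Ω then h.choose else 0

/-- The `H⁻¹(Ω)`-norm of `ψ ∈ L²(Ω)`: the dual norm of `H¹₀(Ω)` normed by `‖∇v‖`. -/
def negNorm {d : ℕ} (Ω : Set (E d)) (ψ : L2 Ω) : ℝ≥0∞ :=
  ⨆ v ∈ {v : L2 Ω | v ∈ H10 Ω ∧ ‖grad Ω v‖ ≤ 1}, ENNReal.ofReal |inner ℝ ψ v|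

/-! ### Functions of time -/

/-- `(∫₀ᵀ N(t)² dt)^{1/2} ∈ [0, ∞]`: the norm of `L²(0,T;X)`, where `N t` is the `X`-norm of the
value at time `t`. -/
def timeL2 (T : ℝ) (N : ℝ → ℝ≥0∞) : ℝ≥0∞ :=
  (∫⁻ t in Ioc 0 T, N t ^ 2) ^ (1 / 2 : ℝ)

/-- `v` is absolutely continuous on `[0,T]` with time derivative `v'`. -/
def HasTimeDeriv {X : Type*} [NormedAddCommGroup X] [NormedSpace ℝ X] (T : ℝ) (v v' : ℝ → X) :
    Prop :=
  IntervalIntegrable v' volume 0 T ∧ ∀ t ∈ Icc 0 T, v t = v 0 + ∫ s in 0..t, v' s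

/-! ### The quasilinear problem -/

/-- The flux `a(t, x, |y|) y`. -/
def flux {d : ℕ} (a : ℝ → E d → ℝ → ℝ) (t : ℝ) (x y : E d) : E d := a t x ‖y‖ • y

/-- `⟨α(w), ∇v⟩ = ∫_Ω a(t, x, |∇w|) ∇w · ∇v dx` for `w, v ∈ H¹₀(Ω)`. -/
def quasiForm {d : ℕ} (Ω : Set (E d)) (a : ℝ → E d → ℝ → ℝ) (t : ℝ) (w v : L2 Ω) : ℝ :=
  ∫ x in Ω, inner ℝ (flux a t x (grad Ω w x)) (grad Ω v x)

/-- `u` is the weak solution on `[0,T]` of `u_t - ∇·(a(t,x,|∇u|)∇u) = f`, `u(0) = u₀`, with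
homogeneous Dirichlet boundary conditions: `u ∈ C([0,T]; L²(Ω)) ∩ L²(0,T; H¹₀(Ω))` and the weak
equation `⟨u_t, v⟩ + ⟨α(u), ∇v⟩ = ⟨f, v⟩` holds for all `v ∈ H¹₀(Ω)`, written in time-integrated
form (so that `u_t` need only be in `L²(0,T; H⁻¹(Ω))`). -/
structure IsWeakSolution {d : ℕ} (Ω : Set (E d)) (T : ℝ) (a : ℝ → E d → ℝ → ℝ)
    (f : ℝ → L2 Ω) (u₀ : L2 Ω) (u : ℝ → L2 Ω) : Prop where
  continuousOn : ContinuousOn u (Icc 0 T)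
  mem_H10 : ∀ᵐ t ∂volume.restrict (Ioc 0 T), u t ∈ H10 Ω
  memLp_grad : MemLp (fun t => grad Ω (u t)) 2 (volume.restrict (Ioc 0 T))
  initial : u 0 = u₀
  equation : ∀ v ∈ H10 Ω, ∀ t ∈ Icc 0 T,
    inner ℝ (u t) v = inner ℝ u₀ v +
      ∫ s in 0..t, (inner ℝ (f s) v - quasiForm Ω a s (u s) v)

/-! ### The mesh -/

/-- The closed reference cube `[-1,1]^d`. -/
def cube (d : ℕ) : Set (E d) := {x | ∀ i, x i ∈ Icc (-1 : ℝ) 1}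

/-- The open reference cube `(-1,1)^d`. -/
def openCube (d : ℕ) : Set (E d) := {x | ∀ i, x i ∈ Ioo (-1 : ℝ) 1}

/-- An element map: the restriction to the reference cube is a `C^∞`-diffeomorphism (up to the
boundary) onto its image, with non-singular Jacobian. The values off the closed cube play no
role. -/
structure ElementMap (d : ℕ) where
  toFun : E d → E d
  contDiff : ContDiff ℝ ∞ toFun
  injOn : InjOn toFun (cube d)
  det_ne_zero : ∀ x ∈ cube d, (fderiv ℝ toFun x).det ≠ 0

namespace ElementMap

variable {d : ℕ} (F : ElementMap d)

/-- The closed element `κ`. -/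
def elem : Set (E d) := F.toFun '' cube d

/-- The interior of the element `κ`. -/
def cell : Set (E d) := F.toFun '' openCube d

/-- The boundary `∂κ` of the element, i.e. the union of its faces. -/
def bdry : Set (E d) := F.toFun '' (cube d \ openCube d)

/-- The inverse element map `κ → [-1,1]^d`. -/
def inv (x : E d) : E d := Function.invFunOn F.toFun (cube d) x

/-- The function `ψ ∘ F⁻¹` on the closed element. -/
def push (ψ : E d → ℝ) (x : E d) : ℝ := ψ (F.inv x)

/-- The inverse transpose `DF^{-T}` of the Jacobian, at the preimage of `x`. -/
def invTranspose (x : E d) : E d →L[ℝ] E d :=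
  ContinuousLinearMap.adjoint (fderiv ℝ F.toFun (F.inv x)).inverse

/-- The gradient of `ψ ∘ F⁻¹` on the closed element (one-sided on `∂κ`), by the chain rule
`∇(ψ ∘ F⁻¹) = DF^{-T} (∇ψ) ∘ F⁻¹`. -/
def pushGrad (ψ : E d → ℝ) (x : E d) : E d := F.invTranspose x (gradient ψ (F.inv x))

open Classical in
/-- The outward normal of the reference cube at the points of a face `x_i = ±1`. -/
def refNormal (y : E d) : E d := WithLp.toLp 2 fun i => if |y i| = 1 then y i else 0

/-- The outward unit normal `n` of the element at the points of (the relative interior of) its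
faces: the normalization of `DF^{-T} n̂`. -/
def normal (x : E d) : E d :=
  ‖F.invTranspose x (refNormal (F.inv x))‖⁻¹ • F.invTranspose x (refNormal (F.inv x))

/-- The element diameter. -/
def diam : ℝ := Metric.diam F.elem

end ElementMap

/-- A subdivision of `Ω` into finitely many closed, possibly curved, elements with pairwise
disjoint interiors, whose union is `closure Ω`. Hanging nodes are allowed. (In particular `Ω` is
bounded.) -/
structure Mesh (d : ℕ) (Ω : Set (E d)) where
  N : ℕ
  map : Fin N → ElementMap d
  disjoint : Pairwise fun k l => Disjoint (map k).cell (map l).cell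
  cell_subset : ∀ k, (map k).cell ⊆ Ω
  cover : ⋃ k, (map k).elem = closure Ω

/-- The reference function given by a polynomial. -/
def polyFun {d : ℕ} (q : MvPolynomial (Fin d) ℝ) (x : E d) : ℝ :=
  MvPolynomial.eval (fun i => x i) q

namespace Mesh

variable {d : ℕ} {Ω : Set (E d)} (M : Mesh d Ω)

/-! ### The finite element space -/

/-- `v|_κ = q_κ ∘ F_κ⁻¹` for every element, with `q_κ` of degree at most `p` in each variable. -/
def Represents (p : ℕ) (q : Fin M.N → MvPolynomial (Fin d) ℝ) (v : L2 Ω) : Prop :=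
  ∀ k, q k ∈ MvPolynomial.restrictDegree (Fin d) ℝ p ∧
    v =ᵐ[volume.restrict (M.map k).cell] (M.map k).push (polyFun (q k))

/-- The discontinuous finite element space `S^p`, as a subset of `L²(Ω)`. -/
def Sp (p : ℕ) : Set (L2 Ω) := {v | ∃ q, M.Represents p q v}

open Classical in
/-- The (unique) family of reference polynomials of a function `v ∈ S^p`. -/
def rep (p : ℕ) (v : L2 Ω) : Fin M.N → MvPolynomial (Fin d) ℝ :=
  if h : ∃ q, M.Represents p q v then h.choose else 0

/-- The trace from inside `κ_k` of `v ∈ S^p`. -/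
def tr (p : ℕ) (v : L2 Ω) (k : Fin M.N) : E d → ℝ :=
  (M.map k).push (polyFun (M.rep p v k))

/-- The gradient on the closed element `κ_k` of `v ∈ S^p`. -/
def trGrad (p : ℕ) (v : L2 Ω) (k : Fin M.N) : E d → E d :=
  (M.map k).pushGrad (polyFun (M.rep p v k))

/-! ### Faces -/

/-- The interior faces `κ_k ∩ κ_l ⊂ Γ_int`. -/
def face (k l : Fin M.N) : Set (E d) := (M.map k).bdry ∩ (M.map l).bdry ∩ Ω

/-- The boundary faces `∂κ_k ∩ ∂Ω`. -/
def bface (k : Fin M.N) : Set (E d) := (M.map k).bdry ∩ frontier Ω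

/-- The mesh size on the interior face between `κ_k` and `κ_l`, the average of the two diameters
(for `k = l` it is the mesh size on the boundary faces of `κ_k`). -/
def faceSize (k l : Fin M.N) : ℝ := ((M.map k).diam + (M.map l).diam) / 2

/-- The penalty parameter `σ = C_σ p² / h` on the faces. -/
def sigma (p : ℕ) (Cσ : ℝ) (k l : Fin M.N) : ℝ := Cσ * (p : ℝ) ^ 2 / M.faceSize k l

/-- The jump `[v] = v⁺ n⁺ + v⁻ n⁻ = (v⁺ - v⁻) n⁺` on an interior face of `v ∈ S^p`
(recall `n⁻ = - n⁺`). -/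
def jump (p : ℕ) (v : L2 Ω) (k l : Fin M.N) (x : E d) : E d :=
  (M.tr p v k x - M.tr p v l x) • (M.map k).normal x

/-- The jump `[v] = v⁺ n⁺` on a boundary face of `v ∈ S^p`. -/
def bjump (p : ℕ) (v : L2 Ω) (k : Fin M.N) (x : E d) : E d :=
  M.tr p v k x • (M.map k).normal x

/-- The interior penalty semilinear form `B(w, v)` at time `t`, for `w, v ∈ S^p`. The face
integral over `Γ` is split into the interior faces (each pair of elements counted once), where
`{·}` is the average of the two one-sided values, and the boundary faces, where `{·}` is the
one-sided value. -/
def ipForm (p : ℕ) (Cσ θ : ℝ) (a : ℝ → E d → ℝ → ℝ) (t : ℝ) (w v : L2 Ω) : ℝ :=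
  (∑ k, ∫ x in (M.map k).cell, inner ℝ (flux a t x (M.trGrad p w k x)) (M.trGrad p v k x))
  + (∑ k, ∑ l ∈ Finset.Ioi k, ∫ x in M.face k l,
      (θ * inner ℝ ((1 / 2 : ℝ) •
            (a t x ((M.faceSize k l)⁻¹ * ‖M.jump p w k l x‖) • M.trGrad p v k x
              + a t x ((M.faceSize k l)⁻¹ * ‖M.jump p w k l x‖) • M.trGrad p v l x))
          (M.jump p w k l x)
        - inner ℝ ((1 / 2 : ℝ) •
            (flux a t x (M.trGrad p w k x) + flux a t x (M.trGrad p w l x)))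
          (M.jump p v k l x)
        + M.sigma p Cσ k l * inner ℝ (M.jump p w k l x) (M.jump p v k l x))
      ∂μHE[d - 1])
  + (∑ k, ∫ x in M.bface k,
      (θ * inner ℝ (a t x ((M.faceSize k k)⁻¹ * ‖M.bjump p w k x‖) • M.trGrad p v k x)
          (M.bjump p w k x)
        - inner ℝ (flux a t x (M.trGrad p w k x)) (M.bjump p v k x)
        + M.sigma p Cσ k k * inner ℝ (M.bjump p w k x) (M.bjump p v k x))
      ∂μHE[d - 1])

/-! ### The energy norm -/

/-- `v` is piecewise `H¹`, with piecewise weak gradient `g` and with trace `τ k` on `∂κ_k` from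
inside `κ_k`: on every element, `(v, g, τ k)` is a limit in `L²(κ_k) × L²(κ_k)^d × L²(∂κ_k)` of
`(φ, ∇φ, φ|_{∂κ_k})` with functions `φ = ψ ∘ F_k⁻¹` smooth on the closed element. -/
def IsPiecewiseH1 (v : L2 Ω) (g : L2v Ω)
    (τ : ∀ k : Fin M.N, Lp ℝ 2 ((μHE[d - 1] : Measure (E d)).restrict (M.map k).bdry)) : Prop :=
  ∀ k, ∃ ψ : ℕ → E d → ℝ, (∀ n, ContDiff ℝ ∞ (ψ n)) ∧
    Tendsto (fun n => eLpNorm (fun x => v x - (M.map k).push (ψ n) x) 2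
      (volume.restrict (M.map k).cell)) atTop (𝓝 0) ∧
    Tendsto (fun n => eLpNorm (fun x => g x - (M.map k).pushGrad (ψ n) x) 2
      (volume.restrict (M.map k).cell)) atTop (𝓝 0) ∧
    Tendsto (fun n => eLpNorm (fun x => τ k x - (M.map k).push (ψ n) x) 2
      ((μHE[d - 1] : Measure (E d)).restrict (M.map k).bdry)) atTop (𝓝 0)

/-- The energy norm `(∑_κ ‖∇v‖²_κ + ∫_Γ σ |[v]|² ds)^{1/2}` on piecewise `H¹` functions, in
particular on `H¹₀(Ω) + S^p`. Here `|[v]|` is `|v⁺ - v⁻|` on interior faces and `|v⁺|` on boundary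
faces. The gradient `g` and the traces `τ` are unique as elements of their `L²` spaces, so that the
infimum is over a single value; it is `∞` if `v` is not piecewise `H¹`. -/
def energyNorm (p : ℕ) (Cσ : ℝ) (v : L2 Ω) : ℝ≥0∞ :=
  ⨅ (g : L2v Ω)
    (τ : ∀ k : Fin M.N, Lp ℝ 2 ((μHE[d - 1] : Measure (E d)).restrict (M.map k).bdry))
    (_ : M.IsPiecewiseH1 v g τ),
    ((∑ k, ∫⁻ x in (M.map k).cell, ‖g x‖ₑ ^ 2)
      + (∑ k, ∑ l ∈ Finset.Ioi k, ∫⁻ x in M.face k l,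
          ENNReal.ofReal (M.sigma p Cσ k l) * ‖τ k x - τ l x‖ₑ ^ 2 ∂μHE[d - 1])
      + (∑ k, ∫⁻ x in M.bface k,
          ENNReal.ofReal (M.sigma p Cσ k k) * ‖τ k x‖ₑ ^ 2 ∂μHE[d - 1])) ^ (1 / 2 : ℝ)

/-! ### The semidiscrete method and the elliptic reconstruction -/

/-- `U` solves the semidiscrete interior penalty method on `(0,T]`:
`⟨U_t, V⟩ + B(U, V) = ⟨f, V⟩` for all `V ∈ S^p`. Since `f` is only measurable in time, `U` is
absolutely continuous and the equation holds at almost every time. -/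
structure IsSemidiscreteSolution (p : ℕ) (Cσ θ T : ℝ) (a : ℝ → E d → ℝ → ℝ) (f : ℝ → L2 Ω)
    (U : ℝ → L2 Ω) : Prop where
  mem_Sp : ∀ t ∈ Icc 0 T, U t ∈ M.Sp p
  equation : ∃ Ut : ℝ → L2 Ω, HasTimeDeriv T U Ut ∧
    ∀ᵐ t ∂volume.restrict (Ioc 0 T), ∀ V ∈ M.Sp p,
      inner ℝ (Ut t) V + M.ipForm p Cσ θ a t (U t) V = inner ℝ (f t) V

/-- `AZ ∈ S^p` is the value at `Z ∈ S^p` of the discrete operator `A(t)`: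
`⟨-AZ, V⟩ = B(Z, V)` for all `V ∈ S^p`. -/
def IsDiscreteOp (p : ℕ) (Cσ θ : ℝ) (a : ℝ → E d → ℝ → ℝ) (t : ℝ) (Z AZ : L2 Ω) : Prop :=
  AZ ∈ M.Sp p ∧ ∀ V ∈ M.Sp p, inner ℝ (-AZ) V = M.ipForm p Cσ θ a t Z V

/-- `P = Π φ` is the orthogonal `L²`-projection of `φ` onto `S^p`. -/
def IsL2Proj (p : ℕ) (φ P : L2 Ω) : Prop :=
  P ∈ M.Sp p ∧ ∀ V ∈ M.Sp p, inner ℝ (φ - P) V = 0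

/-- `w ∈ H¹₀(Ω)` is the elliptic reconstruction at time `t` of `Z ∈ S^p`:
`⟨α(w), ∇v⟩ = ⟨g, v⟩` for all `v ∈ H¹₀(Ω)`, where `g = -AZ + φ - Πφ` and `φ` is the value at
time `t` of the right-hand side. -/
def IsEllipticReconstruction (p : ℕ) (Cσ θ : ℝ) (a : ℝ → E d → ℝ → ℝ) (t : ℝ)
    (φ Z w : L2 Ω) : Prop :=
  w ∈ H10 Ω ∧ ∃ AZ P : L2 Ω, M.IsDiscreteOp p Cσ θ a t Z AZ ∧ M.IsL2Proj p φ P ∧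
    ∀ v ∈ H10 Ω, quasiForm Ω a t w v = inner ℝ (-AZ + φ - P) v

end Mesh

end

end IPDG

/-! ### An energy inequality for weakly differentiable curves -/

/-! Write `e = U - u = U^d + z` with `z = U^c - u`, which lies in `H¹₀(Ω)` for a.e. `t`. The
triangle inequality leaves an energy estimate for `z`.

The elliptic reconstruction removes the discrete form. The element `U_t - AU - Πf` of `S^p` is
orthogonal to `S^p`, hence zero, so `⟨α(w), ∇v⟩ = ⟨f - U_t, v⟩` for all `v ∈ H¹₀(Ω)`
(`Mesh.IsEllipticReconstruction.quasiForm_eq`). Subtracting the weak equation of `u` gives `⟨z_t, v⟩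
+ ⟨α(w) - α(u), ∇v⟩ + ⟨U^d_t, v⟩ = 0`. Test with `v = z` and split `α(w) - α(u)` at `α(U^c)`: one
difference is controlled by the Lipschitz bound, the other by monotonicity. With `G = au ‖∇(w -
U^c)‖ + ‖U^d_t‖₋₁`, completing the square yields `al ∫ ‖∇z‖² ≤ al⁻¹ ∫ G² + ‖z(0)‖²`
(`energy_estimate`). As `G` is squared as a whole, Minkowski's inequality in time gives constants
without the factor `√2`, and the stated ones follow from `1 ≤ √2`.

Three points need care. First, `u_t` is only a functional on `H¹₀(Ω)`, so testing with `z` has to be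
justified. This is done with backward differences `z(t) - z(t - h)`, Fubini, and the continuity of
translations in `L¹` and `L²` as `h → 0` (`integral_inner_sub_inner_le_half_norm_sq`).

Second, on `H¹₀(Ω)` the energy norm equals `‖∇v‖`. The bound from below is the uniqueness of weak
gradients on each element (`Mesh.enorm_grad_le_energyNorm`). The bound from above is the trace
inequality: the traces of smooth approximants converge on every element boundary, and a limit of
functions without jumps has none (`Mesh.energyNorm_le_enorm_grad`). This passes between `∇(w -
U^c)`, `∇z` and the broken norms of `ε`, `U^d`, `e`.

Third, the energy norms of `e` and `ε` are not known to be measurable in time. Minkowski's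
inequality for lower integrals needs only one measurable summand (`timeL2_add_le`), and `U^d`
supplies it because it moves in a finite-dimensional space (`aemeasurable_extendedSeminorm_comp`).
-/

theorem integrable_inner_of_memLp_two {α K : Type*} [NormedAddCommGroup K] [InnerProductSpace ℝ K]
    {m : MeasurableSpace α} {μ : Measure α} {f g : α → K} (hf : MemLp f 2 μ) (hg : MemLp g 2 μ) :
    Integrable (fun x => (inner ℝ (f x) (g x) : ℝ)) μ := by
  refine (L2.integrable_inner (𝕜 := ℝ) (hf.toLp f) (hg.toLp g)).congr ?_
  filter_upwards [hf.coeFn_toLp, hg.coeFn_toLp] with x h1 h2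
  rw [h1, h2]

namespace EnergyInequality

variable {H K : Type*} [NormedAddCommGroup H] [InnerProductSpace ℝ H]
  [NormedAddCommGroup K] [InnerProductSpace ℝ K] {X : Type*} [NormedAddCommGroup X]

theorem measurePreserving_translate (r : ℝ) :
    MeasurePreserving (fun t : ℝ => -r + t) volume volume :=
  measurePreserving_add_left volume (-r)

theorem continuous_compMeasurePreserving_translate {p : ℝ≥0∞} [Fact (1 ≤ p)] (hp : p ≠ ⊤)
    (f : Lp X p (volume : Measure ℝ)) :
    Continuous fun r : ℝ =>
      Lp.compMeasurePreserving (fun t : ℝ => -r + t) (measurePreserving_translate r) f := by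
  -- Currying makes the translations a continuous family for the compact-open topology, the form in
  -- which strong continuity on `Lp` with `p < ∞` applies.
  let g : C(ℝ, C(ℝ, ℝ)) := (ContinuousMap.mk (fun a : ℝ × ℝ => -a.1 + a.2) (by fun_prop)).curry
  exact (continuous_const (y := f)).compMeasurePreservingLp g.continuous
    measurePreserving_translate hp

/-- Continuity of translations, tested against a square integrable function. -/
theorem continuous_integral_inner_translate_of_memLp_two {f g : ℝ → K}
    (hf : MemLp f 2) (hg : MemLp g 2) :
    Continuous fun r : ℝ => ∫ t, inner ℝ (f (-r + t)) (g t) := by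
  have h := (continuous_compMeasurePreserving_translate (by simp) (hf.toLp f)).inner (𝕜 := ℝ)
    (continuous_const (y := hg.toLp g))
  refine h.congr fun r => ?_
  rw [L2.inner_def]
  refine integral_congr_ae ?_
  filter_upwards [Lp.coeFn_compMeasurePreserving (hf.toLp f) (measurePreserving_translate r),
    hg.coeFn_toLp,
    (measurePreserving_translate r).quasiMeasurePreserving.ae hf.coeFn_toLp] with t h1 h2 h3
  rw [h1, h2, Function.comp_apply, h3]

/-- Continuity of translations, tested against a bounded function. -/
theorem continuous_integral_inner_translate_of_bound {f g : ℝ → H} {C : ℝ}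
    (hf : Integrable f) (hg : AEStronglyMeasurable g) (hC : ∀ t, ‖g t‖ ≤ C) :
    Continuous fun r : ℝ => ∫ t, inner ℝ (f (-r + t)) (g t) := by
  have hf1 : MemLp f 1 := memLp_one_iff_integrable.2 hf
  have hint : ∀ r : ℝ, Integrable fun t => inner ℝ (f (-r + t)) (g t) := fun r =>
    (((measurePreserving_translate r).integrable_comp hf.1).2 hf).norm.mul_const C |>.mono'
      (((hf.1.comp_measurePreserving (measurePreserving_translate r))).inner hg)
      (Eventually.of_forall fun t => (norm_inner_le_norm _ _).trans
        (mul_le_mul_of_nonneg_left (hC t) (norm_nonneg _)))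
  rw [continuous_iff_continuousAt]
  intro r₀
  have hF := continuous_compMeasurePreserving_translate (by simp) (hf1.toLp f)
  have h0 : Tendsto (fun r => ‖Lp.compMeasurePreserving (fun t : ℝ => -r + t)
      (measurePreserving_translate r) (hf1.toLp f) - Lp.compMeasurePreserving
        (fun t : ℝ => -r₀ + t) (measurePreserving_translate r₀) (hf1.toLp f)‖ * C) (𝓝 r₀) (𝓝 0) := by
    simpa using (((hF.sub (continuous_const (y := Lp.compMeasurePreserving
        (fun t : ℝ => -r₀ + t) (measurePreserving_translate r₀) (hf1.toLp f)))).norm).tendsto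
          r₀).mul_const C
  refine tendsto_iff_norm_sub_tendsto_zero.2 (squeeze_zero (fun _ => norm_nonneg _) (fun r => ?_) h0)
  rw [← integral_sub (hint r) (hint r₀), L1.norm_eq_integral_norm, ← integral_mul_const]
  refine norm_integral_le_of_norm_le ((L1.integrable_coeFn _).norm.mul_const _) ?_
  filter_upwards [Lp.coeFn_compMeasurePreserving (hf1.toLp f) (measurePreserving_translate r),
    Lp.coeFn_compMeasurePreserving (hf1.toLp f) (measurePreserving_translate r₀),
    Lp.coeFn_sub (Lp.compMeasurePreserving (fun t : ℝ => -r + t)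
      (measurePreserving_translate r) (hf1.toLp f)) (Lp.compMeasurePreserving
        (fun t : ℝ => -r₀ + t) (measurePreserving_translate r₀) (hf1.toLp f)),
    (measurePreserving_translate r).quasiMeasurePreserving.ae hf1.coeFn_toLp,
    (measurePreserving_translate r₀).quasiMeasurePreserving.ae hf1.coeFn_toLp]
    with t h1 h2 h3 h4 h5
  rw [h3, Pi.sub_apply, h1, h2, Function.comp_apply, Function.comp_apply, h4, h5,
    ← inner_sub_left]
  exact (norm_inner_le_norm _ _).trans (mul_le_mul_of_nonneg_left (hC t) (norm_nonneg _))

/-- The shear `(r, t) ↦ (r, t - r)` preserves the product measure, so joint measurability and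
integrability are inherited from the unshifted function. This prepares the use of Fubini in the
shift `r` and the time `t`. -/
theorem aestronglyMeasurable_translate {X : Type*} [TopologicalSpace X] {f : ℝ → X}
    (hf : AEStronglyMeasurable f) (ν : Measure ℝ) [SFinite ν] :
    AEStronglyMeasurable (fun p : ℝ × ℝ => f (-p.1 + p.2)) (ν.prod volume) :=
  (hf.comp_snd (μ := ν)).comp_measurePreserving (measurePreserving_prod_neg_add ν volume)

theorem integrable_translate {f : ℝ → X}
    (hf : Integrable f) (ν : Measure ℝ) [IsFiniteMeasure ν] :
    Integrable (fun p : ℝ × ℝ => f (-p.1 + p.2)) (ν.prod volume) :=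
  ((measurePreserving_prod_neg_add ν volume).integrable_comp
    (hf.comp_snd ν).1).2 (hf.comp_snd ν)

theorem integrable_prod_inner_translate_of_bound {f g : ℝ → H} {C : ℝ}
    (hf : Integrable f) (hg : AEStronglyMeasurable g) (hC : ∀ t, ‖g t‖ ≤ C)
    (ν : Measure ℝ) [IsFiniteMeasure ν] :
    Integrable (fun p : ℝ × ℝ => (inner ℝ (f (-p.1 + p.2)) (g p.2) : ℝ)) (ν.prod volume) :=
  ((integrable_translate hf ν).norm.mul_const C).mono'
    ((aestronglyMeasurable_translate hf.1 ν).inner hg.comp_snd)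
    (Eventually.of_forall fun p => (norm_inner_le_norm _ _).trans
        (mul_le_mul_of_nonneg_left (hC p.2) (norm_nonneg _)))

theorem integrable_prod_inner_translate_of_memLp_two {f g : ℝ → K}
    (hf : MemLp f 2) (hg : MemLp g 2) (ν : Measure ℝ) [IsFiniteMeasure ν] :
    Integrable (fun p : ℝ × ℝ => (inner ℝ (f (-p.1 + p.2)) (g p.2) : ℝ)) (ν.prod volume) := by
  refine ((integrable_translate (hf.integrable_norm_pow two_ne_zero) ν).add
    ((hg.integrable_norm_pow two_ne_zero).comp_snd ν)).mono'
    ((aestronglyMeasurable_translate hf.1 ν).inner hg.1.comp_snd)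
    (Eventually.of_forall fun p => (norm_inner_le_norm _ _).trans ?_)
  simp only [Pi.add_apply]
  nlinarith [sq_nonneg (‖f (-p.1 + p.2)‖ - ‖g p.2‖), sq_nonneg (‖f (-p.1 + p.2)‖),
    sq_nonneg (‖g p.2‖)]

/-- Divide by `s` and let `s → 0⁺`: the averages of a continuous function tend to its value at `0`.
This is the passage to the limit in the backward difference argument. -/
theorem le_of_forall_integral_ge {Φ : ℝ → ℝ} (hΦ : Continuous Φ) {T c : ℝ} (hT : 0 < T)
    (h : ∀ s ∈ Ioc 0 T, c * s ≤ ∫ r in 0..s, Φ r) : c ≤ Φ 0 := by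
  have hd : HasDerivAt (fun s => ∫ r in 0..s, Φ r) (Φ 0) 0 :=
    intervalIntegral.integral_hasDerivAt_right (hΦ.intervalIntegrable _ _)
      (hΦ.stronglyMeasurableAtFilter _ _) hΦ.continuousAt
  have := hd.tendsto_slope_zero_right
  refine ge_of_tendsto this ?_
  filter_upwards [Ioc_mem_nhdsGT hT] with s hs
  simp only [zero_add, intervalIntegral.integral_same, sub_zero, smul_eq_mul]
  rw [inv_mul_eq_div, le_div_iff₀ hs.1]
  exact h s hs

/-- Substitute for `∫ (d/dt) ‖z‖² ≥ -‖z(0)‖²` without a derivative. With `z` frozen at `z 0` for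
negative times, the shifted integral is `h ‖z 0‖²` plus the integral over `[0, T - h]`. The latter
cancels, and the part over `[T - h, T]` is nonnegative. -/
theorem intervalIntegral_norm_sq_backward {z : ℝ → X} {T h : ℝ} (hz : ContinuousOn z (Icc 0 T))
    (hh : h ∈ Ioc 0 T) :
    -(h * ‖z 0‖ ^ 2) ≤ ∫ t in 0..T, (‖z t‖ ^ 2 - ‖z (max (t - h) 0)‖ ^ 2) := by
  have hT : 0 < T := hh.1.trans_le hh.2
  have c1 : ContinuousOn (fun t => ‖z t‖ ^ 2) (Icc 0 T) := hz.norm.pow 2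
  have c2 : ContinuousOn (fun t => ‖z (max (t - h) 0)‖ ^ 2) (Icc 0 T) := by
    refine c1.comp (by fun_prop) fun t ht => ⟨le_max_right _ _, max_le ?_ hT.le⟩
    linarith [ht.2, hh.1]
  have i1 : ∀ x ∈ Icc 0 T, ∀ y ∈ Icc 0 T, IntervalIntegrable (fun t => ‖z t‖ ^ 2) volume x y :=
    fun x hx y hy => (c1.mono (ordConnected_Icc.uIcc_subset hx hy)).intervalIntegrable
  have i2 : ∀ x ∈ Icc 0 T, ∀ y ∈ Icc 0 T,
      IntervalIntegrable (fun t => ‖z (max (t - h) 0)‖ ^ 2) volume x y :=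
    fun x hx y hy => (c2.mono (ordConnected_Icc.uIcc_subset hx hy)).intervalIntegrable
  have m0 : (0 : ℝ) ∈ Icc 0 T := ⟨le_rfl, hT.le⟩
  have mT : T ∈ Icc 0 T := ⟨hT.le, le_rfl⟩
  have mh : h ∈ Icc 0 T := ⟨hh.1.le, hh.2⟩
  have mTh : T - h ∈ Icc 0 T := ⟨by linarith [hh.2], by linarith [hh.1]⟩
  rw [intervalIntegral.integral_sub (i1 0 m0 T mT) (i2 0 m0 T mT),
    ← intervalIntegral.integral_add_adjacent_intervals (i2 0 m0 h mh) (i2 h mh T mT),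
    ← intervalIntegral.integral_add_adjacent_intervals (i1 0 m0 _ mTh) (i1 _ mTh T mT)]
  have e1 : ∫ t in 0..h, ‖z (max (t - h) 0)‖ ^ 2 = h * ‖z 0‖ ^ 2 := by
    rw [intervalIntegral.integral_congr (g := fun _ => ‖z 0‖ ^ 2)]
    · simp
    · intro t ht
      rw [uIcc_of_le hh.1.le] at ht
      simp only
      rw [max_eq_right (by linarith [ht.2])]
  have e2 : ∫ t in h..T, ‖z (max (t - h) 0)‖ ^ 2 = ∫ t in 0..(T - h), ‖z t‖ ^ 2 := by
    rw [intervalIntegral.integral_congr (g := fun t => ‖z (t - h)‖ ^ 2)]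
    · simp [intervalIntegral.integral_comp_sub_right (fun t => ‖z t‖ ^ 2)]
    · intro t ht
      rw [uIcc_of_le hh.2] at ht
      simp only
      rw [max_eq_left (by linarith [ht.1])]
  have e3 : 0 ≤ ∫ t in (T - h)..T, ‖z t‖ ^ 2 :=
    intervalIntegral.integral_nonneg (by linarith [hh.1]) fun _ _ => by positivity
  rw [e1, e2]
  linarith

end EnergyInequality

open EnergyInequality in
/-- If `z' = b - D* q` weakly, where the pairing with `z(t)` is `⟨b, z(t)⟩ - ⟨q, g(t)⟩`, then
`½ ‖z(T)‖² - ½ ‖z(0)‖² = ∫ ⟨b, z⟩ - ⟨q, g⟩`; only the resulting lower bound is stated. -/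
theorem integral_inner_sub_inner_le_half_norm_sq
    {H K : Type*} [NormedAddCommGroup H] [InnerProductSpace ℝ H]
    [NormedAddCommGroup K] [InnerProductSpace ℝ K] {T : ℝ} (hT : 0 < T) {z b : ℝ → H} {q g : ℝ → K}
    (hz : ContinuousOn z (Icc 0 T)) (hb : IntegrableOn b (Ioc 0 T))
    (hq : MemLp q 2 (volume.restrict (Ioc 0 T))) (hg : MemLp g 2 (volume.restrict (Ioc 0 T)))
    (h : ∀ᵐ t ∂volume.restrict (Ioc 0 T), ∀ τ ∈ Icc 0 T,
      inner ℝ (z τ) (z t) = inner ℝ (z 0) (z t) +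
        ∫ s in 0..τ, (inner ℝ (b s) (z t) - inner ℝ (q s) (g t))) :
    ∫ s in Ioc 0 T, (inner ℝ (q s) (g s) - inner ℝ (b s) (z s)) ≤ ‖z 0‖ ^ 2 / 2 := by
  set I := Ioc 0 T with hI
  have mI : MeasurableSet I := measurableSet_Ioc
  have hb' : Integrable (I.indicator b) := hb.integrable_indicator mI
  have hq' : MemLp (I.indicator q) 2 := (memLp_indicator_iff_restrict mI).2 hq
  have hg' : MemLp (I.indicator g) 2 := (memLp_indicator_iff_restrict mI).2 hg
  have hz' : AEStronglyMeasurable (I.indicator z) :=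
    (aestronglyMeasurable_indicator_iff mI).2
      ((hz.mono Ioc_subset_Icc_self).aestronglyMeasurable mI)
  obtain ⟨C, hC⟩ : ∃ C, ∀ t, ‖I.indicator z t‖ ≤ C := by
    obtain ⟨C, hC⟩ := isCompact_Icc.exists_bound_of_continuousOn hz
    refine ⟨max C 0, fun t => ?_⟩
    by_cases ht : t ∈ I
    · rw [indicator_of_mem ht]
      exact (hC t (Ioc_subset_Icc_self ht)).trans (le_max_left _ _)
    · simp [indicator_of_notMem ht]
  -- With zero extensions, let `Φ(r) = ∫ ⟨b(t - r), z(t)⟩ - ⟨q(t - r), g(t)⟩ dt`; the claim is a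
  -- bound on `Φ 0`. For `0 < s ≤ T`, Fubini turns `∫₀ˢ Φ` into the time integral of the weak
  -- equation over `[t - s, t]` tested with `z(t)`, which dominates half of the backward difference
  -- of `‖z‖²`.
  have key : -(‖z 0‖ ^ 2 / 2) ≤ (∫ t, inner ℝ (I.indicator b (-0 + t)) (I.indicator z t)) -
      ∫ t, inner ℝ (I.indicator q (-0 + t)) (I.indicator g t) := by
    refine le_of_forall_integral_ge
      ((continuous_integral_inner_translate_of_bound hb' hz' hC).sub
        (continuous_integral_inner_translate_of_memLp_two hq' hg')) hT fun s hs => ?_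
    have k1 := integrable_prod_inner_translate_of_bound hb' hz' hC (volume.restrict (Ioc 0 s))
    have k2 := integrable_prod_inner_translate_of_memLp_two hq' hg' (volume.restrict (Ioc 0 s))
    have hc : ContinuousOn (fun t => (‖z t‖ ^ 2 - ‖z (max (t - s) 0)‖ ^ 2) / 2) (Icc 0 T) := by
      refine ((hz.norm.pow 2).sub ((hz.norm.pow 2).comp (by fun_prop) fun t ht =>
        ⟨le_max_right _ _, max_le ?_ hT.le⟩)).div_const 2
      linarith [ht.2, hs.1]
    have hc' := (hc.integrableOn_Icc (μ := volume)).mono_set Ioc_subset_Icc_self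
    have e1 : ∫ r in 0..s, ((∫ t, inner ℝ (I.indicator b (-r + t)) (I.indicator z t)) -
        ∫ t, inner ℝ (I.indicator q (-r + t)) (I.indicator g t)) =
        ∫ t, ∫ r in 0..s, (inner ℝ (I.indicator b (-r + t)) (I.indicator z t) -
          inner ℝ (I.indicator q (-r + t)) (I.indicator g t)) := by
      simp only [intervalIntegral.integral_of_le hs.1.le]
      rw [← integral_integral_swap (k1.sub k2)]
      refine integral_congr_ae ?_
      filter_upwards [k1.prod_right_ae, k2.prod_right_ae] with r h1 h2
      exact (integral_sub h1 h2).symm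
    simp only [Pi.sub_apply]
    rw [e1]
    have e2 : -(‖z 0‖ ^ 2 / 2) * s ≤
        ∫ t, I.indicator (fun t => (‖z t‖ ^ 2 - ‖z (max (t - s) 0)‖ ^ 2) / 2) t := by
      rw [integral_indicator mI, ← intervalIntegral.integral_of_le hT.le,
        intervalIntegral.integral_div]
      linarith [intervalIntegral_norm_sq_backward hz hs]
    refine e2.trans (integral_mono_ae (hc'.integrable_indicator mI) ?_ ?_)
    · simpa only [intervalIntegral.integral_of_le hs.1.le, Pi.sub_apply] using (k1.sub k2).integral_prod_right
    · have hb2 : ∀ t, ∀ x ∈ Icc 0 T, ∀ y ∈ Icc 0 T, IntervalIntegrable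
          (fun s => (inner ℝ (b s) (z t) - inner ℝ (q s) (g t) : ℝ)) volume x y := by
        intro t x hx y hy
        have : IntegrableOn (fun s => (inner ℝ (b s) (z t) - inner ℝ (q s) (g t) : ℝ)) I :=
          (hb.inner_const _).sub ((hq.integrable one_le_two).inner_const _)
        rw [intervalIntegrable_iff]
        exact this.mono_set fun r hr => ⟨(le_min hx.1 hy.1).trans_lt hr.1,
          hr.2.trans (max_le hx.2 hy.2)⟩
      filter_upwards [(ae_restrict_iff' mI).1 h] with t ht
      by_cases htI : t ∈ I
      swap
      · simp [indicator_of_notMem htI]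
      specialize ht htI
      simp only [indicator_of_mem htI]
      have mt : t ∈ Icc 0 T := Ioc_subset_Icc_self htI
      have mm : max (t - s) 0 ∈ Icc 0 T :=
        ⟨le_max_right _ _, max_le (by linarith [mt.2, hs.1]) hT.le⟩
      have hmt : max (t - s) 0 ≤ t := max_le (by linarith [hs.1]) mt.1
      -- Substitute `r ↦ t - r`; the zero extension to negative times truncates the lower limit at
      -- `max (t - s) 0`.
      have e3 : ∫ r in 0..s, (inner ℝ (I.indicator b (-r + t)) (z t) -
          inner ℝ (I.indicator q (-r + t)) (g t)) =
          ∫ r in (max (t - s) 0)..t, (inner ℝ (b r) (z t) - inner ℝ (q r) (g t)) := by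
        have : ∀ x, (inner ℝ (I.indicator b x) (z t) - inner ℝ (I.indicator q x) (g t) : ℝ) =
            I.indicator (fun r => (inner ℝ (b r) (z t) - inner ℝ (q r) (g t) : ℝ)) x := by
          intro x
          by_cases hx : x ∈ I <;> simp [hx]
        simp only [this, neg_add_eq_sub]
        rw [intervalIntegral.integral_comp_sub_left (I.indicator _), sub_zero,
          intervalIntegral.integral_of_le (by linarith [hs.1]),
          intervalIntegral.integral_of_le hmt, setIntegral_indicator mI, hI, Ioc_inter_Ioc,
          min_eq_left htI.2]
      rw [e3, ← intervalIntegral.integral_interval_sub_left (hb2 t 0 ⟨le_rfl, hT.le⟩ t mt)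
        (hb2 t 0 ⟨le_rfl, hT.le⟩ _ mm)]
      have h1 := ht t mt
      have h2 := ht _ mm
      -- Cauchy–Schwarz and Young: `⟨z(t) - z(t'), z(t)⟩ ≥ (‖z(t)‖² - ‖z(t')‖²) / 2`.
      have h3 := real_inner_le_norm (z (max (t - s) 0)) (z t)
      rw [real_inner_self_eq_norm_sq] at h1
      nlinarith [sq_nonneg (‖z (max (t - s) 0)‖ - ‖z t‖)]
  have i1 : IntegrableOn (fun s => (inner ℝ (b s) (z s) : ℝ)) I := by
    refine (hb.norm.mul_const C).mono' (hb.1.inner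
      ((hz.mono Ioc_subset_Icc_self).aestronglyMeasurable mI)) ?_
    filter_upwards [ae_restrict_mem mI] with t ht
    refine (norm_inner_le_norm _ _).trans (mul_le_mul_of_nonneg_left ?_ (norm_nonneg _))
    simpa [indicator_of_mem ht] using hC t
  have i2 : IntegrableOn (fun s => (inner ℝ (q s) (g s) : ℝ)) I := integrable_inner_of_memLp_two hq hg
  have e1 : ∫ t, inner ℝ (I.indicator b (-0 + t)) (I.indicator z t) =
      ∫ t in I, inner ℝ (b t) (z t) := by
    rw [← integral_indicator mI]
    refine integral_congr_ae (Eventually.of_forall fun t => ?_)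
    by_cases ht : t ∈ I <;> simp [ht]
  have e2 : ∫ t, inner ℝ (I.indicator q (-0 + t)) (I.indicator g t) =
      ∫ t in I, inner ℝ (q t) (g t) := by
    rw [← integral_indicator mI]
    refine integral_congr_ae (Eventually.of_forall fun t => ?_)
    by_cases ht : t ∈ I <;> simp [ht]
  rw [integral_sub i2 i1]
  rw [e1, e2] at key
  linarith

namespace IPDG

/-! ### The norm of `L²(0,T;X)` -/

theorem timeL2_mono_ae {T : ℝ} {f g : ℝ → ℝ≥0∞} (h : ∀ᵐ t ∂volume.restrict (Ioc 0 T), f t ≤ g t) :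
    timeL2 T f ≤ timeL2 T g := by
  refine ENNReal.rpow_le_rpow (lintegral_mono_ae ?_) (by norm_num)
  filter_upwards [h] with t ht
  gcongr

/-- Minkowski's inequality; as `lintegral` is a lower integral, it is enough that one of the
functions is measurable. -/
theorem timeL2_add_le {T : ℝ} {f g : ℝ → ℝ≥0∞} (hg : AEMeasurable g (volume.restrict (Ioc 0 T))) :
    timeL2 T (fun t => f t + g t) ≤ timeL2 T f + timeL2 T g := by
  -- Replace `(f + g)²` by a measurable minorant with the same integral. Then `√φ - g` is a.e.
  -- measurable and at most `f`, so the usual Minkowski inequality applies to it and `g`.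
  obtain ⟨φ, hφm, hφ_le, hφ_eq⟩ :=
    exists_measurable_le_lintegral_eq (volume.restrict (Ioc 0 T)) fun t => (f t + g t) ^ 2
  have hψ : Measurable fun t => φ t ^ (1 / 2 : ℝ) := hφm.pow_const _
  have hsq : ∀ x : ℝ≥0∞, (x ^ (1 / 2 : ℝ)) ^ 2 = x := fun x => by
    rw [← ENNReal.rpow_natCast, ← ENNReal.rpow_mul]; norm_num
  have hsq' : ∀ x : ℝ≥0∞, (x ^ 2) ^ (1 / 2 : ℝ) = x := fun x => by
    rw [← ENNReal.rpow_natCast, ← ENNReal.rpow_mul]; norm_num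
  have hle : ∀ t, φ t ^ (1 / 2 : ℝ) - g t ≤ f t := fun t => by
    rw [tsub_le_iff_right, ← hsq' (f t + g t)]
    exact ENNReal.rpow_le_rpow (hφ_le t) (by norm_num)
  calc timeL2 T (fun t => f t + g t)
      = (∫⁻ t in Ioc 0 T, φ t) ^ (1 / 2 : ℝ) := by rw [timeL2, hφ_eq]
    _ = (∫⁻ t in Ioc 0 T, (φ t ^ (1 / 2 : ℝ)) ^ (2 : ℝ)) ^ (1 / 2 : ℝ) := by
        congr 1
        refine lintegral_congr fun t => ?_
        rw [← ENNReal.rpow_mul]; norm_num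
    _ ≤ (∫⁻ t in Ioc 0 T, ((fun t => φ t ^ (1 / 2 : ℝ) - g t) + g) t ^ (2 : ℝ)) ^ (1 / 2 : ℝ) := by
        refine ENNReal.rpow_le_rpow (lintegral_mono fun t => ?_) (by norm_num)
        exact ENNReal.rpow_le_rpow le_tsub_add (by norm_num)
    _ ≤ (∫⁻ t in Ioc 0 T, (φ t ^ (1 / 2 : ℝ) - g t) ^ (2 : ℝ)) ^ (1 / 2 : ℝ) +
          (∫⁻ t in Ioc 0 T, g t ^ (2 : ℝ)) ^ (1 / 2 : ℝ) :=
        ENNReal.lintegral_Lp_add_le (hψ.aemeasurable.sub hg) hg (by norm_num)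
    _ ≤ timeL2 T f + timeL2 T g := by
        simp only [timeL2, ENNReal.rpow_ofNat]
        gcongr with t
        exact hle t

theorem timeL2_const_mul {T : ℝ} {c : ℝ≥0∞} (hc : c ≠ ⊤) (f : ℝ → ℝ≥0∞) :
    timeL2 T (fun t => c * f t) = c * timeL2 T f := by
  simp only [timeL2, mul_pow]
  rw [lintegral_const_mul' _ _ (ENNReal.pow_ne_top hc), ENNReal.mul_rpow_of_nonneg _ _ (by norm_num),
    ← ENNReal.rpow_natCast, ← ENNReal.rpow_mul]
  norm_num

theorem timeL2_sq (T : ℝ) (f : ℝ → ℝ≥0∞) : timeL2 T f ^ 2 = ∫⁻ t in Ioc 0 T, f t ^ 2 := by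
  rw [timeL2, ← ENNReal.rpow_natCast, ← ENNReal.rpow_mul]
  norm_num

theorem ae_ne_top_of_timeL2_ne_top {T : ℝ} {f : ℝ → ℝ≥0∞}
    (hf : AEMeasurable f (volume.restrict (Ioc 0 T))) (h : timeL2 T f ≠ ⊤) :
    ∀ᵐ t ∂volume.restrict (Ioc 0 T), f t ≠ ⊤ := by
  have := ae_lt_top' (hf.pow_const 2) (by rw [← timeL2_sq]; exact ENNReal.pow_ne_top h)
  filter_upwards [this] with t ht h
  simp [h] at ht

theorem HasTimeDeriv.continuousOn {X : Type*} [NormedAddCommGroup X] [NormedSpace ℝ X] {T : ℝ}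
    {v v' : ℝ → X} (hT : 0 ≤ T) (h : HasTimeDeriv T v v') : ContinuousOn v (Icc 0 T) := by
  have h1 := intervalIntegral.continuousOn_primitive_interval'
    (b₁ := 0) (b₂ := T) (a := 0) h.1 left_mem_uIcc
  rw [uIcc_of_le hT] at h1
  exact (continuousOn_const.add h1).congr h.2

end IPDG

namespace IPDG

variable {d : ℕ}

/-! ### Weak gradients -/

theorem tendsto_integral_inner_of_tendsto_eLpNorm {α K : Type*} [NormedAddCommGroup K]
    [InnerProductSpace ℝ K] {m : MeasurableSpace α} {μ : Measure α} {f g : α → K} {F : ℕ → α → K}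
    (hf : MemLp f 2 μ) (hg : MemLp g 2 μ) (hF : ∀ n, AEStronglyMeasurable (F n) μ)
    (h : Tendsto (fun n => eLpNorm (fun x => f x - F n x) 2 μ) atTop (𝓝 0)) :
    Tendsto (fun n => ∫ x, inner ℝ (F n x) (g x) ∂μ) atTop (𝓝 (∫ x, inner ℝ (f x) (g x) ∂μ)) := by
  have h0 : Tendsto (fun n => (eLpNorm (fun x => f x - F n x) 2 μ).toReal * ‖hg.toLp g‖)
      atTop (𝓝 0) := by
    simpa using ((ENNReal.tendsto_toReal ENNReal.zero_ne_top).comp h).mul_const ‖hg.toLp g‖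
  rw [tendsto_iff_dist_tendsto_zero]
  refine squeeze_zero' (Eventually.of_forall fun _ => dist_nonneg) ?_ h0
  -- The functions `F n` are in `L²` only from some index on, once their distance to `f` is finite.
  filter_upwards [h.eventually_lt_const ENNReal.zero_lt_top] with n hn
  have hd : MemLp (fun x => f x - F n x) 2 μ := ⟨hf.1.sub (hF n), hn⟩
  have hFn : MemLp (F n) 2 μ := by
    convert hf.sub hd using 1
    ext x; simp
  rw [dist_comm, Real.dist_eq, ← integral_sub (integrable_inner_of_memLp_two hf hg)
    (integrable_inner_of_memLp_two hFn hg)]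
  have : ∫ x, (inner ℝ (f x) (g x) - inner ℝ (F n x) (g x)) ∂μ =
      inner ℝ (hd.toLp _) (hg.toLp g) := by
    rw [L2.inner_def]
    refine integral_congr_ae ?_
    filter_upwards [hd.coeFn_toLp, hg.coeFn_toLp] with x h1 h2
    rw [h1, h2, inner_sub_left]
  rw [this, ← Lp.norm_toLp _ hd]
  exact abs_real_inner_le_norm _ _

/-- `G` is the weak gradient of `v` in `O`. -/
def IsWeakGrad (O : Set (E d)) (v : E d → ℝ) (G : E d → E d) : Prop :=
  ∀ χ : E d → ℝ, ContDiff ℝ ∞ χ → HasCompactSupport χ → tsupport χ ⊆ O → ∀ e : E d,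
    ∫ x in O, inner ℝ (v x) (fderiv ℝ χ x e) = - ∫ x in O, inner ℝ (G x) (χ x • e)

theorem memLp_of_hasCompactSupport {X : Type*} [NormedAddCommGroup X] {χ : E d → X}
    (h : Continuous χ) (hc : HasCompactSupport χ) (p : ℝ≥0∞) (μ : Measure (E d))
    [IsFiniteMeasureOnCompacts μ] : MemLp χ p μ :=
  h.memLp_of_hasCompactSupport hc

/-- The fundamental lemma of the calculus of variations, applied to `G - G'`; the direction `e`
tests its components. -/
theorem IsWeakGrad.ae_eq {O : Set (E d)} (hO : IsOpen O) {v : E d → ℝ} {G G' : E d → E d}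
    (hG : MemLp G 2 (volume.restrict O)) (hG' : MemLp G' 2 (volume.restrict O))
    (h : IsWeakGrad O v G) (h' : IsWeakGrad O v G') : G =ᵐ[volume.restrict O] G' := by
  have hloc : LocallyIntegrableOn (fun x => G x - G' x) O volume :=
    locallyIntegrableOn_of_locallyIntegrable_restrict
      ((hG.sub hG').locallyIntegrable one_le_two)
  have := hO.ae_eq_zero_of_integral_contDiff_smul_eq_zero hloc ?_
  · rw [EventuallyEq, ae_restrict_iff' hO.measurableSet]
    filter_upwards [this] with x hx hxO
    exact sub_eq_zero.1 (hx hxO)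
  · intro χ h1 h2 h3
    refine ext_inner_left ℝ fun e => ?_
    have hint : ∀ {F : E d → E d}, MemLp F 2 (volume.restrict O) →
        IntegrableOn (fun x => (inner ℝ (F x) (χ x • e) : ℝ)) O := fun hF =>
      integrable_inner_of_memLp_two hF
        (memLp_of_hasCompactSupport (h1.continuous.smul continuous_const) h2.smul_right 2 _)
    have hz : ∀ x, x ∉ O → χ x • (G x - G' x) = 0 := fun x hx => by
      rw [image_eq_zero_of_notMem_tsupport fun hx' => hx (h3 hx'), zero_smul]
    rw [← setIntegral_eq_integral_of_forall_compl_eq_zero hz, inner_zero_right, ← integral_inner]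
    · have e1 : ∀ x, (inner ℝ e (χ x • (G x - G' x)) : ℝ) =
          inner ℝ (G x) (χ x • e) - inner ℝ (G' x) (χ x • e) := fun x => by
        rw [← inner_sub_left, real_inner_comm, inner_smul_left, inner_smul_right]; simp
      simp only [e1]
      rw [integral_sub (hint hG) (hint hG')]
      linarith [h χ h1 h2 h3 e, h' χ h1 h2 h3 e]
    · exact (hG.sub hG').smul (p := 2) (q := 2) (r := 1)
        (memLp_of_hasCompactSupport h1.continuous h2 2 _) |> memLp_one_iff_integrable.1

theorem IsWeakGrad.of_tendsto {O : Set (E d)} {v : E d → ℝ} {G : E d → E d}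
    {V : ℕ → E d → ℝ} {W : ℕ → E d → E d} (hv : MemLp v 2 (volume.restrict O))
    (hG : MemLp G 2 (volume.restrict O))
    (hV : ∀ n, AEStronglyMeasurable (V n) (volume.restrict O))
    (hW : ∀ n, AEStronglyMeasurable (W n) (volume.restrict O))
    (h : ∀ n, IsWeakGrad O (V n) (W n))
    (hVv : Tendsto (fun n => eLpNorm (fun x => v x - V n x) 2 (volume.restrict O)) atTop (𝓝 0))
    (hWG : Tendsto (fun n => eLpNorm (fun x => G x - W n x) 2 (volume.restrict O)) atTop (𝓝 0)) :
    IsWeakGrad O v G := by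
  intro χ h1 h2 h3 e
  have hd : Continuous fun x => fderiv ℝ χ x e :=
    (h1.continuous_fderiv (by simp)).clm_apply continuous_const
  have hdc : HasCompactSupport fun x => fderiv ℝ χ x e := h2.fderiv_apply ℝ e
  refine tendsto_nhds_unique (tendsto_integral_inner_of_tendsto_eLpNorm hv
    (memLp_of_hasCompactSupport hd hdc 2 _) hV hVv) ?_
  simp only [h _ χ h1 h2 h3 e]
  exact (tendsto_integral_inner_of_tendsto_eLpNorm hG
    (memLp_of_hasCompactSupport (h1.continuous.smul continuous_const) h2.smul_right 2 _)
    hW hWG).neg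

theorem continuous_mul_of_tsupport_subset {O : Set (E d)} {f χ : E d → ℝ}
    (hf : ∀ x ∈ O, ContinuousAt f x) (hχ : Continuous χ) (h : tsupport χ ⊆ O) :
    Continuous fun x => f x * χ x :=
  continuous_of_tsupport fun x hx =>
    (hf x (h (tsupport_mul_subset_right hx))).mul hχ.continuousAt

/-- Integration by parts. Smoothness is asked only at points of `O`, because `ψ ∘ F⁻¹` is
uncontrolled off the element. Multiplying by a test function supported in `O` makes every integrand
globally continuous with compact support. -/
theorem isWeakGrad_of_contDiffAt {O : Set (E d)} {v : E d → ℝ} {G : E d → E d}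
    (hv : ∀ x ∈ O, ContDiffAt ℝ 1 v x) (hG : ∀ x ∈ O, G x = gradient v x) (hO : MeasurableSet O) :
    IsWeakGrad O v G := by
  intro χ h1 h2 h3 e
  have hd : Continuous fun x => fderiv ℝ χ x e :=
    (h1.continuous_fderiv (by simp)).clm_apply continuous_const
  have hdc : HasCompactSupport fun x => fderiv ℝ χ x e := h2.fderiv_apply ℝ e
  have hds : tsupport (fun x => fderiv ℝ χ x e) ⊆ O :=
    (tsupport_fderiv_apply_subset ℝ e).trans h3
  have hvc : ∀ x ∈ O, ContinuousAt v x := fun x hx => (hv x hx).continuousAt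
  have hvd : ∀ x ∈ O, ContinuousAt (fun x => fderiv ℝ v x e) x := fun x hx =>
    ((hv x hx).continuousAt_fderiv one_ne_zero).clm_apply continuousAt_const
  have key := integral_mul_fderiv_eq_neg_fderiv_mul_of_integrable (μ := volume) (f := v) (g := χ)
    (v := e)
    ((continuous_mul_of_tsupport_subset hvd h1.continuous h3).integrable_of_hasCompactSupport
      h2.mul_left)
    ((continuous_mul_of_tsupport_subset hvc hd hds).integrable_of_hasCompactSupport hdc.mul_left)
    ((continuous_mul_of_tsupport_subset hvc h1.continuous h3).integrable_of_hasCompactSupport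
      h2.mul_left)
    (fun x hx => (hv x (h3 hx)).differentiableAt one_ne_zero)
    (fun x _ => (h1.differentiable (by simp)) x)
  have z1 : ∀ x, x ∉ O → inner ℝ (v x) (fderiv ℝ χ x e) = 0 := fun x hx => by
    rw [image_eq_zero_of_notMem_tsupport (f := fun x => fderiv ℝ χ x e) fun hx' => hx (hds hx'),
      inner_zero_right]
  have e2 : ∫ x in O, inner ℝ (G x) (χ x • e) = ∫ x, fderiv ℝ v x e * χ x := by
    rw [← setIntegral_eq_integral_of_forall_compl_eq_zero (s := O) (f := fun x => fderiv ℝ v x e * χ x)]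
    · refine setIntegral_congr_fun hO fun x hx => ?_
      rw [hG x hx, gradient, real_inner_smul_right, InnerProductSpace.toDual_symm_apply, mul_comm]
    · intro x hx
      rw [image_eq_zero_of_notMem_tsupport fun hx' => hx (h3 hx'), mul_zero]
  rw [setIntegral_eq_integral_of_forall_compl_eq_zero z1, e2, ← key]
  refine integral_congr_ae (Eventually.of_forall fun x => ?_)
  simp [mul_comm]

/-! ### `H¹₀(Ω)` -/

theorem gradient_add' {φ ψ : E d → ℝ} (hφ : Differentiable ℝ φ) (hψ : Differentiable ℝ ψ) (x : E d) :
    gradient (fun x => φ x + ψ x) x = gradient φ x + gradient ψ x := by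
  simp only [gradient]
  rw [fderiv_fun_add (hφ x) (hψ x), map_add]

theorem gradient_const_mul' {φ : E d → ℝ} (hφ : Differentiable ℝ φ) (c : ℝ) (x : E d) :
    gradient (fun x => c * φ x) x = c • gradient φ x := by
  simp only [gradient]
  rw [fderiv_const_mul (hφ x), map_smulₛₗ]
  simp

theorem continuous_gradient {φ : E d → ℝ} (hφ : ContDiff ℝ ∞ φ) : Continuous (gradient φ) :=
  (InnerProductSpace.toDual ℝ (E d)).symm.continuous.comp (hφ.continuous_fderiv (by simp))

/-- The graph of the gradient on `C_c^∞(Ω)`. -/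
def smoothGraph (Ω : Set (E d)) : Submodule ℝ (L2 Ω × L2v Ω) where
  carrier := {P | ∃ φ : E d → ℝ, ContDiff ℝ ∞ φ ∧ HasCompactSupport φ ∧ tsupport φ ⊆ Ω ∧
    P.1 =ᵐ[volume.restrict Ω] φ ∧ P.2 =ᵐ[volume.restrict Ω] gradient φ}
  add_mem' := by
    rintro P Q ⟨φ, h1, h2, h3, h4, h5⟩ ⟨ψ, k1, k2, k3, k4, k5⟩
    refine ⟨fun x => φ x + ψ x, h1.add k1, h2.add k2, (tsupport_add φ ψ).trans (union_subset h3 k3),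
      ?_, ?_⟩
    · filter_upwards [Lp.coeFn_add P.1 Q.1, h4, k4] with x a b c
      rw [Prod.fst_add, a, Pi.add_apply, b, c]
    · filter_upwards [Lp.coeFn_add P.2 Q.2, h5, k5] with x a b c
      rw [Prod.snd_add, a, Pi.add_apply, b, c,
        gradient_add' (h1.differentiable (by simp)) (k1.differentiable (by simp))]
  zero_mem' := by
    refine ⟨fun _ => 0, contDiff_const, HasCompactSupport.zero, by simp [tsupport], ?_, ?_⟩
    · filter_upwards [Lp.coeFn_zero ℝ 2 (volume.restrict Ω)] with x a
      rw [Prod.fst_zero, a, Pi.zero_apply]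
    · filter_upwards [Lp.coeFn_zero (E d) 2 (volume.restrict Ω)] with x a
      rw [Prod.snd_zero, a, Pi.zero_apply]
      simp [gradient]
  smul_mem' := by
    rintro c P ⟨φ, h1, h2, h3, h4, h5⟩
    refine ⟨fun x => c * φ x, contDiff_const.mul h1, h2.mul_left,
      (tsupport_mul_subset_right).trans h3, ?_, ?_⟩
    · filter_upwards [Lp.coeFn_smul c P.1, h4] with x a b
      rw [Prod.smul_fst, a, Pi.smul_apply, b, smul_eq_mul]
    · filter_upwards [Lp.coeFn_smul c P.2, h5] with x a b
      rw [Prod.smul_snd, a, Pi.smul_apply, b, gradient_const_mul' (h1.differentiable (by simp))]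

theorem coe_topologicalClosure_smoothGraph (Ω : Set (E d)) :
    ((smoothGraph Ω).topologicalClosure : Set (L2 Ω × L2v Ω)) = H10Graph Ω :=
  (smoothGraph Ω).topologicalClosure_coe

variable {Ω : Set (E d)}

theorem H10Graph_add {P Q : L2 Ω × L2v Ω} (hP : P ∈ H10Graph Ω) (hQ : Q ∈ H10Graph Ω) :
    P + Q ∈ H10Graph Ω := by
  rw [← coe_topologicalClosure_smoothGraph, SetLike.mem_coe] at *
  exact add_mem hP hQ

theorem H10Graph_smul (c : ℝ) {P : L2 Ω × L2v Ω} (hP : P ∈ H10Graph Ω) :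
    c • P ∈ H10Graph Ω := by
  rw [← coe_topologicalClosure_smoothGraph, SetLike.mem_coe] at *
  exact Submodule.smul_mem _ c hP

theorem exists_seq_of_mem_H10Graph {v : L2 Ω} {G : L2v Ω} (h : (v, G) ∈ H10Graph Ω) :
    ∃ φ : ℕ → E d → ℝ, (∀ n, ContDiff ℝ ∞ (φ n)) ∧ (∀ n, HasCompactSupport (φ n)) ∧
      (∀ n, tsupport (φ n) ⊆ Ω) ∧
      Tendsto (fun n => eLpNorm (fun x => v x - φ n x) 2 (volume.restrict Ω)) atTop (𝓝 0) ∧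
      Tendsto (fun n => eLpNorm (fun x => G x - gradient (φ n) x) 2 (volume.restrict Ω))
        atTop (𝓝 0) := by
  obtain ⟨P, hP, hlim⟩ := mem_closure_iff_seq_limit.1 h
  choose φ h1 h2 h3 h4 h5 using hP
  refine ⟨φ, h1, h2, h3, ?_, ?_⟩
  · have := (tendsto_iff_edist_tendsto_0.1 ((continuous_fst.tendsto _).comp hlim))
    refine this.congr fun n => ?_
    rw [edist_comm, Lp.edist_def]
    refine eLpNorm_congr_ae ?_
    filter_upwards [h4 n] with x hx
    simp [hx]
  · have := (tendsto_iff_edist_tendsto_0.1 ((continuous_snd.tendsto _).comp hlim))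
    refine this.congr fun n => ?_
    rw [edist_comm, Lp.edist_def]
    refine eLpNorm_congr_ae ?_
    filter_upwards [h5 n] with x hx
    simp [hx]

/-- Integration by parts holds for the smooth approximants and survives the `L²` limit. Smaller sets
`O` are allowed so that the global gradient can be compared with the broken one on a single cell. -/
theorem isWeakGrad_of_mem_H10Graph {v : L2 Ω} {G : L2v Ω} (h : (v, G) ∈ H10Graph Ω)
    {O : Set (E d)} (hO : IsOpen O) (hOΩ : O ⊆ Ω) : IsWeakGrad O v G := by
  obtain ⟨φ, h1, h2, h3, h4, h5⟩ := exists_seq_of_mem_H10Graph h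
  have hle := Measure.restrict_mono hOΩ (le_refl (volume : Measure (E d)))
  refine IsWeakGrad.of_tendsto ((Lp.memLp v).mono_measure hle) ((Lp.memLp G).mono_measure hle)
    (fun n => (h1 n).continuous.aestronglyMeasurable)
    (fun n => (continuous_gradient (h1 n)).aestronglyMeasurable)
    (fun n => isWeakGrad_of_contDiffAt (fun x _ => ((h1 n).of_le (by simp)).contDiffAt)
      (fun x _ => rfl) hO.measurableSet) ?_ ?_
  · exact tendsto_of_tendsto_of_tendsto_of_le_of_le tendsto_const_nhds h4 (fun _ => zero_le)
      fun n => eLpNorm_mono_measure _ hle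
  · exact tendsto_of_tendsto_of_tendsto_of_le_of_le tendsto_const_nhds h5 (fun _ => zero_le)
      fun n => eLpNorm_mono_measure _ hle

theorem H10Graph_unique (hΩ : IsOpen Ω) {v : L2 Ω} {G G' : L2v Ω} (h : (v, G) ∈ H10Graph Ω)
    (h' : (v, G') ∈ H10Graph Ω) : G = G' :=
  Lp.ext <| IsWeakGrad.ae_eq hΩ (Lp.memLp G) (Lp.memLp G')
    (isWeakGrad_of_mem_H10Graph h hΩ subset_rfl) (isWeakGrad_of_mem_H10Graph h' hΩ subset_rfl)

theorem grad_mem {v : L2 Ω} (h : v ∈ H10 Ω) : (v, grad Ω v) ∈ H10Graph Ω := by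
  have h' : ∃ G, (v, G) ∈ H10Graph Ω := h
  rw [grad, dif_pos h']
  exact h'.choose_spec

theorem grad_eq (hΩ : IsOpen Ω) {v : L2 Ω} {G : L2v Ω} (h : (v, G) ∈ H10Graph Ω) :
    grad Ω v = G :=
  H10Graph_unique hΩ (grad_mem ⟨G, h⟩) h

variable (Ω) in
/-- `H¹₀(Ω)` as a subspace of `L²(Ω)`. -/
def H10Sub : Submodule ℝ (L2 Ω) where
  carrier := H10 Ω
  add_mem' := fun ⟨G, h⟩ ⟨G', h'⟩ => ⟨G + G', H10Graph_add h h'⟩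
  zero_mem' := ⟨0, by
    have := (smoothGraph Ω).topologicalClosure.zero_mem
    rwa [← SetLike.mem_coe, coe_topologicalClosure_smoothGraph] at this⟩
  smul_mem' := fun c _ ⟨G, h⟩ => ⟨c • G, H10Graph_smul c h⟩

/-- The weak gradient, as a linear map on `H¹₀(Ω)`. -/
noncomputable def gradLM (hΩ : IsOpen Ω) : H10Sub Ω →ₗ[ℝ] L2v Ω where
  toFun v := grad Ω v
  map_add' v w := grad_eq hΩ (H10Graph_add (grad_mem v.2) (grad_mem w.2))
  map_smul' c v := grad_eq hΩ (H10Graph_smul c (grad_mem v.2))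

theorem grad_sub (hΩ : IsOpen Ω) {v w : L2 Ω} (hv : v ∈ H10 Ω) (hw : w ∈ H10 Ω) :
    grad Ω (v - w) = grad Ω v - grad Ω w :=
  (gradLM hΩ).map_sub ⟨v, hv⟩ ⟨w, hw⟩

theorem grad_smul (hΩ : IsOpen Ω) (c : ℝ) {v : L2 Ω} (hv : v ∈ H10 Ω) :
    grad Ω (c • v) = c • grad Ω v :=
  (gradLM hΩ).map_smul c ⟨v, hv⟩

theorem abs_inner_le_negNorm_mul (hΩ : IsOpen Ω) {ψ v : L2 Ω} (hv : v ∈ H10 Ω)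
    (hψ : negNorm Ω ψ ≠ ⊤) : |inner ℝ ψ v| ≤ (negNorm Ω ψ).toReal * ‖grad Ω v‖ := by
  have key : ∀ y ∈ H10 Ω, ‖grad Ω y‖ ≤ 1 → |inner ℝ ψ y| ≤ (negNorm Ω ψ).toReal := by
    intro y hy hy1
    rw [← ENNReal.ofReal_le_iff_le_toReal hψ]
    exact le_iSup₂_of_le y ⟨hy, hy1⟩ le_rfl
  have hs : ∀ c : ℝ, c • v ∈ H10 Ω := fun c => (H10Sub Ω).smul_mem c hv
  rcases eq_or_ne ‖grad Ω v‖ 0 with h0 | h0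
  · rw [h0, mul_zero]
    -- If `∇v = 0`, all multiples `n v` lie in the unit ball, so finiteness of the dual norm forces
    -- the pairing to vanish; Poincaré's inequality is not required.
    have : ∀ n : ℕ, n * |inner ℝ ψ v| ≤ (negNorm Ω ψ).toReal := fun n => by
      have := key _ (hs n) (by rw [grad_smul hΩ _ hv, norm_smul, h0]; simp)
      rwa [inner_smul_right, abs_mul, Nat.abs_cast] at this
    by_contra! hlt
    obtain ⟨n, hn⟩ := exists_nat_gt ((negNorm Ω ψ).toReal / |inner ℝ ψ v|)
    rw [div_lt_iff₀ hlt] at hn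
    exact absurd (this n) (not_le.2 hn)
  · have h1 : 0 < ‖grad Ω v‖ := lt_of_le_of_ne (norm_nonneg _) h0.symm
    have := key _ (hs ‖grad Ω v‖⁻¹) (by
      rw [grad_smul hΩ _ hv, norm_smul, norm_inv, norm_norm, inv_mul_cancel₀ h0])
    rwa [inner_smul_right, abs_mul, abs_inv, abs_norm, inv_mul_eq_div, div_le_iff₀ h1] at this

/-- A supremum of continuous functions, possibly over an uncountable family: lower semicontinuity
still yields Borel measurability, needed along `U^d_t`. -/
theorem lowerSemicontinuous_negNorm : LowerSemicontinuous (negNorm Ω) := by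
  unfold negNorm
  refine lowerSemicontinuous_iSup fun v => lowerSemicontinuous_iSup fun _ => ?_
  refine Continuous.lowerSemicontinuous ?_
  exact ENNReal.continuous_ofReal.comp (continuous_id.inner continuous_const).abs

end IPDG

namespace IPDG

variable {d : ℕ}

/-! ### The reference cube and the element maps -/

theorem openCube_subset_cube : openCube d ⊆ cube d := fun _ hx i => Ioo_subset_Icc_self (hx i)

theorem isOpen_openCube : IsOpen (openCube d) := by
  have : openCube d = ⋂ i, {x : E d | x i ∈ Ioo (-1 : ℝ) 1} := by ext; simp [openCube]
  rw [this]
  exact isOpen_iInter_of_finite fun i => isOpen_Ioo.preimage (by fun_prop)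

theorem cube_eq_preimage :
    cube d = WithLp.ofLp ⁻¹' (Icc (fun _ => (-1 : ℝ)) (fun _ => 1) : Set (Fin d → ℝ)) := by
  ext x; simp [cube, Pi.le_def, forall_and]

theorem isCompact_cube : IsCompact (cube d) := by
  rw [cube_eq_preimage]
  exact (PiLp.homeomorph 2 (fun _ : Fin d => ℝ)).isCompact_preimage.2 isCompact_Icc

theorem volume_cube_diff_openCube : volume (cube d \ openCube d) = 0 := by
  refine measure_mono_null (t := ⋃ i, ({x : E d | x i = 1} ∪ {x : E d | x i = -1})) ?_ ?_
  · rintro x ⟨hx, hx'⟩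
    simp only [openCube, mem_ofPred_eq, not_forall] at hx'
    obtain ⟨i, hi⟩ := hx'
    refine mem_iUnion.2 ⟨i, ?_⟩
    by_contra h
    simp only [mem_union, mem_ofPred_eq, not_or] at h
    exact hi ⟨lt_of_le_of_ne (hx i).1 (Ne.symm h.2), lt_of_le_of_ne (hx i).2 h.1⟩
  · refine measure_iUnion_null fun i => measure_union_null ?_ ?_
    all_goals
      exact (PiLp.volume_preserving_ofLp (Fin d)).quasiMeasurePreserving.preimage_null
        (Measure.pi_hyperplane (fun _ => volume) i _)

namespace ElementMap

variable (F : ElementMap d)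

theorem inv_mem {x : E d} (hx : x ∈ F.elem) : F.inv x ∈ cube d :=
  Function.invFunOn_mem hx

theorem toFun_inv {x : E d} (hx : x ∈ F.elem) : F.toFun (F.inv x) = x :=
  Function.invFunOn_eq hx

theorem inv_toFun {y : E d} (hy : y ∈ cube d) : F.inv (F.toFun y) = y :=
  F.injOn.leftInvOn_invFunOn hy

theorem cell_subset_elem : F.cell ⊆ F.elem := image_mono openCube_subset_cube

theorem elem_subset_cell_union_bdry : F.elem ⊆ F.cell ∪ F.bdry := by
  rw [elem, cell, bdry, ← image_union, union_sdiff_cancel openCube_subset_cube]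

theorem bdry_subset_elem : F.bdry ⊆ F.elem := image_mono sdiff_subset

theorem isCompact_bdry : IsCompact F.bdry :=
  (isCompact_cube.diff isOpen_openCube).image F.contDiff.continuous

theorem hasFDerivAt (y : E d) : HasFDerivAt F.toFun (fderiv ℝ F.toFun y) y :=
  ((F.contDiff.differentiable (by simp)) y).hasFDerivAt

theorem volume_bdry : volume F.bdry = 0 :=
  addHaar_image_eq_zero_of_differentiableOn_of_addHaar_eq_zero _
    (fun y _ => (F.hasFDerivAt y).differentiableAt.differentiableWithinAt)
    volume_cube_diff_openCube

/-- The Jacobian at a point of the reference cube. -/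
noncomputable def jac {y : E d} (hy : y ∈ cube d) : E d ≃L[ℝ] E d :=
  (fderiv ℝ F.toFun y).toContinuousLinearEquivOfDetNeZero (F.det_ne_zero y hy)

theorem coe_jac {y : E d} (hy : y ∈ cube d) : (F.jac hy : E d →L[ℝ] E d) = fderiv ℝ F.toFun y :=
  ContinuousLinearMap.coe_toContinuousLinearEquivOfDetNeZero _ _

theorem inverse_fderiv {y : E d} (hy : y ∈ cube d) :
    (fderiv ℝ F.toFun y).inverse = (F.jac hy).symm := by
  rw [← F.coe_jac hy, ContinuousLinearMap.inverse_equiv]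

/-- The inverse function theorem. The local inverse takes values in the open cube near `F y`, and
`F` is injective there, so the chosen inverse `F.inv` agrees with it and inherits smoothness and
derivative. -/
theorem cell_mem_nhds_and_inv {y : E d} (hy : y ∈ openCube d) :
    F.cell ∈ 𝓝 (F.toFun y) ∧ ContDiffAt ℝ ∞ F.inv (F.toFun y) ∧
      HasFDerivAt F.inv ((fderiv ℝ F.toFun y).inverse) (F.toFun y) := by
  have hy' := openCube_subset_cube hy
  have hc : ContDiffAt ℝ ∞ F.toFun y := F.contDiff.contDiffAt
  have hd : HasFDerivAt F.toFun (F.jac hy' : E d →L[ℝ] E d) y := by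
    rw [F.coe_jac]; exact F.hasFDerivAt y
  have hs : HasStrictFDerivAt F.toFun (F.jac hy' : E d →L[ℝ] E d) y :=
    hc.hasStrictFDerivAt' hd (by simp)
  have h1 : ∀ᶠ x in 𝓝 (F.toFun y), hs.localInverse F.toFun _ y x ∈ openCube d :=
    hs.localInverse_tendsto (isOpen_openCube.mem_nhds hy)
  have h2 := hs.eventually_right_inverse
  have h3 : F.inv =ᶠ[𝓝 (F.toFun y)] hs.localInverse F.toFun _ y := by
    filter_upwards [h1, h2] with x hx1 hx2
    nth_rewrite 1 [← hx2]
    exact F.inv_toFun (openCube_subset_cube hx1)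
  refine ⟨?_, ?_, ?_⟩
  · filter_upwards [h1, h2] with x hx1 hx2
    exact ⟨_, hx1, hx2⟩
  · exact (hc.to_localInverse hd (by simp)).congr_of_eventuallyEq h3
  · rw [F.inverse_fderiv hy']
    exact hs.to_localInverse.hasFDerivAt.congr_of_eventuallyEq h3

theorem isOpen_cell : IsOpen F.cell := by
  rw [isOpen_iff_mem_nhds]
  rintro _ ⟨y, hy, rfl⟩
  exact (F.cell_mem_nhds_and_inv hy).1

theorem contDiffAt_push {ψ : E d → ℝ} (hψ : ContDiff ℝ ∞ ψ) {x : E d} (hx : x ∈ F.cell) :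
    ContDiffAt ℝ ∞ (F.push ψ) x := by
  obtain ⟨y, hy, rfl⟩ := hx
  exact hψ.contDiffAt.comp _ (F.cell_mem_nhds_and_inv hy).2.1

theorem pushGrad_eq_gradient {ψ : E d → ℝ} (hψ : ContDiff ℝ ∞ ψ) {x : E d} (hx : x ∈ F.cell) :
    F.pushGrad ψ x = gradient (F.push ψ) x := by
  obtain ⟨y, hy, rfl⟩ := hx
  have hi := F.inv_toFun (openCube_subset_cube hy)
  have h1 : HasFDerivAt ψ (fderiv ℝ ψ y) (F.inv (F.toFun y)) := by
    rw [hi]; exact (hψ.differentiable (by simp) y).hasFDerivAt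
  have h2 := h1.comp (F.toFun y) (F.cell_mem_nhds_and_inv hy).2.2
  refine ext_inner_right ℝ fun e => ?_
  rw [pushGrad, invTranspose, hi, ContinuousLinearMap.adjoint_inner_left, gradient, gradient,
    InnerProductSpace.toDual_symm_apply, InnerProductSpace.toDual_symm_apply,
    show fderiv ℝ (F.push ψ) (F.toFun y) = _ from h2.fderiv]
  rfl

/-- Together with `push_comp`, this makes `φ ∘ F` an admissible approximant in `IsPiecewiseH1` for
any smooth `φ` on the whole space. -/
theorem pushGrad_comp {φ : E d → ℝ} (hφ : ContDiff ℝ ∞ φ) {x : E d} (hx : x ∈ F.elem) :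
    F.pushGrad (φ ∘ F.toFun) x = gradient φ x := by
  refine ext_inner_right ℝ fun e => ?_
  have h1 : HasFDerivAt φ (fderiv ℝ φ x) (F.toFun (F.inv x)) := by
    rw [F.toFun_inv hx]; exact (hφ.differentiable (by simp) x).hasFDerivAt
  rw [pushGrad, invTranspose, ContinuousLinearMap.adjoint_inner_left, gradient, gradient,
    InnerProductSpace.toDual_symm_apply, InnerProductSpace.toDual_symm_apply,
    (h1.comp _ (F.hasFDerivAt _)).fderiv, F.inverse_fderiv (F.inv_mem hx),
    ← F.coe_jac (F.inv_mem hx)]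
  simp

theorem push_comp {φ : E d → ℝ} {x : E d} (hx : x ∈ F.elem) :
    F.push (φ ∘ F.toFun) x = φ x := by
  rw [push, Function.comp_apply, F.toFun_inv hx]

theorem isWeakGrad_push {ψ : E d → ℝ} (hψ : ContDiff ℝ ∞ ψ) :
    IsWeakGrad F.cell (F.push ψ) (F.pushGrad ψ) :=
  isWeakGrad_of_contDiffAt (fun _ hx => (F.contDiffAt_push hψ hx).of_le (by simp))
    (fun _ hx => F.pushGrad_eq_gradient hψ hx) F.isOpen_cell.measurableSet

theorem aestronglyMeasurable_push {ψ : E d → ℝ} (hψ : ContDiff ℝ ∞ ψ) :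
    AEStronglyMeasurable (F.push ψ) (volume.restrict F.cell) :=
  ContinuousOn.aestronglyMeasurable
    (fun _ hx => (F.contDiffAt_push hψ hx).continuousAt.continuousWithinAt)
    F.isOpen_cell.measurableSet

theorem aestronglyMeasurable_pushGrad {ψ : E d → ℝ} (hψ : ContDiff ℝ ∞ ψ) :
    AEStronglyMeasurable (F.pushGrad ψ) (volume.restrict F.cell) := by
  have : ContinuousOn (gradient (F.push ψ)) F.cell := fun x hx =>
    ((InnerProductSpace.toDual ℝ (E d)).symm.continuous.continuousAt.comp
      ((F.contDiffAt_push hψ hx).continuousAt_fderiv (by simp))).continuousWithinAt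
  exact (this.congr fun x hx => F.pushGrad_eq_gradient hψ hx).aestronglyMeasurable
    F.isOpen_cell.measurableSet

end ElementMap

/-! ### Broken gradients on the mesh and the lower bound for the energy norm. -/

namespace Mesh

variable {Ω : Set (E d)} (M : Mesh d Ω)

theorem isWeakGrad_of_isPiecewiseH1 {v : L2 Ω} {g : L2v Ω}
    {τ : ∀ k : Fin M.N, Lp ℝ 2 ((μHE[d - 1] : Measure (E d)).restrict (M.map k).bdry)}
    (h : M.IsPiecewiseH1 v g τ) (k : Fin M.N) : IsWeakGrad (M.map k).cell v g := by
  obtain ⟨ψ, h1, h2, h3, -⟩ := h k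
  have hle := Measure.restrict_mono (M.cell_subset k) (le_refl (volume : Measure (E d)))
  exact IsWeakGrad.of_tendsto ((Lp.memLp v).mono_measure hle) ((Lp.memLp g).mono_measure hle)
    (fun n => (M.map k).aestronglyMeasurable_push (h1 n))
    (fun n => (M.map k).aestronglyMeasurable_pushGrad (h1 n))
    (fun n => (M.map k).isWeakGrad_push (h1 n)) h2 h3

theorem ae_mem_iUnion_cell (hΩ : IsOpen Ω) :
    ∀ᵐ x ∂volume.restrict Ω, x ∈ ⋃ k, (M.map k).cell := by
  have h0 : volume (⋃ k, (M.map k).bdry) = 0 := measure_iUnion_null fun k => (M.map k).volume_bdry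
  have h1 : ∀ᵐ x ∂volume.restrict Ω, x ∉ ⋃ k, (M.map k).bdry :=
    ae_restrict_of_ae (measure_eq_zero_iff_ae_notMem.1 h0)
  filter_upwards [h1, ae_restrict_mem hΩ.measurableSet] with x hx hxΩ
  have : x ∈ ⋃ k, (M.map k).elem := by rw [M.cover]; exact subset_closure hxΩ
  obtain ⟨k, hk⟩ := mem_iUnion.1 this
  refine mem_iUnion.2 ⟨k, ((M.map k).elem_subset_cell_union_bdry hk).resolve_right fun h => ?_⟩
  exact hx (mem_iUnion.2 ⟨k, h⟩)

theorem lintegral_eq_sum_cell (hΩ : IsOpen Ω) (φ : E d → ℝ≥0∞) :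
    ∫⁻ x in Ω, φ x = ∑ k, ∫⁻ x in (M.map k).cell, φ x := by
  have hm : MeasurableSet (⋃ k, (M.map k).cell) :=
      MeasurableSet.iUnion fun k => (M.map k).isOpen_cell.measurableSet
  rw [← tsum_fintype (L := .unconditional _),
    ← lintegral_iUnion (fun k => (M.map k).isOpen_cell.measurableSet) M.disjoint]
  refine (lintegral_mono_set (iUnion_subset M.cell_subset)).antisymm' ?_
  calc ∫⁻ x in Ω, φ x = ∫⁻ x in Ω ∩ ⋃ k, (M.map k).cell, φ x := by
        rw [inter_comm, ← Measure.restrict_restrict hm,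
          Measure.restrict_eq_self_of_ae_mem (M.ae_mem_iUnion_cell hΩ)]
    _ ≤ _ := lintegral_mono_set inter_subset_right

theorem enorm_sq_eq_sum_cell (hΩ : IsOpen Ω) (g : L2v Ω) :
    ‖g‖ₑ ^ 2 = ∑ k, ∫⁻ x in (M.map k).cell, ‖g x‖ₑ ^ 2 := by
  rw [← M.lintegral_eq_sum_cell hΩ, Lp.enorm_def, eLpNorm_eq_lintegral_rpow_enorm_toReal (by simp)
    (by simp), ← ENNReal.rpow_natCast, ← ENNReal.rpow_mul]
  simp

/-- On `H¹₀(Ω)` the energy norm dominates the norm of the weak gradient. -/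
theorem enorm_grad_le_energyNorm (hΩ : IsOpen Ω) (p : ℕ) (Cσ : ℝ) {v : L2 Ω} (hv : v ∈ H10 Ω) :
    ‖grad Ω v‖ₑ ≤ M.energyNorm p Cσ v := by
  refine le_iInf fun g => le_iInf fun τ => le_iInf fun h => ?_
  -- Both `∇v` and any admissible `g` are weak gradients of `v` on the open cell, hence agree a.e.
  -- there; the face terms are simply dropped afterwards.
  have hg : ∀ k, ∫⁻ x in (M.map k).cell, ‖grad Ω v x‖ₑ ^ 2 =
      ∫⁻ x in (M.map k).cell, ‖g x‖ₑ ^ 2 := by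
    intro k
    have hle := Measure.restrict_mono (M.cell_subset k) (le_refl (volume : Measure (E d)))
    have := IsWeakGrad.ae_eq (M.map k).isOpen_cell ((Lp.memLp (grad Ω v)).mono_measure hle)
      ((Lp.memLp g).mono_measure hle)
      (isWeakGrad_of_mem_H10Graph (grad_mem hv) (M.map k).isOpen_cell (M.cell_subset k))
      (M.isWeakGrad_of_isPiecewiseH1 h k)
    refine lintegral_congr_ae ?_
    filter_upwards [this] with x hx
    rw [hx]
  calc ‖grad Ω v‖ₑ = (‖grad Ω v‖ₑ ^ 2) ^ (1 / 2 : ℝ) := by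
        rw [← ENNReal.rpow_natCast, ← ENNReal.rpow_mul]; norm_num
    _ ≤ _ := by
        refine ENNReal.rpow_le_rpow ?_ (by norm_num)
        rw [M.enorm_sq_eq_sum_cell hΩ, Finset.sum_congr rfl fun k _ => hg k]
        exact le_add_right (le_add_right le_rfl)

end Mesh

end IPDG

namespace IPDG

open scoped NNReal

/-! ### The trace inequality -/

theorem sq_le_integral_of_contDiff {f f' : ℝ → ℝ} (hf : ∀ s, HasDerivAt f (f' s) s)
    (hf' : Continuous f') {c : ℝ} (hc : c = 1 ∨ c = -1) :
    f c ^ 2 ≤ ∫ s in (-1 : ℝ)..1, 2 * (f s ^ 2 + f' s ^ 2) := by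
  have hfc : Continuous f := continuous_iff_continuousAt.2 fun s => (hf s).continuousAt
  -- The linear weight `c (1 + c s) / 2` equals `c` at the endpoint `c` and vanishes at `-c`, so for
  -- either sign the fundamental theorem of calculus returns exactly `f(c)²`.
  have hd : ∀ s, HasDerivAt (fun s => c * (1 + c * s) / 2 * f s ^ 2)
      (c * c / 2 * f s ^ 2 + c * (1 + c * s) * f s * f' s) s := fun s => by
    have h1 : HasDerivAt (fun s : ℝ => c * (1 + c * s) / 2) (c * c / 2) s := by
      simpa using ((((hasDerivAt_id s).const_mul c).const_add 1).const_mul c).div_const 2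
    refine (h1.mul ((hf s).pow 2)).congr_deriv ?_
    simp
    ring
  have hcont : Continuous fun s => c * c / 2 * f s ^ 2 + c * (1 + c * s) * f s * f' s := by fun_prop
  have h1 := intervalIntegral.integral_eq_sub_of_hasDerivAt (a := -1) (b := 1) (fun s _ => hd s)
    (hcont.intervalIntegrable _ _)
  have h2 : f c ^ 2 = ∫ s in (-1 : ℝ)..1, (c * c / 2 * f s ^ 2 + c * (1 + c * s) * f s * f' s) := by
    rw [h1]
    rcases hc with rfl | rfl <;> ring
  rw [h2]
  refine intervalIntegral.integral_mono_on (by norm_num) (hcont.intervalIntegrable _ _)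
    (Continuous.intervalIntegrable (by fun_prop) _ _) fun s hs => ?_
  have hcc : c * c = 1 := by rcases hc with rfl | rfl <;> norm_num
  have hb : |c * (1 + c * s)| ≤ 2 := by
    rcases hc with rfl | rfl <;> rw [abs_le] <;> constructor <;> linarith [hs.1, hs.2]
  have h3 : c * (1 + c * s) * (f s * f' s) ≤ 2 * |f s * f' s| := by
    refine (le_abs_self _).trans ?_
    rw [abs_mul]
    exact mul_le_mul_of_nonneg_right hb (abs_nonneg _)
  have h4 : 2 * |f s * f' s| ≤ f s ^ 2 + f' s ^ 2 := by
    rw [abs_mul, ← sq_abs (f s), ← sq_abs (f' s)]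
    nlinarith [sq_nonneg (|f s| - |f' s|)]
  rw [hcc]
  nlinarith [sq_nonneg (f s), sq_nonneg (f' s)]

theorem enorm_sq_le_lintegral_of_contDiff {f f' : ℝ → ℝ} (hf : ∀ s, HasDerivAt f (f' s) s)
    (hf' : Continuous f') {c : ℝ} (hc : c = 1 ∨ c = -1) :
    ‖f c‖ₑ ^ 2 ≤ ∫⁻ s in Icc (-1 : ℝ) 1, 2 * (‖f s‖ₑ ^ 2 + ‖f' s‖ₑ ^ 2) := by
  have hfc : Continuous f := continuous_iff_continuousAt.2 fun s => (hf s).continuousAt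
  have e : ∀ x : ℝ, ‖x‖ₑ ^ 2 = ENNReal.ofReal (x ^ 2) := fun x => by
    rw [Real.enorm_eq_ofReal_abs, ← ENNReal.ofReal_pow (abs_nonneg _), sq_abs]
  have e' : ∀ s, 2 * (‖f s‖ₑ ^ 2 + ‖f' s‖ₑ ^ 2) = ENNReal.ofReal (2 * (f s ^ 2 + f' s ^ 2)) :=
    fun s => by
      rw [e, e, ← ENNReal.ofReal_add (by positivity) (by positivity),
        ENNReal.ofReal_mul (by norm_num)]
      simp
  simp only [e']
  rw [e, ← ofReal_integral_eq_lintegral_ofReal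
    ((by fun_prop : Continuous fun s => 2 * (f s ^ 2 + f' s ^ 2)).integrableOn_Icc)
    (Eventually.of_forall fun s => by positivity), integral_Icc_eq_integral_Ioc,
    ← intervalIntegral.integral_of_le (by norm_num)]
  exact ENNReal.ofReal_le_ofReal (sq_le_integral_of_contDiff hf hf' hc)

variable {n : ℕ}

/-- The affine parametrization of the hyperplane `x_i = c`. -/
noncomputable def faceMap (i : Fin (n + 1)) (c : ℝ) (y : Fin n → ℝ) : E (n + 1) :=
  WithLp.toLp 2 (i.insertNth c y)

theorem faceMap_eq_add (i : Fin (n + 1)) (c : ℝ) (y : Fin n → ℝ) :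
    faceMap i c y = faceMap i 0 y + c • EuclideanSpace.single i 1 := by
  ext j
  refine i.succAboveCases ?_ (fun j => ?_) j <;> simp [faceMap]

theorem contDiff_faceMap (i : Fin (n + 1)) (c : ℝ) : ContDiff ℝ ∞ (faceMap i c) := by
  rw [contDiff_euclidean]
  intro j
  refine i.succAboveCases ?_ (fun j => ?_) j
  · simpa [faceMap] using contDiff_const
  · simpa [faceMap] using contDiff_apply ℝ ℝ j

theorem hasDerivAt_faceMap (i : Fin (n + 1)) (c : ℝ) (y : Fin n → ℝ) :
    HasDerivAt (fun s => faceMap i s y) (EuclideanSpace.single i 1) c := by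
  rw [funext fun s => faceMap_eq_add i s y]
  simpa using ((hasDerivAt_id c).smul_const (EuclideanSpace.single i (1 : ℝ))).const_add
    (faceMap i 0 y)

/-- The cube `[-1,1]^n` in coordinates. -/
def coordCube (n : ℕ) : Set (Fin n → ℝ) := Icc (fun _ => -1) (fun _ => 1)

theorem faceMap_mem_cube {i : Fin (n + 1)} {c : ℝ} {y : Fin n → ℝ} :
    faceMap i c y ∈ cube (n + 1) ↔ c ∈ Icc (-1 : ℝ) 1 ∧ y ∈ coordCube n := by
  simp only [cube, mem_ofPred_eq, i.forall_iff_succAbove, faceMap, Fin.insertNth_apply_same,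
    Fin.insertNth_apply_succAbove, coordCube, mem_Icc, Pi.le_def, forall_and]
  tauto

theorem cube_diff_openCube_subset :
    cube (n + 1) \ openCube (n + 1) ⊆
      ⋃ i : Fin (n + 1), (faceMap i 1 '' coordCube n ∪ faceMap i (-1) '' coordCube n) := by
  rintro x ⟨hx, hx'⟩
  simp only [openCube, mem_ofPred_eq, not_forall] at hx'
  obtain ⟨i, hi⟩ := hx'
  have key : ∀ c, x i = c → x ∈ faceMap i c '' coordCube n := by
    rintro _ rfl
    have e : faceMap i (x i) (fun j => x (i.succAbove j)) = x := by
      ext j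
      refine i.succAboveCases ?_ (fun j => ?_) j <;> simp [faceMap]
    exact ⟨_, (faceMap_mem_cube.1 (e ▸ hx)).2, e⟩
  refine mem_iUnion.2 ⟨i, ?_⟩
  by_contra h
  rw [mem_union, not_or] at h
  exact hi ⟨lt_of_le_of_ne (hx i).1 fun h' => h.2 (key _ h'.symm),
    lt_of_le_of_ne (hx i).2 fun h' => h.1 (key _ h')⟩

theorem measurePreserving_faceMap (i : Fin (n + 1)) :
    MeasurePreserving (fun q : ℝ × (Fin n → ℝ) => faceMap i q.1 q.2) :=
  (PiLp.volume_preserving_toLp (Fin (n + 1))).comp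
    (volume_preserving_piFinSuccAbove (fun _ : Fin (n + 1) => ℝ) i).symm

theorem lintegral_cube_eq (i : Fin (n + 1)) {h : E (n + 1) → ℝ≥0∞} (hh : Measurable h) :
    ∫⁻ x in cube (n + 1), h x =
      ∫⁻ y in coordCube n, ∫⁻ s in Icc (-1 : ℝ) 1, h (faceMap i s y) := by
  have hp : (fun q : ℝ × (Fin n → ℝ) => faceMap i q.1 q.2) ⁻¹' cube (n + 1) =
      Icc (-1 : ℝ) 1 ×ˢ coordCube n := by
    ext q
    exact faceMap_mem_cube
  rw [← (measurePreserving_faceMap i).setLIntegral_comp_preimage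
    isCompact_cube.isClosed.measurableSet hh, hp, Measure.volume_eq_prod,
    setLIntegral_prod_symm (fun q => h (faceMap i q.1 q.2)) (hh.comp (measurePreserving_faceMap i).measurable).aemeasurable]

/-- Traces on a face of the reference cube. -/
theorem lintegral_face_le {ψ : E (n + 1) → ℝ} (hψ : ContDiff ℝ ∞ ψ) (i : Fin (n + 1)) {c : ℝ}
    (hc : c = 1 ∨ c = -1) :
    ∫⁻ y in coordCube n, ‖ψ (faceMap i c y)‖ₑ ^ 2 ≤
      ∫⁻ x in cube (n + 1), 2 * (‖ψ x‖ₑ ^ 2 + ‖fderiv ℝ ψ x‖ₑ ^ 2) := by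
  have hdc := hψ.continuous_fderiv (by simp)
  rw [lintegral_cube_eq i (by
    have h1 : Continuous fun x => ‖ψ x‖ₑ := hψ.continuous.enorm
    have h2 : Continuous fun x => ‖fderiv ℝ ψ x‖ₑ := hdc.enorm
    exact ((h1.measurable.pow_const 2).add (h2.measurable.pow_const 2)).const_mul 2)]
  refine lintegral_mono fun y => ?_
  refine (enorm_sq_le_lintegral_of_contDiff (f := fun s => ψ (faceMap i s y))
    (f' := fun s => fderiv ℝ ψ (faceMap i s y) (EuclideanSpace.single i 1))
    (fun s => ((hψ.differentiable (by simp) _).hasFDerivAt).comp_hasDerivAt s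
      (hasDerivAt_faceMap i s y)) ?_ hc).trans (lintegral_mono fun s => ?_)
  · have : Continuous fun s => faceMap i s y :=
      continuous_iff_continuousAt.2 fun s => (hasDerivAt_faceMap i s y).continuousAt
    exact (hdc.comp this).clm_apply continuous_const
  · gcongr
    rw [← ofReal_norm, ← ofReal_norm]
    refine ENNReal.ofReal_le_ofReal ?_
    simpa using (fderiv ℝ ψ (faceMap i s y)).le_opNorm (EuclideanSpace.single i 1)

/-- The image of the Hausdorff measure under a Lipschitz parametrization. -/
theorem exists_lintegral_image_le {d : ℕ} {G : (Fin n → ℝ) → E d} (hG : ContDiff ℝ ∞ G) :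
    ∃ C : ℝ≥0∞, C ≠ ⊤ ∧ ∀ h : E d → ℝ≥0∞, Measurable h →
      ∫⁻ x in G '' coordCube n, h x ∂μHE[n] ≤ C * ∫⁻ y in coordCube n, h (G y) := by
  have hcomp : IsCompact (coordCube n) := isCompact_Icc
  obtain ⟨K, hK⟩ := hcomp.exists_bound_of_continuousOn (hG.continuous_fderiv (by simp)).continuousOn
  have hL : LipschitzOnWith K.toNNReal G (coordCube n) := by
    refine (convex_Icc _ _).lipschitzOnWith_of_nnnorm_fderiv_le
      (fun y _ => hG.differentiable (by simp) y) fun y hy => ?_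
    rw [← NNReal.coe_le_coe, coe_nnnorm]
    exact (hK y hy).trans (Real.le_coe_toNNReal K)
  set c : ℝ≥0 := Measure.addHaarScalarFactor (volume : Measure (EuclideanSpace ℝ (Fin n))) μH[n]
  refine ⟨c * (K.toNNReal : ℝ≥0∞) ^ (n : ℝ), by finiteness, fun h hh => ?_⟩
  have hm : (μHE[n] : Measure (E d)).restrict (G '' coordCube n) ≤
      (c * (K.toNNReal : ℝ≥0∞) ^ (n : ℝ)) • (volume.restrict (coordCube n)).map G := by
    refine Measure.le_iff.2 fun s hs => ?_
    have hsub : s ∩ G '' coordCube n = G '' (G ⁻¹' s ∩ coordCube n) := by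
      rw [image_preimage_inter]
    have h1 := (hL.mono (inter_subset_right (s := G ⁻¹' s))).hausdorffMeasure_image_le
      (d := (n : ℝ)) (by positivity)
    -- For the sup norm on `Fin n → ℝ`, Hausdorff measure is exactly Lebesgue measure. The factor
    -- `c` only accounts for the Euclidean normalization of `μHE[n]`.
    have h2 : (μH[(n : ℝ)] : Measure (Fin n → ℝ)) = volume := by
      simpa using hausdorffMeasure_pi_real (ι := Fin n)
    rw [Measure.restrict_apply hs, hsub, Measure.smul_apply, Measure.map_apply
      hG.continuous.measurable hs, Measure.restrict_apply (hG.continuous.measurable hs),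
      Measure.euclideanHausdorffMeasure_def, Measure.smul_apply, smul_eq_mul, mul_assoc]
    rw [h2] at h1
    exact mul_le_mul_right h1 _
  calc ∫⁻ x in G '' coordCube n, h x ∂μHE[n]
      ≤ ∫⁻ x, h x ∂((c * (K.toNNReal : ℝ≥0∞) ^ (n : ℝ)) •
          (volume.restrict (coordCube n)).map G) := lintegral_mono' hm le_rfl
    _ = _ := by rw [lintegral_smul_measure, lintegral_map hh hG.continuous.measurable, smul_eq_mul]

namespace ElementMap

/-- Change of variables: `|det DF|` has a positive minimum `δ` on the compact cube, and `C = δ⁻¹`.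
-/
theorem exists_lintegral_comp_le {d : ℕ} (F : ElementMap d) :
    ∃ C : ℝ≥0∞, C ≠ ⊤ ∧ ∀ h : E d → ℝ≥0∞,
      ∫⁻ x in cube d, h (F.toFun x) ≤ C * ∫⁻ x in F.cell, h x := by
  have hdet : Continuous fun y => |(fderiv ℝ F.toFun y).det| :=
    (ContinuousLinearMap.continuous_det.comp (F.contDiff.continuous_fderiv (by simp))).abs
  obtain ⟨δ, hδ, hle⟩ : ∃ δ : ℝ, 0 < δ ∧ ∀ y ∈ cube d, δ ≤ |(fderiv ℝ F.toFun y).det| := by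
    have hne : (cube d).Nonempty := ⟨0, fun i => by simp⟩
    obtain ⟨y, hy, hmin⟩ := isCompact_cube.exists_isMinOn hne hdet.continuousOn
    exact ⟨_, abs_pos.2 (F.det_ne_zero y hy), fun z hz => hmin hz⟩
  refine ⟨(ENNReal.ofReal δ)⁻¹, by simpa using hδ, fun h => ?_⟩
  have hae : (cube d : Set (E d)) =ᵐ[volume] openCube d := by
    rw [ae_eq_set]
    exact ⟨volume_cube_diff_openCube, by rw [sdiff_eq_empty.2 openCube_subset_cube, measure_empty]⟩
  rw [setLIntegral_congr hae, cell, lintegral_image_eq_lintegral_abs_det_fderiv_mul volume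
    isOpen_openCube.measurableSet (fun y _ => (F.hasFDerivAt y).hasFDerivWithinAt)
    (F.injOn.mono openCube_subset_cube), ← lintegral_const_mul' _ _ (by simpa using hδ)]
  refine setLIntegral_mono' isOpen_openCube.measurableSet fun y hy => ?_
  calc h (F.toFun y) = (ENNReal.ofReal δ)⁻¹ * (ENNReal.ofReal δ * h (F.toFun y)) := by
        rw [← mul_assoc, ENNReal.inv_mul_cancel (by simpa using hδ) (by simp), one_mul]
    _ ≤ _ := by
        gcongr
        exact hle y (openCube_subset_cube hy)

theorem exists_fderiv_comp_le {d : ℕ} (F : ElementMap d) :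
    ∃ C : ℝ≥0∞, C ≠ ⊤ ∧ ∀ φ : E d → ℝ, ContDiff ℝ ∞ φ → ∀ y ∈ cube d,
      ‖fderiv ℝ (φ ∘ F.toFun) y‖ₑ ^ 2 ≤ C * ‖gradient φ (F.toFun y)‖ₑ ^ 2 := by
  obtain ⟨K, hK⟩ := isCompact_cube.exists_bound_of_continuousOn
    (F.contDiff.continuous_fderiv (by simp)).continuousOn
  refine ⟨ENNReal.ofReal K ^ 2, by finiteness, fun φ hφ y hy => ?_⟩
  rw [← mul_pow]
  refine pow_le_pow_left₀ zero_le ?_ 2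
  have hK0 : 0 ≤ K := (norm_nonneg _).trans (hK y hy)
  rw [← ofReal_norm, ← ofReal_norm, ← ENNReal.ofReal_mul hK0, gradient, LinearIsometryEquiv.norm_map,
    fderiv_comp _ (hφ.differentiable (by simp) _) (F.hasFDerivAt y).differentiableAt]
  refine ENNReal.ofReal_le_ofReal ((ContinuousLinearMap.opNorm_comp_le _ _).trans ?_)
  rw [mul_comm]
  exact mul_le_mul_of_nonneg_right (hK y hy) (norm_nonneg _)

/-- Integrals over the boundary of an element are bounded by integrals over the faces of the
reference cube. -/
theorem exists_lintegral_bdry_le (F : ElementMap (n + 1)) :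
    ∃ C : ℝ≥0∞, C ≠ ⊤ ∧ ∀ h : E (n + 1) → ℝ≥0∞, Measurable h →
      ∫⁻ x in F.bdry, h x ∂μHE[n] ≤ C * ∑ i : Fin (n + 1),
        ((∫⁻ y in coordCube n, h (F.toFun (faceMap i 1 y))) +
          ∫⁻ y in coordCube n, h (F.toFun (faceMap i (-1) y))) := by
  choose C hC hCle using fun (i : Fin (n + 1)) (c : ℝ) =>
    exists_lintegral_image_le (F.contDiff.comp (contDiff_faceMap i c))
  refine ⟨∑ i, (C i 1 + C i (-1)), by
    simp [ENNReal.sum_eq_top, hC], fun h hh => ?_⟩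
  have hsub : F.bdry ⊆ ⋃ i : Fin (n + 1), ((F.toFun ∘ faceMap i 1) '' coordCube n ∪
      (F.toFun ∘ faceMap i (-1)) '' coordCube n) := by
    refine (image_mono cube_diff_openCube_subset).trans ?_
    simp only [image_iUnion, image_union, image_comp]
    rfl
  refine (lintegral_mono_set hsub).trans ((lintegral_iUnion_le _ _).trans ?_)
  rw [tsum_fintype, Finset.mul_sum]
  refine Finset.sum_le_sum fun i _ => (lintegral_union_le _ _ _).trans ?_
  have hi : C i 1 + C i (-1) ≤ ∑ i, (C i 1 + C i (-1)) :=
    Finset.single_le_sum (f := fun i => C i 1 + C i (-1)) (fun _ _ => zero_le) (Finset.mem_univ i)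
  rw [mul_add]
  refine add_le_add ((hCle i 1 h hh).trans ?_) ((hCle i (-1) h hh).trans ?_)
  · exact mul_le_mul_left ((le_add_right le_rfl).trans hi) _
  · exact mul_le_mul_left ((le_add_left le_rfl).trans hi) _

theorem hausdorffMeasure_bdry_lt_top (F : ElementMap (n + 1)) :
    (μHE[n] : Measure (E (n + 1))) F.bdry < ⊤ := by
  obtain ⟨C, hC, h⟩ := F.exists_lintegral_bdry_le
  have := h (fun _ => 1) measurable_const
  simp only [lintegral_one, Measure.restrict_apply_univ] at this
  refine this.trans_lt ?_
  have hv : volume (coordCube n) ≠ ⊤ := isCompact_Icc.measure_lt_top.ne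
  have : ∑ _i : Fin (n + 1), (volume (coordCube n) + volume (coordCube n)) ≠ ⊤ :=
    ENNReal.sum_ne_top.2 fun i _ => by finiteness
  exact ENNReal.mul_lt_top hC.lt_top this.lt_top

/-- The trace inequality on an element. -/
theorem exists_trace_inequality (F : ElementMap (n + 1)) :
    ∃ C : ℝ≥0∞, C ≠ ⊤ ∧ ∀ φ : E (n + 1) → ℝ, ContDiff ℝ ∞ φ →
      ∫⁻ x in F.bdry, ‖φ x‖ₑ ^ 2 ∂μHE[n] ≤
        C * ((∫⁻ x in F.cell, ‖φ x‖ₑ ^ 2) + ∫⁻ x in F.cell, ‖gradient φ x‖ₑ ^ 2) := by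
  obtain ⟨C₁, hC₁, h₁⟩ := F.exists_lintegral_bdry_le
  obtain ⟨C₂, hC₂, h₂⟩ := F.exists_lintegral_comp_le
  obtain ⟨C₃, hC₃, h₃⟩ := F.exists_fderiv_comp_le
  -- Each of the two faces `x_i = ±1` contributes the factor `2` of the reference trace inequality.
  -- The factor `(1 + C₃) C₂` transports values and gradients from the cube to the element, and `C₁`
  -- transports the faces.
  refine ⟨C₁ * (∑ _i : Fin (n + 1), (2 + 2)) * ((1 + C₃) * C₂), ?_, fun φ hφ => ?_⟩
  · have : ∑ _i : Fin (n + 1), ((2 : ℝ≥0∞) + 2) ≠ ⊤ := ENNReal.sum_ne_top.2 fun i _ => by finiteness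
    finiteness
  set A := (∫⁻ x in F.cell, ‖φ x‖ₑ ^ 2) + ∫⁻ x in F.cell, ‖gradient φ x‖ₑ ^ 2 with hA
  have hme : Measurable fun x => ‖φ x‖ₑ ^ 2 := hφ.continuous.enorm.measurable.pow_const 2
  have hmg : Measurable fun x => ‖gradient φ x‖ₑ ^ 2 :=
    (continuous_gradient hφ).enorm.measurable.pow_const 2
  have key : ∀ i : Fin (n + 1), ∀ c : ℝ, c = 1 ∨ c = -1 →
      ∫⁻ y in coordCube n, ‖φ (F.toFun (faceMap i c y))‖ₑ ^ 2 ≤ 2 * ((1 + C₃) * C₂ * A) := by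
    intro i c hc
    refine (lintegral_face_le (hφ.comp F.contDiff) i hc).trans ?_
    rw [lintegral_const_mul' _ _ (by simp)]
    gcongr
    calc ∫⁻ x in cube (n + 1), (‖(φ ∘ F.toFun) x‖ₑ ^ 2 + ‖fderiv ℝ (φ ∘ F.toFun) x‖ₑ ^ 2)
        ≤ ∫⁻ x in cube (n + 1), (1 + C₃) * (‖φ (F.toFun x)‖ₑ ^ 2 +
            ‖gradient φ (F.toFun x)‖ₑ ^ 2) := by
          refine setLIntegral_mono' isCompact_cube.isClosed.measurableSet fun x hx => ?_
          rw [mul_add]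
          refine add_le_add ?_ ((h₃ φ hφ x hx).trans ?_)
          · exact le_mul_of_one_le_left zero_le (le_add_right le_rfl)
          · exact mul_le_mul_left (le_add_left le_rfl) _
      _ = (1 + C₃) * ∫⁻ x in cube (n + 1), (‖φ (F.toFun x)‖ₑ ^ 2 +
            ‖gradient φ (F.toFun x)‖ₑ ^ 2) := lintegral_const_mul' _ _ (by finiteness)
      _ ≤ (1 + C₃) * (C₂ * ∫⁻ x in F.cell, (‖φ x‖ₑ ^ 2 + ‖gradient φ x‖ₑ ^ 2)) := by
          gcongr
          exact h₂ fun x => ‖φ x‖ₑ ^ 2 + ‖gradient φ x‖ₑ ^ 2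
      _ = (1 + C₃) * C₂ * A := by rw [lintegral_add_left hme, mul_assoc]
  refine (h₁ _ hme).trans ?_
  rw [mul_assoc, mul_assoc]
  gcongr
  rw [Finset.sum_mul]
  refine Finset.sum_le_sum fun i _ => ?_
  rw [add_mul]
  exact add_le_add (key i 1 (Or.inl rfl)) (key i (-1) (Or.inr rfl))

end ElementMap

end IPDG

namespace IPDG

/-! ### Square roots of sums of squares -/

theorem lintegral_enorm_sq {α X : Type*} [NormedAddCommGroup X] {m : MeasurableSpace α}
    (μ : Measure α) (f : α → X) : ∫⁻ x, ‖f x‖ₑ ^ 2 ∂μ = eLpNorm f 2 μ ^ 2 := by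
  rw [eLpNorm_eq_lintegral_rpow_enorm_toReal (by simp) (by simp), ← ENNReal.rpow_natCast,
    ← ENNReal.rpow_mul]
  simp

theorem ennreal_sqrt_sq (x : ℝ≥0∞) : (x ^ 2) ^ (1 / 2 : ℝ) = x := by
  rw [← ENNReal.rpow_natCast, ← ENNReal.rpow_mul]; norm_num

theorem ennreal_sq_sqrt (x : ℝ≥0∞) : (x ^ (1 / 2 : ℝ)) ^ 2 = x := by
  rw [← ENNReal.rpow_natCast, ← ENNReal.rpow_mul]; norm_num

/-- Minkowski's inequality in `ℓ²` of two terms. Iterated, it allows the triangle inequality for the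
energy norm to be checked on each cell and face separately. -/
theorem sqrt_add_le_of_sqrt_le {a b c a' b' c' : ℝ≥0∞}
    (h : a ^ (1 / 2 : ℝ) ≤ b ^ (1 / 2 : ℝ) + c ^ (1 / 2 : ℝ))
    (h' : a' ^ (1 / 2 : ℝ) ≤ b' ^ (1 / 2 : ℝ) + c' ^ (1 / 2 : ℝ)) :
    (a + a') ^ (1 / 2 : ℝ) ≤ (b + b') ^ (1 / 2 : ℝ) + (c + c') ^ (1 / 2 : ℝ) := by
  have := ENNReal.Lp_add_le (s := Finset.univ) (f := ![b ^ (1 / 2 : ℝ), b' ^ (1 / 2 : ℝ)])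
    (g := ![c ^ (1 / 2 : ℝ), c' ^ (1 / 2 : ℝ)]) (p := 2) (by norm_num)
  simp only [Fin.sum_univ_two, Matrix.cons_val_zero, Matrix.cons_val_one, ENNReal.rpow_ofNat,
    ennreal_sq_sqrt] at this
  refine (ENNReal.rpow_le_rpow ?_ (by norm_num)).trans this
  rw [← ennreal_sq_sqrt a, ← ennreal_sq_sqrt a']
  gcongr

theorem sqrt_sum_le_of_sqrt_le {ι : Type*} (s : Finset ι) {a b c : ι → ℝ≥0∞}
    (h : ∀ i ∈ s, a i ^ (1 / 2 : ℝ) ≤ b i ^ (1 / 2 : ℝ) + c i ^ (1 / 2 : ℝ)) :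
    (∑ i ∈ s, a i) ^ (1 / 2 : ℝ) ≤
      (∑ i ∈ s, b i) ^ (1 / 2 : ℝ) + (∑ i ∈ s, c i) ^ (1 / 2 : ℝ) := by
  classical
  induction s using Finset.induction_on with
  | empty => simp
  | insert i s hi ih =>
    simp only [Finset.sum_insert hi]
    exact sqrt_add_le_of_sqrt_le (h i (Finset.mem_insert_self i s))
      (ih fun j hj => h j (Finset.mem_insert_of_mem hj))

theorem sqrt_lintegral_add_le {α X : Type*} [NormedAddCommGroup X] {m : MeasurableSpace α}
    {μ : Measure α} {f g h : α → X} (hg : AEStronglyMeasurable g μ) (hh : AEStronglyMeasurable h μ)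
    (hf : ∀ᵐ x ∂μ, f x = g x + h x) {c : ℝ≥0∞} (hc : c ≠ ⊤) :
    (∫⁻ x, c * ‖f x‖ₑ ^ 2 ∂μ) ^ (1 / 2 : ℝ) ≤
      (∫⁻ x, c * ‖g x‖ₑ ^ 2 ∂μ) ^ (1 / 2 : ℝ) + (∫⁻ x, c * ‖h x‖ₑ ^ 2 ∂μ) ^ (1 / 2 : ℝ) := by
  simp only [lintegral_const_mul' _ _ hc, lintegral_enorm_sq,
    ENNReal.mul_rpow_of_nonneg _ _ (by norm_num : (0 : ℝ) ≤ 1 / 2), ennreal_sqrt_sq]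
  rw [← mul_add, eLpNorm_congr_ae (g := g + h) hf]
  gcongr
  exact eLpNorm_add_le hg hh one_le_two

namespace ElementMap

variable {d : ℕ} (F : ElementMap d)

/-- A continuous injection of a compact set is closed onto its image. -/
theorem continuousOn_inv : ContinuousOn F.inv F.elem := by
  rw [continuousOn_iff_isClosed]
  refine fun t ht => ⟨F.toFun '' (cube d ∩ t),
    ((isCompact_cube.inter_right ht).image F.contDiff.continuous).isClosed, ?_⟩
  ext x
  constructor
  · rintro ⟨hx, hxe⟩
    exact ⟨⟨F.inv x, ⟨F.inv_mem hxe, hx⟩, F.toFun_inv hxe⟩, hxe⟩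
  · rintro ⟨⟨y, ⟨hy, hyt⟩, rfl⟩, hxe⟩
    exact ⟨by rwa [mem_preimage, F.inv_toFun hy], hxe⟩

theorem aestronglyMeasurable_push_bdry {ψ : E d → ℝ} (hψ : Continuous ψ) (μ : Measure (E d)) :
    AEStronglyMeasurable (F.push ψ) (μ.restrict F.bdry) :=
  ((hψ.comp_continuousOn F.continuousOn_inv).mono F.bdry_subset_elem).aestronglyMeasurable
    F.isCompact_bdry.isClosed.measurableSet

end ElementMap

/-! ### The energy norm as an extended seminorm. -/

namespace Mesh

variable {d : ℕ} {Ω : Set (E d)} (M : Mesh d Ω)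

/-- Families of traces on the element boundaries. -/
abbrev Traces : Type :=
  ∀ k : Fin M.N, Lp ℝ 2 ((μHE[d - 1] : Measure (E d)).restrict (M.map k).bdry)

/-- The square of the energy norm, in terms of the gradient and the traces. -/
noncomputable def energySq (p : ℕ) (Cσ : ℝ) (g : L2v Ω) (τ : M.Traces) : ℝ≥0∞ :=
  (∑ k, ∫⁻ x in (M.map k).cell, ‖g x‖ₑ ^ 2)
      + (∑ k, ∑ l ∈ Finset.Ioi k, ∫⁻ x in M.face k l,
          ENNReal.ofReal (M.sigma p Cσ k l) * ‖τ k x - τ l x‖ₑ ^ 2 ∂μHE[d - 1])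
      + (∑ k, ∫⁻ x in M.bface k,
          ENNReal.ofReal (M.sigma p Cσ k k) * ‖τ k x‖ₑ ^ 2 ∂μHE[d - 1])

theorem energyNorm_eq (p : ℕ) (Cσ : ℝ) (v : L2 Ω) :
    M.energyNorm p Cσ v = ⨅ (g : L2v Ω) (τ : M.Traces) (_ : M.IsPiecewiseH1 v g τ),
      M.energySq p Cσ g τ ^ (1 / 2 : ℝ) := rfl

theorem energyNorm_le (p : ℕ) (Cσ : ℝ) {v : L2 Ω} {g : L2v Ω} {τ : M.Traces}
    (h : M.IsPiecewiseH1 v g τ) : M.energyNorm p Cσ v ≤ M.energySq p Cσ g τ ^ (1 / 2 : ℝ) :=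
  iInf_le_of_le g (iInf₂_le τ h)

theorem face_subset_left (k l : Fin M.N) : M.face k l ⊆ (M.map k).bdry := fun _ hx => hx.1.1

theorem face_subset_right (k l : Fin M.N) : M.face k l ⊆ (M.map l).bdry := fun _ hx => hx.1.2

theorem bface_subset (k : Fin M.N) : M.bface k ⊆ (M.map k).bdry := inter_subset_left

theorem sqrt_energySq_add_le (p : ℕ) (Cσ : ℝ) (g g' : L2v Ω) (τ τ' : M.Traces) :
    M.energySq p Cσ (g + g') (τ + τ') ^ (1 / 2 : ℝ) ≤
      M.energySq p Cσ g τ ^ (1 / 2 : ℝ) + M.energySq p Cσ g' τ' ^ (1 / 2 : ℝ) := by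
  have hmono : ∀ {s t : Set (E d)} (μ : Measure (E d)), s ⊆ t → μ.restrict s ≤ μ.restrict t :=
    fun μ h => Measure.restrict_mono h le_rfl
  refine sqrt_add_le_of_sqrt_le (sqrt_add_le_of_sqrt_le ?_ ?_) ?_
  · refine sqrt_sum_le_of_sqrt_le _ fun k _ => ?_
    have hle := hmono volume (M.cell_subset k)
    simpa using sqrt_lintegral_add_le (c := 1) ((Lp.aestronglyMeasurable g).mono_measure hle)
      ((Lp.aestronglyMeasurable g').mono_measure hle)
      ((ae_mono hle) (Lp.coeFn_add g g')) (by simp)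
  · refine sqrt_sum_le_of_sqrt_le _ fun k _ => sqrt_sum_le_of_sqrt_le _ fun l _ => ?_
    have hk := hmono μHE[d - 1] (M.face_subset_left k l)
    have hl := hmono μHE[d - 1] (M.face_subset_right k l)
    refine sqrt_lintegral_add_le
      (((Lp.aestronglyMeasurable (τ k)).mono_measure hk).sub
        ((Lp.aestronglyMeasurable (τ l)).mono_measure hl))
      (((Lp.aestronglyMeasurable (τ' k)).mono_measure hk).sub
        ((Lp.aestronglyMeasurable (τ' l)).mono_measure hl)) ?_ (by simp)
    filter_upwards [(ae_mono hk) (Lp.coeFn_add (τ k) (τ' k)),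
      (ae_mono hl) (Lp.coeFn_add (τ l) (τ' l))] with x h1 h2
    simp only [Pi.add_apply] at h1 h2 ⊢
    rw [h1, h2, Pi.sub_apply, Pi.sub_apply]
    ring
  · refine sqrt_sum_le_of_sqrt_le _ fun k _ => ?_
    have hk := hmono μHE[d - 1] (M.bface_subset k)
    exact sqrt_lintegral_add_le ((Lp.aestronglyMeasurable (τ k)).mono_measure hk)
      ((Lp.aestronglyMeasurable (τ' k)).mono_measure hk)
      ((ae_mono hk) (Lp.coeFn_add (τ k) (τ' k))) (by simp)

theorem energySq_smul (p : ℕ) (Cσ : ℝ) (c : ℝ) (g : L2v Ω) (τ : M.Traces) :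
    M.energySq p Cσ (c • g) (c • τ) = ‖c‖ₑ ^ 2 * M.energySq p Cσ g τ := by
  have hmono : ∀ {s t : Set (E d)} (μ : Measure (E d)), s ⊆ t → μ.restrict s ≤ μ.restrict t :=
    fun μ h => Measure.restrict_mono h le_rfl
  have hc : ‖c‖ₑ ^ 2 ≠ ⊤ := by finiteness
  simp only [energySq, mul_add, Finset.mul_sum, ← lintegral_const_mul' _ _ hc]
  congr 1
  · congr 1
    · refine Finset.sum_congr rfl fun k _ => lintegral_congr_ae ?_
      filter_upwards [(ae_mono (hmono volume (M.cell_subset k))) (Lp.coeFn_smul c g)] with x h1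
      rw [h1, Pi.smul_apply, enorm_smul, mul_pow]
    · refine Finset.sum_congr rfl fun k _ => Finset.sum_congr rfl fun l _ => lintegral_congr_ae ?_
      filter_upwards [(ae_mono (hmono μHE[d - 1] (M.face_subset_left k l)))
        (Lp.coeFn_smul c (τ k)), (ae_mono (hmono μHE[d - 1] (M.face_subset_right k l)))
        (Lp.coeFn_smul c (τ l))] with x h1 h2
      rw [Pi.smul_apply, Pi.smul_apply, h1, h2, Pi.smul_apply, Pi.smul_apply, ← smul_sub,
        enorm_smul, mul_pow, mul_left_comm]
  · refine Finset.sum_congr rfl fun k _ => lintegral_congr_ae ?_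
    filter_upwards [(ae_mono (hmono μHE[d - 1] (M.bface_subset k)))
        (Lp.coeFn_smul c (τ k))] with x h1
    rw [Pi.smul_apply, h1, Pi.smul_apply, enorm_smul, mul_pow, mul_left_comm]

theorem tendsto_eLpNorm_add {α X : Type*} [NormedAddCommGroup X] {m : MeasurableSpace α}
    {μ : Measure α} {f g h : α → X} {F G H : ℕ → α → X} (hg : AEStronglyMeasurable g μ)
    (hh : AEStronglyMeasurable h μ) (hG : ∀ n, AEStronglyMeasurable (G n) μ)
    (hH : ∀ n, AEStronglyMeasurable (H n) μ) (hf : ∀ᵐ x ∂μ, f x = g x + h x)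
    (hF : ∀ n x, F n x = G n x + H n x)
    (lG : Tendsto (fun n => eLpNorm (fun x => g x - G n x) 2 μ) atTop (𝓝 0))
    (lH : Tendsto (fun n => eLpNorm (fun x => h x - H n x) 2 μ) atTop (𝓝 0)) :
    Tendsto (fun n => eLpNorm (fun x => f x - F n x) 2 μ) atTop (𝓝 0) := by
  refine tendsto_of_tendsto_of_tendsto_of_le_of_le tendsto_const_nhds
    (by simpa using lG.add lH) (fun _ => zero_le) fun n => ?_
  rw [eLpNorm_congr_ae (g := (fun x => g x - G n x) + fun x => h x - H n x)]
  · exact eLpNorm_add_le (hg.sub (hG n)) (hh.sub (hH n)) one_le_two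
  · filter_upwards [hf] with x hx
    rw [hx, hF, Pi.add_apply]
    abel

variable {M}

theorem IsPiecewiseH1.add {v v' : L2 Ω} {g g' : L2v Ω} {τ τ' : M.Traces}
    (h : M.IsPiecewiseH1 v g τ) (h' : M.IsPiecewiseH1 v' g' τ') :
    M.IsPiecewiseH1 (v + v') (g + g') (τ + τ') := by
  intro k
  obtain ⟨ψ, a1, a2, a3, a4⟩ := h k
  obtain ⟨χ, b1, b2, b3, b4⟩ := h' k
  have hle := Measure.restrict_mono (M.cell_subset k) (le_refl (volume : Measure (E d)))
  refine ⟨fun n x => ψ n x + χ n x, fun n => (a1 n).add (b1 n), ?_, ?_, ?_⟩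
  · exact tendsto_eLpNorm_add ((Lp.aestronglyMeasurable v).mono_measure hle)
      ((Lp.aestronglyMeasurable v').mono_measure hle)
      (fun n => (M.map k).aestronglyMeasurable_push (a1 n))
      (fun n => (M.map k).aestronglyMeasurable_push (b1 n))
      ((ae_mono hle) (Lp.coeFn_add v v')) (fun _ _ => rfl) a2 b2
  · refine tendsto_eLpNorm_add ((Lp.aestronglyMeasurable g).mono_measure hle)
      ((Lp.aestronglyMeasurable g').mono_measure hle)
      (fun n => (M.map k).aestronglyMeasurable_pushGrad (a1 n))
      (fun n => (M.map k).aestronglyMeasurable_pushGrad (b1 n))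
      ((ae_mono hle) (Lp.coeFn_add g g')) (fun n x => ?_) a3 b3
    rw [ElementMap.pushGrad, gradient_add' ((a1 n).differentiable (by simp))
      ((b1 n).differentiable (by simp)), map_add]
    rfl
  · exact tendsto_eLpNorm_add (Lp.aestronglyMeasurable (τ k)) (Lp.aestronglyMeasurable (τ' k))
      (fun n => (M.map k).aestronglyMeasurable_push_bdry (a1 n).continuous _)
      (fun n => (M.map k).aestronglyMeasurable_push_bdry (b1 n).continuous _)
      (Lp.coeFn_add (τ k) (τ' k)) (fun _ _ => rfl) a4 b4

theorem tendsto_eLpNorm_const_smul {α X : Type*} [NormedAddCommGroup X] [NormedSpace ℝ X]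
    {m : MeasurableSpace α}
    {μ : Measure α} {f g : α → X} {F G : ℕ → α → X} (c : ℝ) (hf : ∀ᵐ x ∂μ, f x = c • g x)
    (hF : ∀ n x, F n x = c • G n x)
    (lG : Tendsto (fun n => eLpNorm (fun x => g x - G n x) 2 μ) atTop (𝓝 0)) :
    Tendsto (fun n => eLpNorm (fun x => f x - F n x) 2 μ) atTop (𝓝 0) := by
  have := ENNReal.Tendsto.const_mul (a := ‖c‖ₑ) lG (Or.inr (by simp))
  rw [mul_zero] at this
  refine this.congr fun n => ?_
  rw [← eLpNorm_const_smul]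
  refine eLpNorm_congr_ae ?_
  filter_upwards [hf] with x hx
  rw [hx, hF, Pi.smul_apply, smul_sub]

theorem IsPiecewiseH1.smul (c : ℝ) {v : L2 Ω} {g : L2v Ω} {τ : M.Traces}
    (h : M.IsPiecewiseH1 v g τ) : M.IsPiecewiseH1 (c • v) (c • g) (c • τ) := by
  intro k
  obtain ⟨ψ, a1, a2, a3, a4⟩ := h k
  have hle := Measure.restrict_mono (M.cell_subset k) (le_refl (volume : Measure (E d)))
  refine ⟨fun n x => c * ψ n x, fun n => contDiff_const.mul (a1 n), ?_, ?_, ?_⟩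
  · exact tendsto_eLpNorm_const_smul c ((ae_mono hle) (Lp.coeFn_smul c v)) (fun _ _ => rfl) a2
  · refine tendsto_eLpNorm_const_smul c ((ae_mono hle) (Lp.coeFn_smul c g)) (fun n x => ?_) a3
    rw [ElementMap.pushGrad, gradient_const_mul' ((a1 n).differentiable (by simp)), map_smul]
    rfl
  · exact tendsto_eLpNorm_const_smul c (Lp.coeFn_smul c (τ k)) (fun _ _ => rfl) a4

variable (M)

/-- Admissible pairs of gradient and traces can be added, so the infimum is subadditive; uniqueness
of the pair plays no role. -/
theorem energyNorm_add_le (p : ℕ) (Cσ : ℝ) (v w : L2 Ω) :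
    M.energyNorm p Cσ (v + w) ≤ M.energyNorm p Cσ v + M.energyNorm p Cσ w := by
  rw [M.energyNorm_eq p Cσ v, M.energyNorm_eq p Cσ w]
  simp only [ENNReal.iInf_add, ENNReal.add_iInf]
  refine le_iInf fun g' => le_iInf fun τ' => le_iInf fun h' => le_iInf fun g => le_iInf fun τ =>
    le_iInf fun h => ?_
  exact (M.energyNorm_le p Cσ (h.add h')).trans (M.sqrt_energySq_add_le p Cσ g g' τ τ')

theorem energyNorm_smul_le (p : ℕ) (Cσ : ℝ) {c : ℝ} (hc : c ≠ 0) (v : L2 Ω) :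
    M.energyNorm p Cσ (c • v) ≤ ‖c‖ₑ * M.energyNorm p Cσ v := by
  rw [M.energyNorm_eq p Cσ v]
  simp only [ENNReal.mul_iInf_of_ne (enorm_ne_zero.2 hc) enorm_ne_top]
  -- The factor could be moved inside the infimum because `c ≠ 0`, which also avoids the product `0
  -- * ∞`.
  refine le_iInf fun g => le_iInf fun τ => le_iInf fun h => ?_
  refine (M.energyNorm_le p Cσ (h.smul c)).trans ?_
  rw [energySq_smul, ENNReal.mul_rpow_of_nonneg _ _ (by norm_num), ennreal_sqrt_sq]

end Mesh

/-! ### The energy norm on `H¹₀(Ω)` -/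

theorem ElementMap.exists_eLpNorm_trace_le {n : ℕ} (F : ElementMap (n + 1)) :
    ∃ C : ℝ≥0∞, C ≠ ⊤ ∧ ∀ φ : E (n + 1) → ℝ, ContDiff ℝ ∞ φ →
      eLpNorm φ 2 ((μHE[n] : Measure (E (n + 1))).restrict F.bdry) ≤
        C * (eLpNorm φ 2 (volume.restrict F.cell) +
          eLpNorm (gradient φ) 2 (volume.restrict F.cell)) := by
  obtain ⟨C, hC, h⟩ := F.exists_trace_inequality
  refine ⟨C ^ (1 / 2 : ℝ), by finiteness, fun φ hφ => ?_⟩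
  have := h φ hφ
  simp only [lintegral_enorm_sq] at this
  have h2 : ∀ a b : ℝ≥0∞, a ^ 2 + b ^ 2 ≤ (a + b) ^ 2 := fun a b => by
    rw [add_sq]
    exact add_le_add_left (le_add_right le_rfl) _
  rw [← ennreal_sqrt_sq (eLpNorm φ 2 _), ← ennreal_sqrt_sq (_ + _),
    ← ENNReal.mul_rpow_of_nonneg _ _ (by norm_num)]
  exact ENNReal.rpow_le_rpow (this.trans (mul_le_mul_right (h2 _ _) _)) (by norm_num)

/-- By the trace inequality, convergence of `φ j` and its gradient on the cell makes the
restrictions to the boundary a Cauchy sequence in `L²(∂κ)`. The sequence is global, so neighbouring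
elements can share it. -/
theorem ElementMap.exists_trace_limit {n : ℕ} (F : ElementMap (n + 1)) {v : E (n + 1) → ℝ}
    {G : E (n + 1) → E (n + 1)} (hv : AEStronglyMeasurable v (volume.restrict F.cell))
    (hG : AEStronglyMeasurable G (volume.restrict F.cell)) {φ : ℕ → E (n + 1) → ℝ}
    (h1 : ∀ j, ContDiff ℝ ∞ (φ j)) (h2 : ∀ j, HasCompactSupport (φ j))
    (h3 : Tendsto (fun j => eLpNorm (fun x => v x - φ j x) 2 (volume.restrict F.cell)) atTop (𝓝 0))
    (h4 : Tendsto (fun j => eLpNorm (fun x => G x - gradient (φ j) x) 2 (volume.restrict F.cell))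
      atTop (𝓝 0)) :
    ∃ τ : Lp ℝ 2 ((μHE[n] : Measure (E (n + 1))).restrict F.bdry),
      Tendsto (fun j => eLpNorm (fun x => τ x - φ j x) 2
        ((μHE[n] : Measure (E (n + 1))).restrict F.bdry)) atTop (𝓝 0) := by
  obtain ⟨C, hC, h⟩ := F.exists_eLpNorm_trace_le
  have : IsFiniteMeasure ((μHE[n] : Measure (E (n + 1))).restrict F.bdry) :=
    ⟨by simpa using F.hausdorffMeasure_bdry_lt_top⟩
  set μ := (μHE[n] : Measure (E (n + 1))).restrict F.bdry
  have hm : ∀ j, MemLp (φ j) 2 μ := fun j => memLp_of_hasCompactSupport (h1 j).continuous (h2 j) 2 μ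
  set a : ℕ → ℝ≥0∞ := fun j => C * (eLpNorm (fun x => v x - φ j x) 2 (volume.restrict F.cell) +
    eLpNorm (fun x => G x - gradient (φ j) x) 2 (volume.restrict F.cell)) with ha
  have hlim : Tendsto a atTop (𝓝 0) := by
    have := ENNReal.Tendsto.const_mul (a := C) (h3.add h4) (Or.inr hC)
    simpa using this
  have hdist : ∀ i j, edist ((hm i).toLp (φ i)) ((hm j).toLp (φ j)) ≤ a i + a j := by
    intro i j
    rw [Lp.edist_toLp_toLp]
    refine (h (φ i - φ j) ((h1 i).sub (h1 j))).trans ?_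
    rw [ha, ← mul_add]
    refine mul_le_mul_right ?_ C
    have e1 : eLpNorm (φ i - φ j) 2 (volume.restrict F.cell) ≤
        eLpNorm (fun x => v x - φ i x) 2 (volume.restrict F.cell) +
        eLpNorm (fun x => v x - φ j x) 2 (volume.restrict F.cell) := by
      refine (le_of_eq ?_).trans ((eLpNorm_sub_le (hv.sub (h1 j).continuous.aestronglyMeasurable)
        (hv.sub (h1 i).continuous.aestronglyMeasurable) one_le_two).trans (add_comm _ _).le)
      congr 1
      ext x
      simp
    have e2 : eLpNorm (gradient (φ i - φ j)) 2 (volume.restrict F.cell) ≤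
        eLpNorm (fun x => G x - gradient (φ i) x) 2 (volume.restrict F.cell) +
        eLpNorm (fun x => G x - gradient (φ j) x) 2 (volume.restrict F.cell) := by
      refine (le_of_eq ?_).trans ((eLpNorm_sub_le
        (hG.sub (continuous_gradient (h1 j)).aestronglyMeasurable)
        (hG.sub (continuous_gradient (h1 i)).aestronglyMeasurable) one_le_two).trans
          (add_comm _ _).le)
      congr 1
      funext x
      simp only [gradient, Pi.sub_apply]
      rw [fderiv_sub ((h1 i).differentiable (by simp) x) ((h1 j).differentiable (by simp) x),
        map_sub]
      abel
    refine (add_le_add e1 e2).trans (le_of_eq ?_)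
    ring
  have hcauchy : CauchySeq fun j => (hm j).toLp (φ j) := by
    rw [EMetric.cauchySeq_iff]
    intro ε hε
    obtain ⟨N, hN⟩ := eventually_atTop.1 (hlim.eventually_lt_const (ENNReal.half_pos hε.ne'))
    refine ⟨N, fun i hi j hj => (hdist i j).trans_lt ?_⟩
    rw [← ENNReal.add_halves ε]
    exact ENNReal.add_lt_add (hN i hi) (hN j hj)
  obtain ⟨τ, hτ⟩ := cauchySeq_tendsto_of_complete hcauchy
  refine ⟨τ, (tendsto_iff_edist_tendsto_0.1 hτ).congr fun j => ?_⟩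
  rw [edist_comm, Lp.edist_def]
  refine eLpNorm_congr_ae ?_
  filter_upwards [(hm j).coeFn_toLp] with x hx
  rw [Pi.sub_apply, hx]

theorem lintegral_const_mul_enorm_sq_eq_zero {α : Type*} {m : MeasurableSpace α} {μ : Measure α}
    {f : α → ℝ} {a : ℕ → ℝ≥0∞} (ha : Tendsto a atTop (𝓝 0)) (h : ∀ j, eLpNorm f 2 μ ≤ a j)
    {c : ℝ≥0∞} (hc : c ≠ ⊤) : ∫⁻ x, c * ‖f x‖ₑ ^ 2 ∂μ = 0 := by
  have : eLpNorm f 2 μ = 0 := le_antisymm (ge_of_tendsto' ha h) zero_le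
  rw [lintegral_const_mul' _ _ hc, lintegral_enorm_sq, this]
  simp

/-- Functions in `H¹₀(Ω)` have no jumps. -/
theorem Mesh.energyNorm_le_enorm_grad {n : ℕ} {Ω : Set (E (n + 1))} (hΩ : IsOpen Ω)
    (M : Mesh (n + 1) Ω) (p : ℕ) (Cσ : ℝ) {v : L2 Ω} (hv : v ∈ H10 Ω) :
    M.energyNorm p Cσ v ≤ ‖grad Ω v‖ₑ := by
  obtain ⟨φ, h1, h2, h3, h4, h5⟩ := exists_seq_of_mem_H10Graph (grad_mem hv)
  have hle := fun k => Measure.restrict_mono (M.cell_subset k)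
    (le_refl (volume : Measure (E (n + 1))))
  have h4' : ∀ k, Tendsto (fun j => eLpNorm (fun x => v x - φ j x) 2
      (volume.restrict (M.map k).cell)) atTop (𝓝 0) := fun k =>
    tendsto_of_tendsto_of_tendsto_of_le_of_le tendsto_const_nhds h4 (fun _ => zero_le)
      fun j => eLpNorm_mono_measure _ (hle k)
  have h5' : ∀ k, Tendsto (fun j => eLpNorm (fun x => grad Ω v x - gradient (φ j) x) 2
      (volume.restrict (M.map k).cell)) atTop (𝓝 0) := fun k =>
    tendsto_of_tendsto_of_tendsto_of_le_of_le tendsto_const_nhds h5 (fun _ => zero_le)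
      fun j => eLpNorm_mono_measure _ (hle k)
  choose τ hτ using fun k => (M.map k).exists_trace_limit
    ((Lp.aestronglyMeasurable v).mono_measure (hle k))
    ((Lp.aestronglyMeasurable (grad Ω v)).mono_measure (hle k)) h1 h2 (h4' k) (h5' k)
  have hpw : M.IsPiecewiseH1 v (grad Ω v) τ := by
    intro k
    refine ⟨fun j => φ j ∘ (M.map k).toFun, fun j => (h1 j).comp (M.map k).contDiff, ?_, ?_, ?_⟩
    · refine (h4' k).congr fun j => eLpNorm_congr_ae ?_
      filter_upwards [ae_restrict_mem (M.map k).isOpen_cell.measurableSet] with x hx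
      rw [(M.map k).push_comp ((M.map k).cell_subset_elem hx)]
    · refine (h5' k).congr fun j => eLpNorm_congr_ae ?_
      filter_upwards [ae_restrict_mem (M.map k).isOpen_cell.measurableSet] with x hx
      rw [(M.map k).pushGrad_comp (h1 j) ((M.map k).cell_subset_elem hx)]
    · refine (hτ k).congr fun j => eLpNorm_congr_ae ?_
      filter_upwards [ae_restrict_mem (M.map k).isCompact_bdry.isClosed.measurableSet] with x hx
      rw [(M.map k).push_comp ((M.map k).bdry_subset_elem hx)]
  refine (M.energyNorm_le p Cσ hpw).trans (le_of_eq ?_)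
  -- On a common face both traces are limits of the same `φ j`, so they coincide.
  have hf : ∀ k l, ∫⁻ x in M.face k l,
      ENNReal.ofReal (M.sigma p Cσ k l) * ‖τ k x - τ l x‖ₑ ^ 2 ∂μHE[n + 1 - 1] = 0 := by
    intro k l
    have hk := Measure.restrict_mono (M.face_subset_left k l)
      (le_refl (μHE[n] : Measure (E (n + 1))))
    have hl := Measure.restrict_mono (M.face_subset_right k l)
      (le_refl (μHE[n] : Measure (E (n + 1))))
    refine lintegral_const_mul_enorm_sq_eq_zero (by simpa using (hτ k).add (hτ l)) (fun j => ?_)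
      (by simp)
    have e : (fun x => τ k x - τ l x) = (fun x => τ k x - φ j x) - fun x => τ l x - φ j x := by
      ext x; simp
    rw [e]
    refine (eLpNorm_sub_le (((Lp.aestronglyMeasurable (τ k)).sub
      (h1 j).continuous.aestronglyMeasurable).mono_measure hk)
      (((Lp.aestronglyMeasurable (τ l)).sub
      (h1 j).continuous.aestronglyMeasurable).mono_measure hl) one_le_two).trans ?_
    exact add_le_add (eLpNorm_mono_measure _ hk) (eLpNorm_mono_measure _ hl)
  -- The support of `φ j` lies in the open set `Ω`, which does not meet its frontier; hence the
  -- boundary trace is a limit of zeros.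
  have hb : ∀ k, ∫⁻ x in M.bface k,
      ENNReal.ofReal (M.sigma p Cσ k k) * ‖τ k x‖ₑ ^ 2 ∂μHE[n + 1 - 1] = 0 := by
    intro k
    have hk := Measure.restrict_mono (M.bface_subset k) (le_refl (μHE[n] : Measure (E (n + 1))))
    refine lintegral_const_mul_enorm_sq_eq_zero (hτ k) (fun j => ?_) (by simp)
    refine (le_of_eq (eLpNorm_congr_ae ?_)).trans (eLpNorm_mono_measure _ hk)
    have hmeas : MeasurableSet (M.bface k) :=
      ((M.map k).isCompact_bdry.isClosed.inter isClosed_frontier).measurableSet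
    filter_upwards [ae_restrict_mem hmeas] with x hx
    have : x ∉ tsupport (φ j) := fun hx' =>
      (hΩ.inter_frontier_eq ▸ (⟨h3 j hx', hx.2⟩ : x ∈ Ω ∩ frontier Ω) : x ∈ (∅ : Set _))
    rw [image_eq_zero_of_notMem_tsupport this, sub_zero]
  rw [energySq, Finset.sum_eq_zero fun k _ => Finset.sum_eq_zero fun l _ => hf k l,
    Finset.sum_eq_zero fun k _ => hb k, add_zero, add_zero, ← M.enorm_sq_eq_sum_cell hΩ,
    ennreal_sqrt_sq]

end IPDG

namespace IPDG

/-! ### The finite element space as a finite-dimensional subspace -/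

namespace Mesh

variable {d : ℕ} {Ω : Set (E d)} (M : Mesh d Ω)

/-- The graph of the representation by reference polynomials. -/
noncomputable def repGraph (p : ℕ) :
    Submodule ℝ ((Fin M.N → MvPolynomial.restrictDegree (Fin d) ℝ p) × L2 Ω) where
  carrier := {P | ∀ k, P.2 =ᵐ[volume.restrict (M.map k).cell]
    (M.map k).push (polyFun (P.1 k : MvPolynomial (Fin d) ℝ))}
  add_mem' := by
    intro P Q hP hQ k
    filter_upwards [hP k, hQ k, (ae_mono (Measure.restrict_mono (M.cell_subset k) le_rfl))
      (Lp.coeFn_add P.2 Q.2)] with x h1 h2 h3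
    rw [Prod.snd_add, h3, Pi.add_apply, h1, h2]
    simp [ElementMap.push, polyFun]
  zero_mem' := by
    intro k
    filter_upwards [(ae_mono (Measure.restrict_mono (M.cell_subset k) le_rfl))
      (Lp.coeFn_zero ℝ 2 (volume.restrict Ω))] with x h3
    rw [Prod.snd_zero, h3]
    simp [ElementMap.push, polyFun]
  smul_mem' := by
    intro c P hP k
    filter_upwards [hP k, (ae_mono (Measure.restrict_mono (M.cell_subset k) le_rfl))
      (Lp.coeFn_smul c P.2)] with x h1 h3
    rw [Prod.smul_snd, h3, Pi.smul_apply, h1]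
    simp [ElementMap.push, polyFun]

/-- `S^p` as a subspace of `L²(Ω)`. -/
noncomputable def spSub (p : ℕ) : Submodule ℝ (L2 Ω) := (M.repGraph p).map (LinearMap.snd ℝ _ _)

theorem mem_spSub {p : ℕ} {v : L2 Ω} : v ∈ M.spSub p ↔ v ∈ M.Sp p := by
  constructor
  · rintro ⟨⟨q, v⟩, h, rfl⟩
    exact ⟨fun k => q k, fun k => ⟨(q k).2, h k⟩⟩
  · rintro ⟨q, h⟩
    exact ⟨⟨fun k => ⟨q k, (h k).1⟩, v⟩, fun k => (h k).2, rfl⟩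

/-- The cells exhaust `Ω` up to a null set, so the reference polynomials determine the function. The
graph therefore embeds into a finite-dimensional space of polynomial families, and `S^p` is its
image. -/
theorem finiteDimensional_spSub (hΩ : IsOpen Ω) (p : ℕ) : FiniteDimensional ℝ (M.spSub p) := by
  have hinj : Function.Injective ((LinearMap.fst ℝ
      (Fin M.N → MvPolynomial.restrictDegree (Fin d) ℝ p) (L2 Ω)).comp (M.repGraph p).subtype) := by
    rw [injective_iff_map_eq_zero]
    rintro ⟨⟨q, v⟩, h⟩ (rfl : q = 0)
    have hv : v = 0 := by
      refine Lp.ext ?_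
      have hk : ∀ᵐ x ∂volume, ∀ k, x ∈ (M.map k).cell → v x = 0 := ae_all_iff.2 fun k => by
        filter_upwards [(ae_restrict_iff' (M.map k).isOpen_cell.measurableSet).1 (h k)] with x hx hxk
        rw [hx hxk]
        simp [ElementMap.push, polyFun]
      filter_upwards [ae_restrict_of_ae hk, M.ae_mem_iUnion_cell hΩ,
        Lp.coeFn_zero ℝ 2 (volume.restrict Ω)] with x h1 h2 h3
      obtain ⟨k, hxk⟩ := mem_iUnion.1 h2
      rw [h3, h1 k hxk, Pi.zero_apply]
    subst hv
    rfl
  have : FiniteDimensional ℝ (M.repGraph p) := Module.Finite.of_injective _ hinj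
  exact Module.Finite.map _ _

end Mesh

/-! ### Measurability of extended seminorms along curves in finite-dimensional spaces -/

/-- The set of finiteness `S'` is a subspace of a finite-dimensional space, hence closed. There `N`
is a finite convex function, hence continuous; elsewhere on `S` it is constantly `∞`. Applied to the
energy norm of `U^d`, this avoids proving that the norm is finite on `S^p`. -/
theorem aemeasurable_extendedSeminorm_comp {X : Type*} [NormedAddCommGroup X] [NormedSpace ℝ X]
    (S : Submodule ℝ X) [FiniteDimensional ℝ S] (N : X → ℝ≥0∞) (h0 : N 0 = 0)
    (hadd : ∀ x y, N (x + y) ≤ N x + N y) (hsmul : ∀ c : ℝ, c ≠ 0 → ∀ x, N (c • x) ≤ ‖c‖ₑ * N x)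
    {T : ℝ} {Z : ℝ → X} (hZ : ContinuousOn Z (Icc 0 T)) (hZS : ∀ t ∈ Icc 0 T, Z t ∈ S) :
    AEMeasurable (fun t => N (Z t)) (volume.restrict (Ioc 0 T)) := by
  let S' : Submodule ℝ X :=
    { carrier := {x | x ∈ S ∧ N x ≠ ⊤}
      add_mem' := fun {x y} hx hy => ⟨S.add_mem hx.1 hy.1,
        ((hadd x y).trans_lt (ENNReal.add_lt_top.2 ⟨hx.2.lt_top, hy.2.lt_top⟩)).ne⟩
      zero_mem' := ⟨S.zero_mem, by simp [h0]⟩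
      smul_mem' := fun c x hx => by
        refine ⟨S.smul_mem c hx.1, ?_⟩
        rcases eq_or_ne c 0 with rfl | hc
        · simp [h0]
        · exact ((hsmul c hc x).trans_lt (ENNReal.mul_lt_top enorm_lt_top hx.2.lt_top)).ne }
  have hS' : S' ≤ S := fun x hx => hx.1
  have : FiniteDimensional ℝ S' := Submodule.finiteDimensional_of_le hS'
  have hcont : Continuous fun x : S' => (N x).toReal := by
    have hconv : ConvexOn ℝ univ fun x : S' => (N x).toReal := by
      have hs : ∀ (c : ℝ), 0 ≤ c → ∀ x : S', (N ((c • x : S') : X)).toReal ≤ c * (N x).toReal := by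
        intro c hc x
        rcases eq_or_ne c 0 with rfl | hc0
        · simp [h0]
        · rw [← ENNReal.toReal_ofReal hc, ← ENNReal.toReal_mul, ENNReal.toReal_ofReal hc,
            ← Real.enorm_of_nonneg hc]
          exact ENNReal.toReal_mono (ENNReal.mul_ne_top enorm_ne_top x.2.2) (hsmul c hc0 x)
      refine ⟨convex_univ, fun x _ y _ a b ha hb _ => ?_⟩
      refine le_trans ?_ (add_le_add (hs a ha x) (hs b hb y))
      rw [← ENNReal.toReal_add (a • x).2.2 (b • y).2.2]
      exact ENNReal.toReal_mono (ENNReal.add_ne_top.2 ⟨(a • x).2.2, (b • y).2.2⟩) (hadd _ _)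
    exact continuousOn_univ.1 (hconv.continuousOn isOpen_univ)
  set A : Set ℝ := Icc 0 T ∩ Z ⁻¹' S' with hA
  have hAc : IsClosed A :=
    hZ.preimage_isClosed_of_isClosed isClosed_Icc S'.closed_of_finiteDimensional
  have h1 : ContinuousOn (fun t => N (Z t)) A := by
    rw [continuousOn_iff_continuous_domRestrict]
    have hZA : Continuous fun t : A => (⟨Z t, t.2.2⟩ : S') :=
      ((continuousOn_iff_continuous_domRestrict.1 (hZ.mono inter_subset_left))).subtype_mk _
    refine (ENNReal.continuous_ofReal.comp (hcont.comp hZA)).congr fun t => ?_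
    exact ENNReal.ofReal_toReal t.2.2.2
  have h2 : AEMeasurable (fun t => N (Z t)) (volume.restrict (Icc 0 T)) := by
    rw [← inter_union_sdiff (Icc 0 T) A, aemeasurable_union_iff]
    refine ⟨(h1.mono inter_subset_right).aemeasurable (measurableSet_Icc.inter hAc.measurableSet),
      aemeasurable_const (b := (⊤ : ℝ≥0∞)) |>.congr ?_⟩
    filter_upwards [ae_restrict_mem (measurableSet_Icc.diff hAc.measurableSet)] with t ht
    by_contra h
    exact ht.2 ⟨ht.1, hZS t ht.1, fun h' => h h'.symm⟩
  exact h2.mono_measure (Measure.restrict_mono Ioc_subset_Icc_self le_rfl)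

/-! ### The Nemytskii operator of the flux -/

section Nemytskii

variable {d : ℕ} {Ω : Set (E d)} {T al au : ℝ} {a : ℝ → E d → ℝ → ℝ}

open Classical in
/-- The operator `G ↦ a(t, x, |G|) G` on `L²(Ω)^d`. -/
noncomputable def nemytskii (Ω : Set (E d)) (a : ℝ → E d → ℝ → ℝ) (t : ℝ) (G : L2v Ω) : L2v Ω :=
  if h : MemLp (fun x => flux a t x (G x)) 2 (volume.restrict Ω) then h.toLp _ else 0

theorem aestronglyMeasurable_flux (hΩ : IsOpen Ω)
    (ha : UniformContinuousOn (fun q : ℝ × E d × ℝ => a q.1 q.2.1 q.2.2)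
      (Icc 0 T ×ˢ closure Ω ×ˢ Ici 0)) {t : ℝ} (ht : t ∈ Icc 0 T) (G : L2v Ω) :
    AEStronglyMeasurable (fun x => flux a t x (G x)) (volume.restrict Ω) := by
  have hG : Measurable (G : E d → E d) := (Lp.stronglyMeasurable G).measurable
  have hc : ContinuousOn (fun q : E d × ℝ => a t q.1 q.2) (closure Ω ×ˢ Ici 0) :=
    ha.continuousOn.comp (f := fun q : E d × ℝ => (t, q.1, q.2)) (by fun_prop)
      fun q hq => ⟨ht, hq.1, hq.2⟩
  have hK : MeasurableSet (closure Ω ×ˢ Ici (0 : ℝ)) :=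
    isClosed_closure.measurableSet.prod measurableSet_Ici
  -- The coefficient is controlled only for `x` in the closure of `Ω` and nonnegative third
  -- argument, so it is cut off outside that set before composing with `x ↦ (x, ‖G x‖)`.
  have hm : Measurable ((closure Ω ×ˢ Ici (0 : ℝ)).indicator fun q : E d × ℝ => a t q.1 q.2) := by
    classical
    rw [← piecewise_eq_indicator]
    exact hc.measurable_piecewise continuousOn_const hK
  refine ((hm.comp (measurable_id.prodMk hG.norm)).smul hG).aestronglyMeasurable.congr ?_
  filter_upwards [ae_restrict_mem hΩ.measurableSet] with x hx
  have : ((x, ‖G x‖) : E d × ℝ) ∈ closure Ω ×ˢ Ici (0 : ℝ) := ⟨subset_closure hx, norm_nonneg _⟩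
  simp [flux, indicator_of_mem this]

variable (hΩ : IsOpen Ω)
  (ha : UniformContinuousOn (fun q : ℝ × E d × ℝ => a q.1 q.2.1 q.2.2)
    (Icc 0 T ×ˢ closure Ω ×ˢ Ici 0))
  (ha_lip : ∀ t ∈ Icc 0 T, ∀ x ∈ closure Ω, ∀ y z : E d,
    ‖a t x ‖y‖ • y - a t x ‖z‖ • z‖ ≤ au * ‖y - z‖)

include hΩ ha ha_lip

theorem coeFn_nemytskii {t : ℝ} (ht : t ∈ Icc 0 T) (G : L2v Ω) :
    nemytskii Ω a t G =ᵐ[volume.restrict Ω] fun x => flux a t x (G x) := by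
  have h : MemLp (fun x => flux a t x (G x)) 2 (volume.restrict Ω) := by
    refine (Lp.memLp G).of_le_mul (c := au) (aestronglyMeasurable_flux hΩ ha ht G) ?_
    filter_upwards [ae_restrict_mem hΩ.measurableSet] with x hx
    simpa [flux] using ha_lip t ht x (subset_closure hx) (G x) 0
  rw [nemytskii, dif_pos h]
  exact h.coeFn_toLp

theorem norm_nemytskii_sub_le {t : ℝ} (ht : t ∈ Icc 0 T) (G G' : L2v Ω) :
    ‖nemytskii Ω a t G - nemytskii Ω a t G'‖ ≤ au * ‖G - G'‖ := by
  refine Lp.norm_le_mul_norm_of_ae_le_mul ?_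
  filter_upwards [coeFn_nemytskii hΩ ha ha_lip ht G, coeFn_nemytskii hΩ ha ha_lip ht G',
    Lp.coeFn_sub (nemytskii Ω a t G) (nemytskii Ω a t G'), Lp.coeFn_sub G G',
    ae_restrict_mem hΩ.measurableSet] with x h1 h2 h3 h4 hx
  rw [h3, h4, Pi.sub_apply, Pi.sub_apply, h1, h2]
  exact ha_lip t ht x (subset_closure hx) _ _

theorem norm_nemytskii_le {t : ℝ} (ht : t ∈ Icc 0 T) (G : L2v Ω) :
    ‖nemytskii Ω a t G‖ ≤ au * ‖G‖ := by
  refine Lp.norm_le_mul_norm_of_ae_le_mul ?_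
  filter_upwards [coeFn_nemytskii hΩ ha ha_lip ht G, ae_restrict_mem hΩ.measurableSet]
    with x h1 hx
  rw [h1]
  simpa [flux] using ha_lip t ht x (subset_closure hx) (G x) 0

/-- Uniform continuity of `a` bounds the change in time by a small multiple of `‖G‖`, and the map is
Lipschitz in `G` uniformly in time; together these give joint continuity. Clamping time to `[0, T]`
defines the map on the whole line, as needed for composition with measurable curves. -/
theorem continuous_nemytskii (hT : 0 ≤ T) (hau : 0 ≤ au) :
    Continuous fun q : ℝ × L2v Ω => nemytskii Ω a (projIcc 0 T hT q.1) q.2 := by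
  have hmem : ∀ t : ℝ, (projIcc 0 T hT t : ℝ) ∈ Icc 0 T := fun t => (projIcc 0 T hT t).2
  suffices h : Continuous fun q : L2v Ω × ℝ => nemytskii Ω a (projIcc 0 T hT q.2) q.1 from
    h.comp continuous_swap
  refine continuous_prod_of_continuous_lipschitzWith _ au.toNNReal (fun G => ?_) fun t => ?_
  · refine Metric.continuous_iff.2 fun t₀ ε hε => ?_
    have hG : 0 < ‖G‖ + 1 := by positivity
    obtain ⟨δ, hδ, h⟩ := Metric.uniformContinuousOn_iff.1 ha (ε / (‖G‖ + 1)) (by positivity)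
    refine ⟨δ, hδ, fun t ht => ?_⟩
    rw [dist_eq_norm]
    have hle : ‖nemytskii Ω a (projIcc 0 T hT t) G - nemytskii Ω a (projIcc 0 T hT t₀) G‖ ≤
        ε / (‖G‖ + 1) * ‖G‖ := by
      refine Lp.norm_le_mul_norm_of_ae_le_mul ?_
      filter_upwards [coeFn_nemytskii hΩ ha ha_lip (hmem t) G,
        coeFn_nemytskii hΩ ha ha_lip (hmem t₀) G,
        Lp.coeFn_sub (nemytskii Ω a (projIcc 0 T hT t) G) (nemytskii Ω a (projIcc 0 T hT t₀) G),
        ae_restrict_mem hΩ.measurableSet] with x h1 h2 h3 hx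
      rw [h3, Pi.sub_apply, h1, h2, flux, flux, ← sub_smul, norm_smul]
      refine mul_le_mul_of_nonneg_right ?_ (norm_nonneg _)
      refine (h (projIcc 0 T hT t, x, ‖G x‖) ⟨hmem t, subset_closure hx, norm_nonneg (G x)⟩
        (projIcc 0 T hT t₀, x, ‖G x‖) ⟨hmem t₀, subset_closure hx, norm_nonneg (G x)⟩ ?_).le
      rw [Prod.dist_eq, dist_self]
      refine max_lt (lt_of_le_of_lt ?_ ht) hδ
      exact abs_projIcc_sub_projIcc hT
    refine hle.trans_lt ?_
    rw [div_mul_eq_mul_div, div_lt_iff₀ hG]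
    nlinarith
  · refine LipschitzWith.of_dist_le_mul fun G G' => ?_
    rw [dist_eq_norm, dist_eq_norm, Real.coe_toNNReal au hau]
    exact norm_nemytskii_sub_le hΩ ha ha_lip (hmem t) G G'

theorem memLp_nemytskii (hT : 0 ≤ T) (hau : 0 ≤ au) {μ : Measure ℝ} {G : ℝ → L2v Ω}
    (hG : MemLp G 2 μ) : MemLp (fun t => nemytskii Ω a (projIcc 0 T hT t) (G t)) 2 μ := by
  have hm : AEStronglyMeasurable (fun t => (t, G t)) μ :=
    measurable_id.aestronglyMeasurable.prodMk hG.1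
  have h := (continuous_nemytskii hΩ ha ha_lip hT hau).comp_aestronglyMeasurable hm
  exact hG.of_le_mul (c := au) h (Eventually.of_forall fun t =>
    norm_nemytskii_le hΩ ha ha_lip (projIcc 0 T hT t).2 (G t))

theorem le_inner_nemytskii_sub
    (ha_mono : ∀ t ∈ Icc 0 T, ∀ x ∈ closure Ω, ∀ y z : E d,
      al * ‖y - z‖ ^ 2 ≤ inner ℝ (a t x ‖y‖ • y - a t x ‖z‖ • z) (y - z))
    {t : ℝ} (ht : t ∈ Icc 0 T) (G G' : L2v Ω) :
    al * ‖G - G'‖ ^ 2 ≤ inner ℝ (nemytskii Ω a t G - nemytskii Ω a t G') (G - G') := by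
  rw [← real_inner_self_eq_norm_sq, L2.inner_def, L2.inner_def, ← integral_const_mul]
  refine integral_mono_ae ((L2.integrable_inner (𝕜 := ℝ) _ _).const_mul _)
    (L2.integrable_inner (𝕜 := ℝ) _ _) ?_
  filter_upwards [coeFn_nemytskii hΩ ha ha_lip ht G, coeFn_nemytskii hΩ ha ha_lip ht G',
    Lp.coeFn_sub (nemytskii Ω a t G) (nemytskii Ω a t G'), Lp.coeFn_sub G G',
    ae_restrict_mem hΩ.measurableSet] with x h1 h2 h3 h4 hx
  simp only [h3, h4, Pi.sub_apply, h1, h2]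
  rw [real_inner_self_eq_norm_sq]
  exact ha_mono t ht x (subset_closure hx) _ _

theorem quasiForm_eq_inner {t : ℝ} (ht : t ∈ Icc 0 T) (w v : L2 Ω) :
    quasiForm Ω a t w v = inner ℝ (nemytskii Ω a t (grad Ω w)) (grad Ω v) := by
  rw [quasiForm, L2.inner_def]
  refine integral_congr_ae ?_
  filter_upwards [coeFn_nemytskii hΩ ha ha_lip ht (grad Ω w)] with x hx
  rw [hx]

end Nemytskii

end IPDG

namespace IPDG

open scoped NNReal

variable {d : ℕ} {Ω : Set (E d)}

/-! ### Time derivatives -/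

theorem HasTimeDeriv.inner_eq {X : Type*} [NormedAddCommGroup X] [InnerProductSpace ℝ X]
    [CompleteSpace X] {T : ℝ} {v v' : ℝ → X} (h : HasTimeDeriv T v v') {t : ℝ} (ht : t ∈ Icc 0 T)
    (x : X) : inner ℝ (v t) x = inner ℝ (v 0) x + ∫ s in 0..t, inner ℝ (v' s) x := by
  have hi : IntervalIntegrable v' volume 0 t := h.1.mono_set (by
    rw [uIcc_of_le ht.1, uIcc_of_le (ht.1.trans ht.2)]
    exact Icc_subset_Icc le_rfl ht.2)
  have := (innerSL ℝ x).intervalIntegral_comp_comm hi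
  simp only [innerSL_apply_apply] at this
  rw [h.2 t ht, inner_add_left, real_inner_comm _ (∫ s in 0..t, v' s), ← this]
  simp only [real_inner_comm x]

theorem HasTimeDeriv.integrableOn {X : Type*} [NormedAddCommGroup X] [NormedSpace ℝ X]
    {T : ℝ} (hT : 0 ≤ T) {v v' : ℝ → X} (h : HasTimeDeriv T v v') : IntegrableOn v' (Ioc 0 T) :=
  (intervalIntegrable_iff_integrableOn_Ioc_of_le hT).1 h.1

/-- The time derivative of a curve in a closed subspace can be taken in this subspace. -/
theorem HasTimeDeriv.starProjection {X : Type*} [NormedAddCommGroup X] [InnerProductSpace ℝ X]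
    [CompleteSpace X] {T : ℝ} {v v' : ℝ → X} (h : HasTimeDeriv T v v') (S : Submodule ℝ X)
    [S.HasOrthogonalProjection] (hv : ∀ t ∈ Icc 0 T, v t ∈ S) :
    HasTimeDeriv T v fun t => S.starProjection (v' t) := by
  refine ⟨⟨S.starProjection.integrable_comp h.1.1, S.starProjection.integrable_comp h.1.2⟩,
    fun t ht => ?_⟩
  have h0 : (0 : ℝ) ∈ Icc 0 T := ⟨le_rfl, ht.1.trans ht.2⟩
  have hi : IntervalIntegrable v' volume 0 t := h.1.mono_set (by
    rw [uIcc_of_le ht.1, uIcc_of_le (ht.1.trans ht.2)]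
    exact Icc_subset_Icc le_rfl ht.2)
  rw [S.starProjection.intervalIntegral_comp_comm hi]
  have := congrArg S.starProjection (h.2 t ht)
  rwa [map_add, Submodule.starProjection_eq_self_iff.2 (hv t ht),
    Submodule.starProjection_eq_self_iff.2 (hv 0 h0)] at this

theorem aemeasurable_negNorm {T : ℝ} {v : ℝ → L2 Ω}
    (hv : AEStronglyMeasurable v (volume.restrict (Ioc 0 T))) :
    AEMeasurable (fun t => negNorm Ω (v t)) (volume.restrict (Ioc 0 T)) := by
  borelize (L2 Ω)
  exact lowerSemicontinuous_negNorm.measurable.comp_aemeasurable hv.aemeasurable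

theorem ofReal_integral_le_lintegral_ofReal {α : Type*} {m : MeasurableSpace α} {μ : Measure α}
    {F : α → ℝ} (hF : Integrable F μ) :
    ENNReal.ofReal (∫ x, F x ∂μ) ≤ ∫⁻ x, ENNReal.ofReal (F x) ∂μ := by
  rw [integral_eq_lintegral_pos_part_sub_lintegral_neg_part hF]
  exact (ENNReal.ofReal_le_ofReal (sub_le_self _ ENNReal.toReal_nonneg)).trans
    ENNReal.ofReal_toReal_le

/-- Dividing by `al`, the right side is `(al⁻¹ y)² + ((√al)⁻¹ z)²`, at most the square of the sum.
The extended values are settled first. -/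
theorem le_of_mul_sq_le {al : ℝ} (hal : 0 < al) {x y : ℝ≥0∞} {z : ℝ} (hz : 0 ≤ z)
    (h : ENNReal.ofReal al * x ^ 2 ≤ ENNReal.ofReal al⁻¹ * y ^ 2 + ENNReal.ofReal (z ^ 2)) :
    x ≤ ENNReal.ofReal al⁻¹ * y + ENNReal.ofReal ((√al)⁻¹ * z) := by
  rcases eq_or_ne y ⊤ with rfl | hy
  · rw [ENNReal.mul_top (by simpa using hal)]
    simp
  have hx : x ≠ ⊤ := by
    rintro rfl
    have : ENNReal.ofReal al⁻¹ * y ^ 2 + ENNReal.ofReal (z ^ 2) ≠ ⊤ := by finiteness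
    refine this (top_le_iff.1 (le_trans (le_of_eq ?_) h))
    rw [ENNReal.top_pow two_ne_zero, ENNReal.mul_top (by simpa using hal)]
  obtain ⟨x, rfl⟩ : ∃ r : ℝ≥0, x = r := ⟨x.toNNReal, (ENNReal.coe_toNNReal hx).symm⟩
  obtain ⟨y, rfl⟩ : ∃ r : ℝ≥0, y = r := ⟨y.toNNReal, (ENNReal.coe_toNNReal hy).symm⟩
  have hx0 : (0 : ℝ) ≤ x := x.2
  have hy0 : (0 : ℝ) ≤ y := y.2
  have hi : 0 < al⁻¹ := inv_pos.2 hal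
  rw [← ENNReal.ofReal_coe_nnreal (p := x), ← ENNReal.ofReal_coe_nnreal (p := y)] at *
  rw [← ENNReal.ofReal_pow hx0, ← ENNReal.ofReal_pow hy0, ← ENNReal.ofReal_mul hal.le,
    ← ENNReal.ofReal_mul hi.le, ← ENNReal.ofReal_add (by positivity) (by positivity),
    ENNReal.ofReal_le_ofReal_iff (by positivity)] at h
  rw [← ENNReal.ofReal_mul hi.le, ← ENNReal.ofReal_add (by positivity) (by positivity)]
  refine ENNReal.ofReal_le_ofReal ?_
  refine (sq_le_sq₀ hx0 (by positivity)).1 ?_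
  have hs : (√al)⁻¹ ^ 2 = al⁻¹ := by rw [inv_pow, Real.sq_sqrt hal.le]
  have h1 : (x : ℝ) ^ 2 = al⁻¹ * (al * (x : ℝ) ^ 2) := by field_simp
  calc (x : ℝ) ^ 2 = al⁻¹ * (al * (x : ℝ) ^ 2) := h1
    _ ≤ al⁻¹ * (al⁻¹ * (y : ℝ) ^ 2 + z ^ 2) := mul_le_mul_of_nonneg_left h hi.le
    _ ≤ (al⁻¹ * y + (√al)⁻¹ * z) ^ 2 := by
        have : 0 ≤ al⁻¹ * y * ((√al)⁻¹ * z) := by positivity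
        rw [add_sq, mul_pow (√al)⁻¹, hs]
        nlinarith

/-- The algebra behind the energy estimate: monotonicity, the Lipschitz bound and Young's
inequality. -/
theorem mul_norm_sq_sub_le_of_monotone {K : Type*} [NormedAddCommGroup K] [InnerProductSpace ℝ K]
    {al au n I r : ℝ} (hal : 0 < al) {gw gc gu Aw Ac Au : K}
    (hlip : ‖Aw - Ac‖ ≤ au * ‖gw - gc‖)
    (hmono : al * ‖gc - gu‖ ^ 2 ≤ inner ℝ (Ac - Au) (gc - gu))
    (hr : |r| ≤ n * ‖gc - gu‖) (hI : I = inner ℝ (Aw - Au) (gc - gu) + r) :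
    al * ‖gc - gu‖ ^ 2 - 2 * I ≤ al⁻¹ * (au * ‖gw - gc‖ + n) ^ 2 := by
  have h1 : inner ℝ (Aw - Au) (gc - gu) =
      inner ℝ (Aw - Ac) (gc - gu) + inner ℝ (Ac - Au) (gc - gu) := by
    rw [← inner_add_left, sub_add_sub_cancel]
  have h2 := (abs_real_inner_le_norm (Aw - Ac) (gc - gu)).trans
    (mul_le_mul_of_nonneg_right hlip (norm_nonneg _))
  have h3 := (abs_le.1 h2).1
  have h4 := (abs_le.1 hr).1
  set x := ‖gc - gu‖
  set G := au * ‖gw - gc‖ + n with hG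
  -- Young's inequality with weight `al`; the doubled `I` in the conclusion leaves exactly one `al *
  -- x ^ 2` to absorb.
  have h5 : 2 * (G * x) ≤ al * x ^ 2 + al⁻¹ * G ^ 2 := by
    have : 0 ≤ al⁻¹ * (al * x - G) ^ 2 := mul_nonneg (inv_pos.2 hal).le (sq_nonneg _)
    have e : al⁻¹ * (al * x - G) ^ 2 = al * x ^ 2 + al⁻¹ * G ^ 2 - 2 * (G * x) := by
      field_simp
      ring
    linarith
  have h6 : G * x = au * ‖gw - gc‖ * x + n * x := by rw [hG]; ring
  rw [hI, h1]
  linarith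

end IPDG

/-! ### Error equation and energy estimate for the conforming part. -/

namespace IPDG

variable {d : ℕ} {Ω : Set (E d)}

/-- The semidiscrete equation in terms of the discrete operator: the elliptic reconstruction
satisfies `⟨α(w), ∇v⟩ = ⟨f - U_t, v⟩`. -/
theorem Mesh.IsEllipticReconstruction.quasiForm_eq {M : Mesh d Ω} {p : ℕ} {Cσ θ t : ℝ}
    {a : ℝ → E d → ℝ → ℝ} {φ Z w Z' : L2 Ω} (h : M.IsEllipticReconstruction p Cσ θ a t φ Z w)
    (hZ' : Z' ∈ M.spSub p)
    (hZ : ∀ V ∈ M.Sp p, inner ℝ Z' V + M.ipForm p Cσ θ a t Z V = inner ℝ φ V) :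
    ∀ v ∈ H10 Ω, quasiForm Ω a t w v = inner ℝ (φ - Z') v := by
  obtain ⟨-, AZ, P, ⟨hAZ, hAZ'⟩, ⟨hP, hP'⟩, hw⟩ := h
  have hmem : Z' - AZ - P ∈ M.spSub p :=
    sub_mem (sub_mem hZ' (M.mem_spSub.2 hAZ)) (M.mem_spSub.2 hP)
  -- The scheme reads `⟨Z', V⟩ = ⟨φ, V⟩ - B(Z, V) = ⟨P + AZ, V⟩`.
  have horth : ∀ V ∈ M.Sp p, inner ℝ (Z' - AZ - P) V = 0 := fun V hV => by
    have h1 := hZ V hV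
    have h2 := hAZ' V hV
    have h3 := hP' V hV
    rw [inner_neg_left] at h2
    rw [inner_sub_left] at h3
    rw [inner_sub_left, inner_sub_left]
    linarith
  have h0 : Z' - AZ - P = 0 := inner_self_eq_zero.1 (horth _ (M.mem_spSub.1 hmem))
  intro v hv
  have e : Z' = AZ + P := by rw [← sub_eq_zero, ← h0]; abel
  rw [hw v hv, e]
  congr 1
  abel

/-- A time derivative is determined only a.e.; projecting it onto `S^p` puts it there at every time
and leaves the tested equation unchanged. -/
theorem Mesh.IsSemidiscreteSolution.exists_timeDeriv {M : Mesh d Ω} (hΩ : IsOpen Ω) {p : ℕ}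
    {Cσ θ T : ℝ} {a : ℝ → E d → ℝ → ℝ} {f U : ℝ → L2 Ω}
    (h : M.IsSemidiscreteSolution p Cσ θ T a f U) :
    ∃ Ut : ℝ → L2 Ω, HasTimeDeriv T U Ut ∧ (∀ t, Ut t ∈ M.spSub p) ∧
      ∀ᵐ t ∂volume.restrict (Ioc 0 T), ∀ V ∈ M.Sp p,
        inner ℝ (Ut t) V + M.ipForm p Cσ θ a t (U t) V = inner ℝ (f t) V := by
  have := M.finiteDimensional_spSub hΩ p
  obtain ⟨Ut, hUt, heq⟩ := h.equation
  refine ⟨fun t => (M.spSub p).starProjection (Ut t),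
    hUt.starProjection _ fun t ht => M.mem_spSub.2 (h.mem_Sp t ht),
    fun t => Submodule.starProjection_apply_mem _ _, ?_⟩
  filter_upwards [heq] with t ht V hV
  rw [Submodule.inner_starProjection_left_eq_right,
    Submodule.starProjection_eq_self_iff.2 (M.mem_spSub.2 hV)]
  exact ht V hV

/-- The energy estimate for the conforming part of the error. -/
theorem energy_estimate (hΩ : IsOpen Ω) (M : Mesh d Ω)
    {p : ℕ} {Cσ θ T al au : ℝ} (hT : 0 < T) (hal : 0 < al) (hau : 0 < au)
    {a : ℝ → E d → ℝ → ℝ}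
    (ha : UniformContinuousOn (fun q : ℝ × E d × ℝ => a q.1 q.2.1 q.2.2)
      (Icc 0 T ×ˢ closure Ω ×ˢ Ici 0))
    (ha_lip : ∀ t ∈ Icc 0 T, ∀ x ∈ closure Ω, ∀ y z : E d,
      ‖a t x ‖y‖ • y - a t x ‖z‖ • z‖ ≤ au * ‖y - z‖)
    (ha_mono : ∀ t ∈ Icc 0 T, ∀ x ∈ closure Ω, ∀ y z : E d,
      al * ‖y - z‖ ^ 2 ≤ inner ℝ (a t x ‖y‖ • y - a t x ‖z‖ • z) (y - z))
    {f : ℝ → L2 Ω} (hf : MemLp f ⊤ (volume.restrict (Ioc 0 T)))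
    {u₀ : L2 Ω} {u U w : ℝ → L2 Ω}
    (hu : IsWeakSolution Ω T a f u₀ u)
    (hU : M.IsSemidiscreteSolution p Cσ θ T a f U)
    (hw : ∀ᵐ t ∂volume.restrict (Ioc 0 T),
      M.IsEllipticReconstruction p Cσ θ a t (f t) (U t) (w t))
    {Uc Ud Udt : ℝ → L2 Ω}
    (hUc : ∀ t ∈ Icc 0 T, Uc t ∈ M.Sp p ∧ Uc t ∈ H10 Ω)
    (hUd : ∀ t ∈ Icc 0 T, Ud t = U t - Uc t)
    (hUdt : HasTimeDeriv T Ud Udt) (hN : timeL2 T (fun t => negNorm Ω (Udt t)) ≠ ⊤) :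
    AEStronglyMeasurable (fun t => grad Ω (Uc t) - grad Ω (u t)) (volume.restrict (Ioc 0 T)) ∧
    timeL2 T (fun t => ‖grad Ω (Uc t) - grad Ω (u t)‖ₑ) ≤
      ENNReal.ofReal al⁻¹ * timeL2 T (fun t =>
        ENNReal.ofReal au * ‖grad Ω (w t) - grad Ω (Uc t)‖ₑ + negNorm Ω (Udt t)) +
      ENNReal.ofReal ((√al)⁻¹ * ‖Uc 0 - u₀‖) := by
  have := M.finiteDimensional_spSub hΩ p
  obtain ⟨Ut, hUt, hUtS, heq⟩ := hU.exists_timeDeriv hΩ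
  set μ := volume.restrict (Ioc 0 T) with hμ
  have hIoc : ∀ᵐ t ∂μ, t ∈ Icc 0 T := by
    filter_upwards [ae_restrict_mem measurableSet_Ioc] with t ht using Ioc_subset_Icc_self ht
  have m0 : (0 : ℝ) ∈ Icc 0 T := ⟨le_rfl, hT.le⟩
  have hUcU : ∀ t ∈ Icc 0 T, Uc t = U t - Ud t := fun t ht => by rw [hUd t ht]; abel
  have cUc : ContinuousOn Uc (Icc 0 T) :=
    ((hUt.continuousOn hT.le).sub (hUdt.continuousOn hT.le)).congr hUcU
  -- The gradient is linear on the finite-dimensional space `S^p ∩ H¹₀(Ω)`, hence continuous for the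
  -- `L²` norm.
  have cgUc : ContinuousOn (fun t => grad Ω (Uc t)) (Icc 0 T) := by
    let S : Submodule ℝ (L2 Ω) := M.spSub p ⊓ H10Sub Ω
    have : FiniteDimensional ℝ S := Submodule.finiteDimensional_of_le inf_le_left
    let ℓ : S →ₗ[ℝ] L2v Ω := (gradLM hΩ).comp (Submodule.inclusion inf_le_right)
    have hℓ : Continuous ℓ := ℓ.continuous_of_finiteDimensional
    rw [continuousOn_iff_continuous_domRestrict] at cUc ⊢
    exact hℓ.comp (cUc.subtype_mk fun t => ⟨M.mem_spSub.2 (hUc t t.2).1, (hUc t t.2).2⟩)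
  have mgUc : MemLp (fun t => grad Ω (Uc t)) 2 μ := by
    obtain ⟨C, hC⟩ := isCompact_Icc.exists_bound_of_continuousOn cgUc
    refine MemLp.of_bound ((cgUc.mono Ioc_subset_Icc_self).aestronglyMeasurable measurableSet_Ioc)
      C ?_
    filter_upwards [hIoc] with t ht using hC t ht
  set g : ℝ → L2v Ω := fun t => grad Ω (Uc t) - grad Ω (u t) with hg
  have mg : MemLp g 2 μ := mgUc.sub hu.memLp_grad
  set z : ℝ → L2 Ω := fun t => Uc t - u t with hz
  have cz : ContinuousOn z (Icc 0 T) := cUc.sub hu.continuousOn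
  -- Data of the weak equation `⟨z', v⟩ = ⟨b, v⟩ - ⟨q, ∇v⟩`: since `z' = U_t - U^d_t - u_t`, the
  -- source is `b = U_t - U^d_t - f` and the flux is `q = -α(u)`.
  set b : ℝ → L2 Ω := fun t => Ut t - Udt t - f t with hb
  have if' : IntegrableOn f (Ioc 0 T) := hf.integrable le_top
  have ib : IntegrableOn b (Ioc 0 T) :=
    ((hUt.integrableOn hT.le).sub (hUdt.integrableOn hT.le)).sub if'
  set q : ℝ → L2v Ω := fun t => -nemytskii Ω a (projIcc 0 T hT.le t) (grad Ω (u t)) with hq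
  have hproj : ∀ t ∈ Icc 0 T, (projIcc 0 T hT.le t : ℝ) = t := fun t ht => by
    rw [projIcc_of_mem hT.le ht]
  have mq : MemLp q 2 μ :=
    (memLp_nemytskii hΩ ha ha_lip hT.le hau.le hu.memLp_grad).neg
  have hweak : ∀ v ∈ H10 Ω, ∀ τ ∈ Icc 0 T, inner ℝ (z τ) v = inner ℝ (z 0) v +
      ∫ s in 0..τ, (inner ℝ (b s) v - inner ℝ (q s) (grad Ω v)) := by
    intro v hv τ hτ
    have hsub : Ioc 0 τ ⊆ Ioc 0 T := Ioc_subset_Ioc_right hτ.2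
    have ii : ∀ {F : ℝ → ℝ}, IntegrableOn F (Ioc 0 T) → IntervalIntegrable F volume 0 τ :=
      fun hF => (intervalIntegrable_iff_integrableOn_Ioc_of_le hτ.1).2 (hF.mono_set hsub)
    have i1 := ii ((hUt.integrableOn hT.le).inner_const v)
    have i2 := ii ((hUdt.integrableOn hT.le).inner_const v)
    have i3 := ii (if'.inner_const (𝕜 := ℝ) v)
    have i4 := ii ((mq.integrable one_le_two).inner_const (𝕜 := ℝ) (grad Ω v))
    have hflux : ∀ s ∈ uIcc 0 τ, inner ℝ (f s) v - quasiForm Ω a s (u s) v =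
        inner ℝ (f s) v + inner ℝ (q s) (grad Ω v) := fun s hs => by
      rw [uIcc_of_le hτ.1] at hs
      have hs' : s ∈ Icc 0 T := ⟨hs.1, hs.2.trans hτ.2⟩
      simp only [hq]
      rw [quasiForm_eq_inner hΩ ha ha_lip hs', hproj s hs', inner_neg_left, sub_eq_add_neg]
    have e1 := hUt.inner_eq hτ v
    have e2 := hUdt.inner_eq hτ v
    have e3 := hu.equation v hv τ hτ
    rw [intervalIntegral.integral_congr hflux, intervalIntegral.integral_add i3 i4] at e3
    have e4 : ∫ s in 0..τ, (inner ℝ (b s) v - inner ℝ (q s) (grad Ω v)) =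
        (∫ s in 0..τ, inner ℝ (Ut s) v) - (∫ s in 0..τ, inner ℝ (Udt s) v) -
          (∫ s in 0..τ, inner ℝ (f s) v) - ∫ s in 0..τ, inner ℝ (q s) (grad Ω v) := by
      rw [← intervalIntegral.integral_sub i1 i2, ← intervalIntegral.integral_sub (i1.sub i2) i3,
        ← intervalIntegral.integral_sub ((i1.sub i2).sub i3) i4]
      simp only [hb, inner_sub_left]
    rw [e4]
    simp only [hz, inner_sub_left]
    rw [hUcU τ hτ, hUcU 0 m0, inner_sub_left, inner_sub_left, hu.initial]
    linarith
  have hae : ∀ᵐ t ∂μ, z t ∈ H10 Ω ∧ grad Ω (z t) = g t := by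
    filter_upwards [hIoc, hu.mem_H10] with t ht hut
    exact ⟨(H10Sub Ω).sub_mem (hUc t ht).2 hut, grad_sub hΩ (hUc t ht).2 hut⟩
  have henergy := integral_inner_sub_inner_le_half_norm_sq hT cz ib mq mg (by
    filter_upwards [hae] with t ht τ hτ
    rw [← ht.2]
    exact hweak _ ht.1 τ hτ)
  set I : ℝ → ℝ := fun s => inner ℝ (q s) (g s) - inner ℝ (b s) (z s) with hI
  have iz : Integrable (fun s => (inner ℝ (b s) (z s) : ℝ)) μ := by
    obtain ⟨C, hC⟩ := isCompact_Icc.exists_bound_of_continuousOn cz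
    refine (ib.norm.mul_const C).mono' (ib.1.inner
      ((cz.mono Ioc_subset_Icc_self).aestronglyMeasurable measurableSet_Ioc)) ?_
    filter_upwards [hIoc] with t ht
    exact (norm_inner_le_norm _ _).trans (mul_le_mul_of_nonneg_left (hC t ht) (norm_nonneg _))
  have iI : Integrable I μ := (integrable_inner_of_memLp_two mq mg).sub iz
  have ig : Integrable (fun t => ‖g t‖ ^ 2) μ := mg.integrable_norm_pow two_ne_zero
  have iF : Integrable (fun t => al * ‖g t‖ ^ 2 - 2 * I t) μ :=
    (ig.const_mul al).sub (iI.const_mul 2)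
  set N : ℝ → ℝ≥0∞ := fun t =>
    ENNReal.ofReal au * ‖grad Ω (w t) - grad Ω (Uc t)‖ₑ + negNorm Ω (Udt t) with hNdef
  have hpt : ∀ᵐ t ∂μ, ENNReal.ofReal (al * ‖g t‖ ^ 2 - 2 * I t) ≤
      ENNReal.ofReal al⁻¹ * N t ^ 2 := by
    filter_upwards [hIoc, hae, heq, hw,
      ae_ne_top_of_timeL2_ne_top (aemeasurable_negNorm (hUdt.integrableOn hT.le).1) hN]
      with t ht hzt hUeq hwt hNt
    have hrec := hwt.quasiForm_eq (hUtS t) hUeq (z t) hzt.1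
    rw [quasiForm_eq_inner hΩ ha ha_lip ht, hzt.2] at hrec
    have hn := abs_inner_le_negNorm_mul hΩ hzt.1 hNt
    rw [hzt.2] at hn
    -- The reconstruction identity replaces `⟨f - U_t, z⟩` by `⟨α(w), ∇z⟩`, so only a flux
    -- difference and `U^d_t` remain.
    have hIt : I t = inner ℝ (nemytskii Ω a t (grad Ω (w t)) - nemytskii Ω a t (grad Ω (u t)))
        (g t) + inner ℝ (Udt t) (z t) := by
      simp only [hI, hq, hb]
      rw [hproj t ht, inner_neg_left, inner_sub_left, inner_sub_left, inner_sub_left, hrec,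
        inner_sub_left]
      ring
    have key := mul_norm_sq_sub_le_of_monotone hal
      (norm_nemytskii_sub_le hΩ ha ha_lip ht (grad Ω (w t)) (grad Ω (Uc t)))
      (le_inner_nemytskii_sub hΩ ha ha_lip ha_mono ht (grad Ω (Uc t)) (grad Ω (u t))) hn hIt
    refine (ENNReal.ofReal_le_ofReal key).trans (le_of_eq ?_)
    rw [ENNReal.ofReal_mul (inv_pos.2 hal).le, ENNReal.ofReal_pow (by positivity),
      ENNReal.ofReal_add (by positivity) ENNReal.toReal_nonneg, ENNReal.ofReal_mul hau.le,
      ENNReal.ofReal_toReal hNt, ofReal_norm]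
  refine ⟨mg.1, le_of_mul_sq_le hal (norm_nonneg _) ?_⟩
  have e1 : timeL2 T (fun t => ‖g t‖ₑ) ^ 2 = ENNReal.ofReal (∫ t, ‖g t‖ ^ 2 ∂μ) := by
    rw [timeL2_sq, ofReal_integral_eq_lintegral_ofReal ig
      (Eventually.of_forall fun t => by positivity)]
    refine lintegral_congr fun t => ?_
    rw [ENNReal.ofReal_pow (norm_nonneg _), ofReal_norm]
  have e2 : al * ∫ t, ‖g t‖ ^ 2 ∂μ = (∫ t, (al * ‖g t‖ ^ 2 - 2 * I t) ∂μ) + 2 * ∫ t, I t ∂μ := by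
    rw [integral_sub (ig.const_mul al) (iI.const_mul 2), integral_const_mul, integral_const_mul]
    ring
  have e3 : 2 * ∫ t, I t ∂μ ≤ ‖Uc 0 - u₀‖ ^ 2 := by
    have : z 0 = Uc 0 - u₀ := by rw [hz, ← hu.initial]
    rw [← this]
    linarith
  rw [e1, ← ENNReal.ofReal_mul hal.le, e2]
  refine ENNReal.ofReal_add_le.trans (add_le_add ?_ (ENNReal.ofReal_le_ofReal e3))
  refine (ofReal_integral_le_lintegral_ofReal iF).trans ((lintegral_mono_ae hpt).trans ?_)
  rw [lintegral_const_mul' _ _ (by simp), timeL2_sq]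

end IPDG

/-! ### The a posteriori error bound. -/

open IPDG in
theorem theorem3p4
    {d : ℕ} (hd : d = 2 ∨ d = 3) {Ω : Set (E d)} (hΩ : IsOpen Ω) (M : Mesh d Ω)
    (p : ℕ) (Cσ θ T al au : ℝ)
    (hCσ : 0 < Cσ) (hθ : θ = -1 ∨ θ = 0 ∨ θ = 1) (hT : 0 < T) (hal : 0 < al) (hau : 0 < au)
    -- the nonlinearity, with monotonicity constant `al` and Lipschitz constant `au`
    (a : ℝ → E d → ℝ → ℝ)
    (ha : UniformContinuousOn (fun q : ℝ × E d × ℝ => a q.1 q.2.1 q.2.2)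
      (Icc 0 T ×ˢ closure Ω ×ˢ Ici 0))
    (ha_lip : ∀ t ∈ Icc 0 T, ∀ x ∈ closure Ω, ∀ y z : E d,
      ‖a t x ‖y‖ • y - a t x ‖z‖ • z‖ ≤ au * ‖y - z‖)
    (ha_mono : ∀ t ∈ Icc 0 T, ∀ x ∈ closure Ω, ∀ y z : E d,
      al * ‖y - z‖ ^ 2 ≤ inner ℝ (a t x ‖y‖ • y - a t x ‖z‖ • z) (y - z))
    -- the exact solution, the semidiscrete solution, the elliptic reconstruction
    (f : ℝ → L2 Ω) (hf : MemLp f ∞ (volume.restrict (Ioc 0 T)))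
    (u₀ : L2 Ω) (u U w : ℝ → L2 Ω)
    (hu : IsWeakSolution Ω T a f u₀ u)
    (hU : M.IsSemidiscreteSolution p Cσ θ T a f U)
    (hw : ∀ᵐ t ∂volume.restrict (Ioc 0 T),
      M.IsEllipticReconstruction p Cσ θ a t (f t) (U t) (w t))
    -- the decomposition into a conforming and a nonconforming part
    (Uc Ud Udt : ℝ → L2 Ω)
    (hUc : ∀ t ∈ Icc 0 T, Uc t ∈ M.Sp p ∧ Uc t ∈ H10 Ω)
    (hUd : ∀ t ∈ Icc 0 T, Ud t = U t - Uc t)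
    (hUdt : HasTimeDeriv T Ud Udt) :
    timeL2 T (fun t => M.energyNorm p Cσ (U t - u t)) ≤
      ENNReal.ofReal (1 + √2 * au * al⁻¹) * timeL2 T (fun t => M.energyNorm p Cσ (w t - U t))
      + ENNReal.ofReal ((√al)⁻¹ * (‖u₀ - U 0‖ + ‖Ud 0‖))
      + ENNReal.ofReal (1 + √2 * au * al⁻¹) * timeL2 T (fun t => M.energyNorm p Cσ (Ud t))
      + ENNReal.ofReal (√2 * al⁻¹) * timeL2 T (fun t => negNorm Ω (Udt t)) := by
  obtain ⟨n, rfl⟩ : ∃ n, d = n + 1 := by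
    rcases hd with rfl | rfl
    · exact ⟨1, rfl⟩
    · exact ⟨2, rfl⟩
  have hfin := M.finiteDimensional_spSub hΩ p
  have hC₂ : ENNReal.ofReal (√2 * al⁻¹) ≠ 0 := by
    simp only [ne_eq, ENNReal.ofReal_eq_zero, not_le]
    positivity
  -- Since `C_2 > 0`, an infinite dual norm of `U^d_t` makes the right side infinite. Otherwise that
  -- norm is finite for a.e. time, as the energy estimate requires.
  rcases eq_or_ne (timeL2 T (fun t => negNorm Ω (Udt t))) ⊤ with hN | hN
  · rw [hN, ENNReal.mul_top hC₂]
    simp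
  obtain ⟨hgm, hest⟩ := energy_estimate hΩ M hT hal hau ha ha_lip ha_mono hf hu hU hw hUc hUd
    hUdt hN
  have m0 : (0 : ℝ) ∈ Icc 0 T := ⟨le_rfl, hT.le⟩
  have hIoc : ∀ᵐ t ∂volume.restrict (Ioc 0 T), t ∈ Icc 0 T := by
    filter_upwards [ae_restrict_mem measurableSet_Ioc] with t ht using Ioc_subset_Icc_self ht
  have hzero : M.energyNorm p Cσ 0 = 0 := by
    have h0 : (0 : L2 Ω) ∈ H10 Ω := (H10Sub Ω).zero_mem
    refine le_antisymm ((M.energyNorm_le_enorm_grad hΩ p Cσ h0).trans (le_of_eq ?_)) zero_le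
    have := grad_smul hΩ 0 h0
    rw [zero_smul, zero_smul] at this
    rw [this, enorm_zero]
  have mUd : AEMeasurable (fun t => M.energyNorm p Cσ (Ud t)) (volume.restrict (Ioc 0 T)) :=
    aemeasurable_extendedSeminorm_comp (M.spSub p) (M.energyNorm p Cσ) hzero
      (M.energyNorm_add_le p Cσ) (fun c hc x => M.energyNorm_smul_le p Cσ hc x)
      (hUdt.continuousOn hT.le) fun t ht => by
        rw [hUd t ht]
        exact sub_mem (M.mem_spSub.2 (hU.mem_Sp t ht)) (M.mem_spSub.2 (hUc t ht).1)
  set X₁ := timeL2 T (fun t => M.energyNorm p Cσ (w t - U t))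
  set X₂ := timeL2 T (fun t => M.energyNorm p Cσ (Ud t))
  set X₃ := timeL2 T (fun t => negNorm Ω (Udt t))
  -- The measurable summand here is `‖∇z‖`; no measurability of the norm of `e` is claimed.
  have hsplit : timeL2 T (fun t => M.energyNorm p Cσ (U t - u t)) ≤
      X₂ + timeL2 T (fun t => ‖grad Ω (Uc t) - grad Ω (u t)‖ₑ) := by
    refine (timeL2_mono_ae ?_).trans (timeL2_add_le hgm.enorm)
    filter_upwards [hIoc, hu.mem_H10] with t ht hut
    have e : U t - u t = Ud t + (Uc t - u t) := by rw [hUd t ht]; abel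
    rw [e, ← grad_sub hΩ (hUc t ht).2 hut]
    exact (M.energyNorm_add_le p Cσ _ _).trans (add_le_add le_rfl
      (M.energyNorm_le_enorm_grad hΩ p Cσ ((H10Sub Ω).sub_mem (hUc t ht).2 hut)))
  -- Only the conforming difference `w - U^c = ε + U^d` has a weak gradient, which is why `U^d`
  -- enters a second time, with factor `al⁻¹ * au`.
  have hw' : timeL2 T (fun t => ‖grad Ω (w t) - grad Ω (Uc t)‖ₑ) ≤ X₁ + X₂ := by
    refine (timeL2_mono_ae ?_).trans (timeL2_add_le mUd)
    filter_upwards [hIoc, hw] with t ht hwt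
    have e : w t - Uc t = (w t - U t) + Ud t := by rw [hUd t ht]; abel
    rw [← grad_sub hΩ hwt.1 (hUc t ht).2]
    refine (M.enorm_grad_le_energyNorm hΩ p Cσ ((H10Sub Ω).sub_mem hwt.1 (hUc t ht).2)).trans ?_
    rw [e]
    exact M.energyNorm_add_le p Cσ _ _
  have hN' : timeL2 T (fun t => ENNReal.ofReal au * ‖grad Ω (w t) - grad Ω (Uc t)‖ₑ +
      negNorm Ω (Udt t)) ≤ ENNReal.ofReal au * (X₁ + X₂) + X₃ := by
    refine (timeL2_add_le (aemeasurable_negNorm (hUdt.integrableOn hT.le).1)).trans ?_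
    rw [timeL2_const_mul ENNReal.ofReal_ne_top]
    gcongr
  have hinit : ‖Uc 0 - u₀‖ ≤ ‖u₀ - U 0‖ + ‖Ud 0‖ := by
    have e : Uc 0 - u₀ = -((u₀ - U 0) + Ud 0) := by rw [hUd 0 m0]; abel
    rw [e, norm_neg]
    exact norm_add_le _ _
  have hi : 0 < al⁻¹ := inv_pos.2 hal
  have h2 : 1 ≤ √2 := Real.one_le_sqrt.2 one_le_two
  -- The constants obtained are `al⁻¹ au` for `ε`, `1 + al⁻¹ au` for `U^d` and `al⁻¹` for `U^d_t`;
  -- all are enlarged to the stated ones.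
  have hc : 1 + al⁻¹ * au ≤ 1 + √2 * au * al⁻¹ := by
    have : 0 ≤ au * al⁻¹ := by positivity
    nlinarith
  have c1 : ENNReal.ofReal al⁻¹ * ENNReal.ofReal au ≤ ENNReal.ofReal (1 + √2 * au * al⁻¹) := by
    rw [← ENNReal.ofReal_mul hi.le]
    exact ENNReal.ofReal_le_ofReal (by linarith)
  have c2 : 1 + ENNReal.ofReal al⁻¹ * ENNReal.ofReal au ≤
      ENNReal.ofReal (1 + √2 * au * al⁻¹) := by
    rw [← ENNReal.ofReal_mul hi.le, ← ENNReal.ofReal_one,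
      ← ENNReal.ofReal_add zero_le_one (by positivity)]
    exact ENNReal.ofReal_le_ofReal hc
  have c3 : ENNReal.ofReal al⁻¹ ≤ ENNReal.ofReal (√2 * al⁻¹) :=
    ENNReal.ofReal_le_ofReal (le_mul_of_one_le_left hi.le h2)
  calc timeL2 T (fun t => M.energyNorm p Cσ (U t - u t))
      ≤ X₂ + (ENNReal.ofReal al⁻¹ * (ENNReal.ofReal au * (X₁ + X₂) + X₃) +
          ENNReal.ofReal ((√al)⁻¹ * (‖u₀ - U 0‖ + ‖Ud 0‖))) := by
        refine hsplit.trans (add_le_add le_rfl (hest.trans ?_))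
        gcongr
    _ = ENNReal.ofReal al⁻¹ * ENNReal.ofReal au * X₁ +
          ENNReal.ofReal ((√al)⁻¹ * (‖u₀ - U 0‖ + ‖Ud 0‖)) +
          (1 + ENNReal.ofReal al⁻¹ * ENNReal.ofReal au) * X₂ + ENNReal.ofReal al⁻¹ * X₃ := by ring
    _ ≤ _ := by gcongr
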